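/- Let $E$ be a finite set (of edges) and let $z=(z_r)_{r\in R}\in\mathbb{C}^R$ be finitely many analytic regulators (for Feynman integrals: the dimension $D$ and the propagator powers $a_e$). A parametric integrand is a family of functions of $\alpha\in(0,\infty)^E$ $$F(z,\alpha)=\frac{N(z,\alpha)}{q(z)}\prod_{i} p_i(\alpha)^{s_i(z)}$$ (a finite product), where the $p_i\in\mathbb{R}[\alpha_e : e\in E]$ are non-zero homogeneous polynomials with non-negative coefficients (e.g. the variables $\alpha_e$ and the graph polynomials $\psi,\varphi$), the exponents $s_i$ are affine functions of $z$, $N\in\mathbb{C}[z][\alpha]$ is homogeneous in $\alpha$, $0\neq q\in\mathbb{C}[z]$, and $\deg_\alpha N+\sum_i s_i\deg p_i=-|E|$. It is non-zero if $N\ne 0$. For disjoint $J,K\subset E$ let $F_J^K$ be obtained from $F$ by $\alpha_e\mapsto\lambda\alpha_e$ for $e\in J$ and $\alpha_e\mapsto\lambda^{-1}\alpha_e$ for $e\in K$. Let $\deg_J^K(F)$ be the polynomial $s(z)$ such that, for generic $z$ (off the zero set of a non-zero polynomial), the limit $\lim_{\lambda\to0^+}\lambda^{-s(z)}F_J^K$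 exists for all $\alpha\in(0,\infty)^E$ and is not identically zero, and put $\omega_J^K(F)=|J|-|K|+\deg_J^K(F)$. If $F=0$, then $\omega_J^K(F)=\infty$. For a fixed edge $e_0$, let $\int F\,\Omega$ be the integral of $F\,\delta(1-\alpha_{e_0})$ over $(0,\infty)^E$. A meromorphic function $I$ on $\mathbb{C}^R$ is the analytically regularised integral of $F$ if the set of all $z$ with $q(z)\neq0$ for which $\int F\,\Omega$ converges absolutely has non-empty interior, and $I(z)=\int F\,\Omega$ on this interior. Let $F$ be a non-zero parametric integrand. Then $\omega_{J'}^{K'}(F)$ exists and is unique for all disjoint $J',K'\subset E$. Let $J,K\subset E$ be disjoint with $\emptyset\neq J\cup K\subsetneq E$, suppose that $\omega_J^K(F)$ is not identically zero, and put $$\widetilde F=F-\frac{1}{\omega_J^K(F)}\Big(\sum_{e\in J}\partial_e(\alpha_e F)-\sum_{e\in K}\partial_e(\alpha_e F)\Big),\qquad \partial_e=\frac{\partial}{\partial\alpha_e}.$$ Then $\widetilde F$ is again a parametric integrand, with the same polynomials $p_i$ and with $q$ replaced by $q\cdot\omega_J^K(F)$, and 1. for each $e_0\in E$ for which the set of absolute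 convergence of $\int F\,\Omega$ has non-empty interior, there is a meromorphic function $I$ on $\mathbb{C}^R$ which is the analytically regularised integral of both $F$ and $\widetilde F$, so $\int F\,\Omega=\int\widetilde F\,\Omega$ as analytically regularised integrals; 2. $\omega_{J'}^{K'}(\widetilde F)\ge\omega_{J'}^{K'}(F)$ for all disjoint $J',K'\subset E$, in the sense that $\widetilde F=0$ or the difference is a constant non-negative integer; 3. $\omega_J^K(\widetilde F)\ge\omega_J^K(F)+1$, in the same sense. -/

import Mathlib

open scoped Topology

/-- A parametric integrand in the Schwinger parameters `α e` (`e ∈ E`), depending on finitely many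
analytic regulators `z r` (`r ∈ R`; for Feynman integrals the dimension `D` and the propagator
powers `a e`):
`F(z, α) = numer(z, α) / denom(z) * ∏ i, (poly i)(α) ^ (expo i)(z)`.
The `poly i` (for Feynman integrals the graph polynomials `ψ`, `φ` and the variables `α e`) are
non-zero homogeneous polynomials with non-negative coefficients, the exponents are affine functions
of the regulators, the numerator is a homogeneous polynomial in `α` and the coefficients are
rational functions of the regulators. The total homogeneity degree in `α` is `-|E|`, so that
`F Ω` is a projective differential form. -/
structure ParametricIntegrand (E R ι : Type*) [Fintype E] [Fintype ι] where
  poly : ι → MvPolynomial E ℝ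
  polyDeg : ι → ℕ
  expo : ι → MvPolynomial R ℂ
  numer : MvPolynomial E (MvPolynomial R ℂ)
  numerDeg : ℕ
  denom : MvPolynomial R ℂ
  poly_ne_zero : ∀ i, poly i ≠ 0
  poly_coeff_nonneg : ∀ i m, 0 ≤ (poly i).coeff m
  poly_homogeneous : ∀ i, (poly i).IsHomogeneous (polyDeg i)
  expo_affine : ∀ i, (expo i).totalDegree ≤ 1
  numer_homogeneous : numer.IsHomogeneous numerDeg
  denom_ne_zero : denom ≠ 0
  degree_eq : (numerDeg : MvPolynomial R ℂ) + ∑ i, (polyDeg i : MvPolynomial R ℂ) * expo i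
    = -(Fintype.card E : MvPolynomial R ℂ)

/-- The replacement `α e ↦ t α e` for `e ∈ J` and `α e ↦ t⁻¹ α e` for `e ∈ K`. -/
noncomputable def rescale {E : Type*} [DecidableEq E] (J K : Finset E) (t : ℝ) (α : E → ℝ) :
    E → ℝ :=
  fun e => if e ∈ J then t * α e else if e ∈ K then t⁻¹ * α e else α e

/-- `s` is the degree of vanishing of the function `f` of the Schwinger parameters when `α e → 0`
for `e ∈ J` and `α e → ∞` for `e ∈ K`: the limit of `t ^ (-s) * f_J^K` for `t → 0` exists and is
not (identically) zero. -/
def HasVanishingDegreeAt {E : Type*} [DecidableEq E] (f : (E → ℝ) → ℂ) (J K : Finset E)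
    (s : ℂ) : Prop :=
  ∃ L : (E → ℝ) → ℂ,
    (∃ α : E → ℝ, (∀ e, 0 < α e) ∧ L α ≠ 0) ∧
    ∀ α : E → ℝ, (∀ e, 0 < α e) →
      Filter.Tendsto (fun t : ℝ => (t : ℂ) ^ (-s) * f (rescale J K t α)) (𝓝[>] 0) (𝓝 (L α))

/-- The differential operator
`1 - (1/w) * (∑ e ∈ J, ∂_e α_e - ∑ e ∈ K, ∂_e α_e)` applied to `f` (a composition of operators:
first multiply by `α e`, then differentiate). -/
noncomputable def anapartial {E : Type*} [DecidableEq E] (J K : Finset E) (w : ℂ)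
    (f : (E → ℝ) → ℂ) (α : E → ℝ) : ℂ :=
  f α - 1 / w *
    (∑ e ∈ J, deriv (fun t : ℝ => (t : ℂ) * f (Function.update α e t)) (α e)
      - ∑ e ∈ K, deriv (fun t : ℝ => (t : ℂ) * f (Function.update α e t)) (α e))

/-- A function on `ℂ^R` is meromorphic when it is locally a quotient of two holomorphic functions
with denominator not identically zero; values on the zero locus of the denominator do not matter. -/
def IsMeromorphic {R : Type*} [Fintype R] (I : (R → ℂ) → ℂ) : Prop :=
  ∀ z₀ : R → ℂ, ∃ g h : (R → ℂ) → ℂ, AnalyticAt ℂ g z₀ ∧ AnalyticAt ℂ h z₀ ∧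
    (¬ ∀ᶠ z in 𝓝 z₀, h z = 0) ∧ ∀ᶠ z in 𝓝 z₀, h z ≠ 0 → I z = g z / h z

/-- The point of the hyperplane `α e₀ = 1` with the remaining coordinates `x`. -/
def onHyperplane {E : Type*} [DecidableEq E] (e₀ : E) (x : {e : E // e ≠ e₀} → ℝ) : E → ℝ :=
  fun e => if h : e = e₀ then 1 else x ⟨e, h⟩

namespace ParametricIntegrand

variable {E R ι : Type*} [Fintype E] [DecidableEq E] [Fintype R] [Fintype ι]

/-- The value `F(z, α)` of the integrand. -/
noncomputable def value (F : ParametricIntegrand E R ι) (z : R → ℂ) (α : E → ℝ) : ℂ :=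
  MvPolynomial.eval₂ (MvPolynomial.eval z) (fun e => (α e : ℂ)) F.numer
    / MvPolynomial.eval z F.denom
    * ∏ i, ((MvPolynomial.eval α (F.poly i) : ℝ) : ℂ) ^ (MvPolynomial.eval z (F.expo i))

/-- `l`, a function of the regulators, is the degree of vanishing `deg_J^K(F)`, for generic
values of the regulators (off the zero set of some non-zero polynomial). -/
def HasVanishingDegree (F : ParametricIntegrand E R ι) (J K : Finset E)
    (l : MvPolynomial R ℂ) : Prop :=
  ∃ c : MvPolynomial R ℂ, c ≠ 0 ∧ ∀ z : R → ℂ, MvPolynomial.eval z c ≠ 0 →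
    MvPolynomial.eval z F.denom ≠ 0 ∧
    HasVanishingDegreeAt (F.value z) J K (MvPolynomial.eval z l)

/-- `w = |J| - |K| + deg_J^K(F)` is the degree of divergence `ω_J^K(F)`. -/
def HasDivergenceDegree (F : ParametricIntegrand E R ι) (J K : Finset E)
    (w : MvPolynomial R ℂ) : Prop :=
  ∃ l : MvPolynomial R ℂ, F.HasVanishingDegree J K l ∧
    w = (J.card : MvPolynomial R ℂ) - (K.card : MvPolynomial R ℂ) + l

/-- The projective integral `∫ F Ω`, i.e. the integral of `F δ(1 - α e₀)` over all
`α e ∈ (0, ∞)`, at the value `z` of the regulators. -/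
noncomputable def projIntegral (F : ParametricIntegrand E R ι) (e₀ : E) (z : R → ℂ) : ℂ :=
  ∫ x in {x : {e : E // e ≠ e₀} → ℝ | ∀ e, 0 < x e}, F.value z (onHyperplane e₀ x)

/-- The regulators at which `F` is defined and `∫ F Ω` is absolutely convergent. -/
def convergenceSet (F : ParametricIntegrand E R ι) (e₀ : E) : Set (R → ℂ) :=
  {z | MvPolynomial.eval z F.denom ≠ 0 ∧
    MeasureTheory.IntegrableOn (fun x => F.value z (onHyperplane e₀ x))
      {x : {e : E // e ≠ e₀} → ℝ | ∀ e, 0 < x e}}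

/-- `I` is the analytically regularized integral of `F`: the domain of absolute convergence is
non-empty and `I` is a meromorphic function of all regulators which coincides with `∫ F Ω` on that
domain. -/
def IsAnalyticRegularization (F : ParametricIntegrand E R ι) (e₀ : E) (I : (R → ℂ) → ℂ) : Prop :=
  (interior (F.convergenceSet e₀)).Nonempty ∧ IsMeromorphic I ∧
    ∀ z ∈ interior (F.convergenceSet e₀), I z = F.projIntegral e₀ z

end ParametricIntegrand

/-! Let v be the weight 1 on J, -1 on K and 0 elsewhere, and θ = ∑ v_e α_e ∂_e. Then F̃ = (b F - θ
F) / ω with b = ω - (|J| - |K|) = deg_J^K(F). Since θ multiplies a monomial of v-weight d by d, the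
operator b - θ annihilates the leading part of F for (J, K). Weights are integers, so the degree
rises by at least one (`eulerNumer_weightGE_add_one`). For other pairs, θ creates no monomials of
lower weight (`eulerNumer_weightGE`). Clearing the denominators of the logarithmic derivatives of
the p_i lowers each exponent s_i by one.

The difference F - F̃ is a divergence. Because F has degree -|E|, the weight v may be shifted by the
constant v_{e₀}, which makes the vector field tangent to the hyperplane α_{e₀} = 1. In logarithmic
coordinates y the integrand is a combination of Euler–Mellin integrands exp(m y) ∏ f_i(y)^{s_i},
with f_i positive sums of exponentials, and the difference is a directional derivative. Its integral
vanishes (`integral_mellinIntegrand_mul_mellinLogDeriv`, `projIntegral_eulerIntegrand`).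

The remaining work concerns the regularised integrals. The logarithm of f_i stays within bounded
distance of a piecewise linear function `trop`, so negative linear growth in all directions implies
convergence. Conversely, such decay holds for every monomial of the numerator on the interior of the
convergence set (`interior_convergenceSet_subset`). Integration by parts in a direction v yields a
contiguity relation in which the exponentials that are maximal at v drop out, so the remaining
integrals decay faster near v. By compactness finitely many directions suffice, and iteration
continues the integral meromorphically to any ball (`hasContinuation_mellinIntegral`).

The integral of F̃ may converge on a larger set than that of F. Both domains of decay are convex,
hence connected, and the identity theorem provides one meromorphic function for both integrals
(`exists_isMeromorphic`). -/

/-! ### Analytic dependence of exponential integrals on parameters -/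

section AnalyticIntegral

open MeasureTheory

/-- An integral of `φ * exp (∑ i, w i * g i)` with an exponential moment is analytic in all the
parameters `w`. -/
theorem analyticAt_integral_mul_cexp {T ι : Type*} [MeasurableSpace T] {μ : Measure T} [Fintype ι]
    {φ : T → ℂ} {g : ι → T → ℝ} (hφ : AEStronglyMeasurable φ μ)
    (hg : ∀ i, AEStronglyMeasurable (g i) μ) {r : ℝ} (hr : 0 < r)
    (hint : Integrable (fun t => ‖φ t‖ * Real.exp (r * ∑ i, |g i t|)) μ) :
    AnalyticAt ℂ (fun w : ι → ℂ => ∫ t, φ t * Complex.exp (∑ i, w i * g i t) ∂μ) 0 := by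
  set G : T → ℝ := fun t => ∑ i, |g i t| with hG
  have hG0 : ∀ t, 0 ≤ G t := fun t => Finset.sum_nonneg fun i _ => abs_nonneg _
  have hGm : AEStronglyMeasurable G μ :=
    Finset.aestronglyMeasurable_fun_sum _ fun i _ => (hg i).norm
  let l : T → (ι → ℂ) → ℂ := fun t w => ∑ i, w i * g i t
  have hlm : ∀ w, AEStronglyMeasurable (fun t => l t w) μ := fun w =>
    Finset.aestronglyMeasurable_fun_sum _ fun i _ =>
      (Complex.continuous_ofReal.comp_aestronglyMeasurable (hg i)).const_mul _
  have hlb : ∀ t w, ‖l t w‖ ≤ ‖w‖ * G t := by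
    intro t w
    refine (norm_sum_le _ _).trans ?_
    rw [hG, Finset.mul_sum]
    refine Finset.sum_le_sum fun i _ => ?_
    rw [norm_mul, Complex.norm_real, Real.norm_eq_abs]
    exact mul_le_mul_of_nonneg_right (norm_le_pi_norm w i) (abs_nonneg _)
  -- One exponential moment controls all power moments, and the factor r^(-n) gives the power series
  -- a radius of convergence of at least r.
  have hpow : ∀ (n : ℕ) t, G t ^ n / n.factorial ≤ (r ^ n)⁻¹ * Real.exp (r * G t) := by
    intro n t
    have h := Real.pow_div_factorial_le_exp (r * G t) (mul_nonneg hr.le (hG0 t)) n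
    rw [mul_pow, mul_div_assoc] at h
    rw [inv_mul_eq_div, le_div_iff₀ (by positivity), mul_comm]
    exact h
  set K : ℝ := ∫ t, ‖φ t‖ * Real.exp (r * G t) ∂μ with hK
  let u : (n : ℕ) → (Fin n → ι → ℂ) → T → ℂ := fun n v t =>
    φ t * ((n.factorial : ℂ)⁻¹ * ∏ k, l t (v k))
  have hum : ∀ n v, AEStronglyMeasurable (u n v) μ := fun n v =>
    hφ.mul ((Finset.aestronglyMeasurable_fun_prod _ fun k _ => hlm (v k)).const_mul _)
  have hub : ∀ n v t, ‖u n v t‖ ≤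
      ((r ^ n)⁻¹ * ∏ k, ‖v k‖) * (‖φ t‖ * Real.exp (r * G t)) := by
    intro n v t
    have h1 : ∏ k, ‖l t (v k)‖ ≤ (∏ k, ‖v k‖) * G t ^ n := by
      calc ∏ k, ‖l t (v k)‖ ≤ ∏ k, (‖v k‖ * G t) :=
            Finset.prod_le_prod (fun _ _ => norm_nonneg _) fun k _ => hlb t _
        _ = _ := by simp [Finset.prod_mul_distrib]
    have h2 := hpow n t
    have h3 : 0 ≤ ∏ k, ‖v k‖ := Finset.prod_nonneg fun _ _ => norm_nonneg _
    simp only [u, norm_mul, norm_inv, Complex.norm_natCast, norm_prod]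
    calc ‖φ t‖ * ((n.factorial : ℝ)⁻¹ * ∏ k, ‖l t (v k)‖)
        ≤ ‖φ t‖ * ((n.factorial : ℝ)⁻¹ * ((∏ k, ‖v k‖) * G t ^ n)) := by gcongr
      _ = ‖φ t‖ * ((∏ k, ‖v k‖) * (G t ^ n / n.factorial)) := by ring
      _ ≤ ‖φ t‖ * ((∏ k, ‖v k‖) * ((r ^ n)⁻¹ * Real.exp (r * G t))) := by gcongr
      _ = _ := by ring
  have hui : ∀ n v, Integrable (u n v) μ := fun n v =>
    (hint.const_mul _).mono' (hum n v) (Filter.Eventually.of_forall (hub n v))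
  let p : FormalMultilinearSeries ℂ (ι → ℂ) ℂ := fun n =>
    MultilinearMap.mkContinuous
      { toFun := fun v => ∫ t, u n v t ∂μ
        map_update_add' := by
          intro _ v k x y
          rw [← integral_add (hui _ _) (hui _ _)]
          refine integral_congr_ae (Filter.Eventually.of_forall fun t => ?_)
          have hl : l t (x + y) = l t x + l t y := by
            simp [l, add_mul, Finset.sum_add_distrib]
          have h1 : ∀ x, ∏ j, l t (Function.update v k x j)
              = l t x * ∏ j ∈ Finset.univ.erase k, l t (v j) := by
            intro x
            rw [← Finset.mul_prod_erase _ _ (Finset.mem_univ k)]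
            congr 1
            · simp
            · refine Finset.prod_congr rfl fun j hj => ?_
              rw [Function.update_of_ne (Finset.ne_of_mem_erase hj)]
          simp only [u]
          -- The axioms of a multilinear map quantify over the `DecidableEq` instance; it is
          -- identified with the canonical one before rewriting.
          have := Subsingleton.elim ‹DecidableEq (Fin n)› (instDecidableEqFin n)
          subst this
          rw [h1, h1, h1, hl]
          ring
        map_update_smul' := by
          intro _ v k c x
          rw [smul_eq_mul, ← integral_const_mul]
          refine integral_congr_ae (Filter.Eventually.of_forall fun t => ?_)
          have hl : l t (c • x) = c * l t x := by
            simp [l, Finset.mul_sum, mul_assoc]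
          have h1 : ∀ x, ∏ j, l t (Function.update v k x j)
              = l t x * ∏ j ∈ Finset.univ.erase k, l t (v j) := by
            intro x
            rw [← Finset.mul_prod_erase _ _ (Finset.mem_univ k)]
            congr 1
            · simp
            · refine Finset.prod_congr rfl fun j hj => ?_
              rw [Function.update_of_ne (Finset.ne_of_mem_erase hj)]
          simp only [u]
          have := Subsingleton.elim ‹DecidableEq (Fin n)› (instDecidableEqFin n)
          subst this
          rw [h1, h1, hl]
          ring } ((r ^ n)⁻¹ * K) (by
        intro v
        refine (norm_integral_le_of_norm_le (hint.const_mul _)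
          (Filter.Eventually.of_forall (hub n v))).trans (le_of_eq ?_)
        rw [integral_const_mul, hK]
        ring)
  have hK0 : 0 ≤ K := integral_nonneg fun t => by positivity
  have hpn : ∀ n, ‖p n‖ * r ^ n ≤ K := by
    intro n
    have h1 : ‖p n‖ ≤ (r ^ n)⁻¹ * K := MultilinearMap.mkContinuous_norm_le _ (by positivity) _
    calc ‖p n‖ * r ^ n ≤ (r ^ n)⁻¹ * K * r ^ n := by gcongr
      _ = K := by field_simp
  refine ⟨p, ⟨ENNReal.ofReal r, ⟨?_, by simpa using hr, ?_⟩⟩⟩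
  · have := p.le_radius_of_bound K (r := r.toNNReal) (by
      intro n; rw [Real.coe_toNNReal _ hr.le]; exact hpn n)
    exact this
  · intro w hw
    have hw' : ‖w‖ < r := by
      rw [Metric.eball_ofReal] at hw
      simpa using hw
    rw [zero_add]
    have hterm : ∀ n, p n (fun _ => w) = ∫ t, φ t * ((n.factorial : ℂ)⁻¹ * l t w ^ n) ∂μ := by
      intro n
      change ∫ t, u n (fun _ => w) t ∂μ = _
      simp [u]
    simp only [hterm]
    -- Termwise integration of the exponential series: the absolute values sum to ‖φ‖ exp(‖w‖ G),
    -- which the assumed moment dominates because ‖w‖ < r.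
    refine hasSum_integral_of_dominated_convergence
      (fun n t => ‖φ t‖ * ((‖w‖ * G t) ^ n / n.factorial)) ?_ ?_ ?_ ?_ ?_
    · intro n
      exact hφ.mul (((hlm w).pow n).const_mul _)
    · intro n
      refine Filter.Eventually.of_forall fun t => ?_
      rw [norm_mul, norm_mul, norm_inv, norm_pow, Complex.norm_natCast, div_eq_inv_mul]
      gcongr
      exact hlb t w
    · exact Filter.Eventually.of_forall fun t =>
        (Real.summable_pow_div_factorial _).mul_left _
    · refine hint.mono' ?_ (Filter.Eventually.of_forall fun t => ?_)
      · have : (fun t => ∑' n : ℕ, ‖φ t‖ * ((‖w‖ * G t) ^ n / n.factorial))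
            = fun t => ‖φ t‖ * Real.exp (‖w‖ * G t) := by
          funext t
          rw [tsum_mul_left, Real.exp_eq_exp_ℝ, NormedSpace.exp_eq_tsum_div]
        rw [this]
        exact hφ.norm.mul (Real.continuous_exp.comp_aestronglyMeasurable (hGm.const_mul _))
      · rw [tsum_mul_left]
        have : ∑' n : ℕ, ((‖w‖ * G t) ^ n / n.factorial) = Real.exp (‖w‖ * G t) := by
          rw [Real.exp_eq_exp_ℝ, NormedSpace.exp_eq_tsum_div]
        rw [this, Real.norm_of_nonneg (by positivity)]
        have := hG0 t
        gcongr
    · refine Filter.Eventually.of_forall fun t => ?_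
      refine HasSum.mul_left _ ?_
      have := NormedSpace.expSeries_div_hasSum_exp (𝔸 := ℂ) (l t w)
      rw [← Complex.exp_eq_exp_ℂ] at this
      simpa [div_eq_inv_mul] using this

end AnalyticIntegral

/-! ### Positive sums of exponentials and their tropicalisation -/

/-- A non-empty sum of exponentials of linear forms with positive coefficients. -/
structure PosExpSum (κ Y : Type*) [NormedAddCommGroup Y] [NormedSpace ℝ Y] where
  supp : Finset κ
  slope : κ → Y →L[ℝ] ℝ
  coef : κ → ℝ
  nonempty : supp.Nonempty
  coef_pos : ∀ k ∈ supp, 0 < coef k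

namespace PosExpSum

variable {κ Y : Type*} [NormedAddCommGroup Y] [NormedSpace ℝ Y] (f : PosExpSum κ Y)

/-- The value of the sum of exponentials. -/
noncomputable def val (y : Y) : ℝ := ∑ k ∈ f.supp, f.coef k * Real.exp (f.slope k y)

/-- The piecewise linear function describing the growth of the sum of exponentials. -/
noncomputable def trop (y : Y) : ℝ := f.supp.sup' f.nonempty fun k => f.slope k y

theorem val_pos (y : Y) : 0 < f.val y :=
  Finset.sum_pos (fun k hk => mul_pos (f.coef_pos k hk) (Real.exp_pos _)) f.nonempty

theorem le_trop {k : κ} (hk : k ∈ f.supp) (y : Y) : f.slope k y ≤ f.trop y :=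
  Finset.le_sup' (fun k => f.slope k y) hk

theorem exists_trop_eq (y : Y) : ∃ k ∈ f.supp, f.trop y = f.slope k y :=
  Finset.exists_mem_eq_sup' f.nonempty fun k => f.slope k y

theorem trop_add_le (x y : Y) : f.trop (x + y) ≤ f.trop x + f.trop y :=
  Finset.sup'_le _ _ fun k hk => by
    rw [map_add]; exact add_le_add (f.le_trop hk x) (f.le_trop hk y)

theorem trop_smul {t : ℝ} (ht : 0 ≤ t) (y : Y) : f.trop (t • y) = t * f.trop y := by
  apply le_antisymm
  · refine Finset.sup'_le _ _ fun k hk => ?_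
    rw [map_smul, smul_eq_mul]
    exact mul_le_mul_of_nonneg_left (f.le_trop hk y) ht
  · obtain ⟨k, hk, h⟩ := f.exists_trop_eq y
    rw [h, ← smul_eq_mul, ← map_smul]
    exact f.le_trop hk _

@[fun_prop]
theorem continuous_trop : Continuous f.trop :=
  Continuous.finset_sup'_apply f.nonempty fun k _ => (f.slope k).continuous

theorem exists_abs_trop_le : ∃ C, 0 ≤ C ∧ ∀ y, |f.trop y| ≤ C * ‖y‖ := by
  refine ⟨∑ k ∈ f.supp, ‖f.slope k‖, Finset.sum_nonneg fun _ _ => norm_nonneg _, fun y => ?_⟩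
  obtain ⟨k, hk, h⟩ := f.exists_trop_eq y
  rw [h]
  refine ((f.slope k).le_opNorm y).trans ?_
  gcongr
  exact Finset.single_le_sum (f := fun k => ‖f.slope k‖) (fun _ _ => norm_nonneg _) hk

/-- Positive coefficients exclude cancellation: the sum lies between exp(`trop`) times the smallest
coefficient and exp(`trop`) times the sum of all coefficients. -/
theorem exists_abs_log_sub_trop_le : ∃ C, 0 ≤ C ∧ ∀ y, |Real.log (f.val y) - f.trop y| ≤ C := by
  obtain ⟨k₀, hk₀, hmin⟩ := f.supp.exists_min_image f.coef f.nonempty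
  have hS : 0 < ∑ k ∈ f.supp, f.coef k := Finset.sum_pos f.coef_pos f.nonempty
  refine ⟨max |Real.log (f.coef k₀)| |Real.log (∑ k ∈ f.supp, f.coef k)|,
    (abs_nonneg _).trans (le_max_left _ _), fun y => ?_⟩
  have hlow : f.coef k₀ * Real.exp (f.trop y) ≤ f.val y := by
    obtain ⟨k, hk, h⟩ := f.exists_trop_eq y
    rw [h]
    calc f.coef k₀ * Real.exp (f.slope k y) ≤ f.coef k * Real.exp (f.slope k y) := by
          gcongr; exact hmin k hk
      _ ≤ _ := Finset.single_le_sum (f := fun k => f.coef k * Real.exp (f.slope k y))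
          (fun j hj => (mul_pos (f.coef_pos j hj) (Real.exp_pos _)).le) hk
  have hup : f.val y ≤ (∑ k ∈ f.supp, f.coef k) * Real.exp (f.trop y) := by
    rw [Finset.sum_mul]
    refine Finset.sum_le_sum fun k hk => ?_
    have := (f.coef_pos k hk).le
    gcongr
    exact f.le_trop hk y
  have h1 := Real.log_le_log (mul_pos (f.coef_pos _ hk₀) (Real.exp_pos _)) hlow
  have h2 := Real.log_le_log (f.val_pos y) hup
  rw [Real.log_mul (f.coef_pos _ hk₀).ne' (Real.exp_pos _).ne', Real.log_exp] at h1
  rw [Real.log_mul hS.ne' (Real.exp_pos _).ne', Real.log_exp] at h2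
  rw [abs_le]
  have h3 := neg_abs_le (Real.log (f.coef k₀))
  have h4 := le_abs_self (Real.log (∑ k ∈ f.supp, f.coef k))
  have h5 := le_max_left |Real.log (f.coef k₀)| |Real.log (∑ k ∈ f.supp, f.coef k)|
  have h6 := le_max_right |Real.log (f.coef k₀)| |Real.log (∑ k ∈ f.supp, f.coef k)|
  constructor <;> linarith

@[fun_prop]
theorem continuous_val : Continuous f.val :=
  continuous_finsetSum _ fun k _ =>
    continuous_const.mul (Real.continuous_exp.comp (f.slope k).continuous)

@[fun_prop]
theorem continuous_log_val : Continuous fun y => Real.log (f.val y) :=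
  f.continuous_val.log fun y => (f.val_pos y).ne'

/-- The directional derivative of a sum of exponentials. -/
noncomputable def dirDeriv (v y : Y) : ℝ :=
  ∑ k ∈ f.supp, f.coef k * Real.exp (f.slope k y) * f.slope k v

theorem hasDerivAt_log_val (v y : Y) :
    HasDerivAt (fun t : ℝ => Real.log (f.val (y + t • v))) (f.dirDeriv v y / f.val y) 0 := by
  have h : HasDerivAt (fun t : ℝ => f.val (y + t • v)) (f.dirDeriv v y) 0 := by
    refine HasDerivAt.fun_sum fun k _ => ?_
    have h1 : HasDerivAt (fun t : ℝ => f.slope k (y + t • v)) (f.slope k v) 0 := by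
      simp only [map_add, map_smul, smul_eq_mul]
      simpa using ((hasDerivAt_id (0 : ℝ)).mul_const (f.slope k v)).const_add (f.slope k y)
    have h2 := (h1.exp).const_mul (f.coef k)
    simpa [mul_assoc] using h2
  simpa using h.log (by simpa using (f.val_pos y).ne')

end PosExpSum

/-! ### Euler–Mellin integrals -/

section EulerMellin

open MeasureTheory

variable {ι κ Y : Type*} [Fintype ι] [NormedAddCommGroup Y] [NormedSpace ℝ Y]
  (f : ι → PosExpSum κ Y)

/-- The integrand `exp (m y) * ∏ i, (f i y) ^ (s i)` of an Euler–Mellin integral in logarithmic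
coordinates. -/
noncomputable def mellinIntegrand (m : Y →L[ℝ] ℝ) (s : ι → ℂ) (y : Y) : ℂ :=
  Complex.exp (m y + ∑ i, s i * (Real.log ((f i).val y) : ℝ))

/-- The linear growth rate of the integrand of an Euler–Mellin integral. -/
noncomputable def mellinGrowth (m : Y →L[ℝ] ℝ) (s : ι → ℂ) (y : Y) : ℝ :=
  m y + ∑ i, (s i).re * (f i).trop y

/-- The exponents for which the integrand decays in all directions. -/
def mellinDomain (m : Y →L[ℝ] ℝ) : Set (ι → ℂ) :=
  {s | ∀ y, y ≠ 0 → mellinGrowth f m s y < 0}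

theorem norm_mellinIntegrand (m : Y →L[ℝ] ℝ) (s : ι → ℂ) (y : Y) :
    ‖mellinIntegrand f m s y‖ = Real.exp (m y + ∑ i, (s i).re * Real.log ((f i).val y)) := by
  rw [mellinIntegrand, Complex.norm_exp]
  congr 1
  simp

theorem mellinGrowth_smul (m : Y →L[ℝ] ℝ) (s : ι → ℂ) {t : ℝ} (ht : 0 ≤ t) (y : Y) :
    mellinGrowth f m s (t • y) = t * mellinGrowth f m s y := by
  simp only [mellinGrowth, map_smul, smul_eq_mul, PosExpSum.trop_smul _ ht, mul_add,
    Finset.mul_sum]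
  congr 1
  exact Finset.sum_congr rfl fun i _ => by ring

theorem continuous_mellinGrowth (m : Y →L[ℝ] ℝ) (s : ι → ℂ) :
    Continuous (mellinGrowth f m s) :=
  m.continuous.add (continuous_finsetSum _ fun i _ => continuous_const.mul (f i).continuous_trop)

theorem continuous_mellinIntegrand (m : Y →L[ℝ] ℝ) (s : ι → ℂ) :
    Continuous (mellinIntegrand f m s) := by
  refine Complex.continuous_exp.comp ?_
  refine (Complex.continuous_ofReal.comp m.continuous).add ?_
  refine continuous_finsetSum _ fun i _ => continuous_const.mul ?_
  exact Complex.continuous_ofReal.comp (f i).continuous_log_val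

theorem exists_abs_log_norm_sub_mellinGrowth_le (m : Y →L[ℝ] ℝ) (s : ι → ℂ) :
    ∃ C, 0 ≤ C ∧ ∀ y,
      |m y + ∑ i, (s i).re * Real.log ((f i).val y) - mellinGrowth f m s y| ≤ C := by
  choose C hC0 hC using fun i => (f i).exists_abs_log_sub_trop_le
  refine ⟨∑ i, |(s i).re| * C i,
    Finset.sum_nonneg fun i _ => mul_nonneg (abs_nonneg _) (hC0 i), fun y => ?_⟩
  have : m y + ∑ i, (s i).re * Real.log ((f i).val y) - mellinGrowth f m s y
      = ∑ i, (s i).re * (Real.log ((f i).val y) - (f i).trop y) := by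
    simp only [mellinGrowth, mul_sub, Finset.sum_sub_distrib]
    ring
  rw [this]
  refine (Finset.abs_sum_le_sum_abs _ _).trans (Finset.sum_le_sum fun i _ => ?_)
  rw [abs_mul]
  exact mul_le_mul_of_nonneg_left (hC i y) (abs_nonneg _)

/-- The growth is continuous and positively homogeneous, so its maximum on the compact unit sphere
is a uniform rate of decay. In the zero space the sphere is empty and any rate will do. -/
theorem exists_mellinGrowth_le [FiniteDimensional ℝ Y] {m : Y →L[ℝ] ℝ} {s : ι → ℂ}
    (hs : s ∈ mellinDomain f m) :
    ∃ δ, 0 < δ ∧ ∀ y, mellinGrowth f m s y ≤ -δ * ‖y‖ := by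
  have : ProperSpace Y := FiniteDimensional.proper ℝ Y
  have hcomp : IsCompact (Metric.sphere (0 : Y) 1) := isCompact_sphere 0 1
  obtain hne | hne := (Metric.sphere (0 : Y) 1).eq_empty_or_nonempty
  · refine ⟨1, one_pos, fun y => ?_⟩
    have hy : y = 0 := by
      by_contra hy
      have h : ‖y‖⁻¹ • y ∈ Metric.sphere (0 : Y) 1 := by
        simp [norm_smul, hy]
      rw [hne] at h
      exact h
    subst hy
    have := mellinGrowth_smul f m s le_rfl (0 : Y)
    simpa using this.le
  · obtain ⟨y₀, hy₀, hmax⟩ := hcomp.exists_isMaxOn hne (continuous_mellinGrowth f m s).continuousOn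
    have hy₀' : y₀ ≠ 0 := by
      rintro rfl
      simp at hy₀
    refine ⟨-mellinGrowth f m s y₀, by linarith [hs y₀ hy₀'], fun y => ?_⟩
    by_cases hy : y = 0
    · subst hy
      have := mellinGrowth_smul f m s le_rfl (0 : Y)
      simpa using this.le
    · have h1 : mellinGrowth f m s (‖y‖⁻¹ • y) ≤ mellinGrowth f m s y₀ :=
        hmax (show ‖y‖⁻¹ • y ∈ Metric.sphere (0 : Y) 1 by simp [norm_smul, hy])
      have h2 : y = ‖y‖ • (‖y‖⁻¹ • y) := by
        rw [smul_smul, mul_inv_cancel₀ (norm_ne_zero_iff.2 hy), one_smul]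
      rw [h2, mellinGrowth_smul f m s (norm_nonneg y), ← h2]
      have := mul_le_mul_of_nonneg_left h1 (norm_nonneg y)
      linarith

/-- The exponential is bounded by a multiple of (1 + ‖y‖)^(-n), where n exceeds the dimension. -/
theorem integrable_exp_neg_mul_norm [FiniteDimensional ℝ Y] [MeasurableSpace Y] [BorelSpace Y]
    (μ : Measure Y) [μ.IsAddHaarMeasure] {δ : ℝ} (hδ : 0 < δ) :
    Integrable (fun y => Real.exp (-δ * ‖y‖)) μ := by
  set n := Module.finrank ℝ Y + 1 with hn
  have h := integrable_one_add_norm (μ := μ) (E := Y) (r := n) (by rw [hn]; push_cast; linarith)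
  refine (h.const_mul (Real.exp δ * (n.factorial / δ ^ n))).mono'
    (by fun_prop : Continuous _).aestronglyMeasurable (Filter.Eventually.of_forall fun y => ?_)
  have hpos : 0 < 1 + ‖y‖ := by positivity
  have h1 := Real.pow_div_factorial_le_exp (δ * (1 + ‖y‖)) (by positivity) n
  rw [Real.norm_of_nonneg (Real.exp_pos _).le, Real.rpow_neg hpos.le, Real.rpow_natCast]
  rw [mul_pow] at h1
  have h2 : Real.exp (-δ * ‖y‖) = Real.exp δ * (Real.exp (δ * (1 + ‖y‖)))⁻¹ := by
    rw [← Real.exp_neg, ← Real.exp_add]; congr 1; ring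
  rw [h2, mul_assoc]
  gcongr
  rw [inv_le_comm₀ (Real.exp_pos _) (by positivity)]
  refine le_trans (le_of_eq ?_) h1
  field_simp

/-- By `exists_abs_trop_le`, a small change of s alters the growth by at most a small multiple of
‖y‖, which the uniform rate δ absorbs. -/
theorem isOpen_mellinDomain [FiniteDimensional ℝ Y] (m : Y →L[ℝ] ℝ) : IsOpen (mellinDomain f m) := by
  rw [isOpen_iff_mem_nhds]
  intro s hs
  obtain ⟨δ, hδ, hg⟩ := exists_mellinGrowth_le f hs
  choose B hB0 hB using fun i => (f i).exists_abs_trop_le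
  have hBs : 0 ≤ ∑ i, B i := Finset.sum_nonneg fun i _ => hB0 i
  have hpos : 0 < δ / (∑ i, B i + 1) := by positivity
  filter_upwards [Metric.ball_mem_nhds s hpos] with z hz y hy
  have hy' := norm_pos_iff.2 hy
  have hdiff : mellinGrowth f m z y - mellinGrowth f m s y ≤ ‖z - s‖ * ((∑ i, B i) * ‖y‖) := by
    have : mellinGrowth f m z y - mellinGrowth f m s y
        = ∑ i, ((z - s) i).re * (f i).trop y := by
      simp only [mellinGrowth, Pi.sub_apply, Complex.sub_re, sub_mul, Finset.sum_sub_distrib]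
      ring
    rw [this, Finset.sum_mul, Finset.mul_sum]
    refine Finset.sum_le_sum fun i _ => (le_abs_self _).trans ?_
    rw [abs_mul]
    exact mul_le_mul ((Complex.abs_re_le_norm _).trans (norm_le_pi_norm (z - s) i)) (hB i y)
      (abs_nonneg _) (norm_nonneg _)
  have hz' : ‖z - s‖ * (∑ i, B i + 1) < δ := by
    rw [Metric.mem_ball, dist_eq_norm, lt_div_iff₀ (by positivity)] at hz
    exact hz
  have := hg y
  nlinarith [norm_nonneg (z - s), mul_lt_mul_of_pos_right hz' hy',
    mul_nonneg (norm_nonneg (z - s)) hy'.le]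

variable [FiniteDimensional ℝ Y] [MeasurableSpace Y] [BorelSpace Y]
  (μ : Measure Y) [μ.IsAddHaarMeasure]

theorem exists_integrable_mellinIntegrand_mul_exp {m : Y →L[ℝ] ℝ} {s : ι → ℂ}
    (hs : s ∈ mellinDomain f m) :
    ∃ r, 0 < r ∧ Integrable (fun y => ‖mellinIntegrand f m s y‖ *
      Real.exp (r * ∑ i, |Real.log ((f i).val y)|)) μ := by
  obtain ⟨δ, hδ, hg⟩ := exists_mellinGrowth_le f hs
  obtain ⟨C, hC0, hC⟩ := exists_abs_log_norm_sub_mellinGrowth_le f m s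
  choose A hA0 hA using fun i => (f i).exists_abs_log_sub_trop_le
  choose B hB0 hB using fun i => (f i).exists_abs_trop_le
  have hlog : ∀ y, ∑ i, |Real.log ((f i).val y)| ≤ ∑ i, A i + (∑ i, B i) * ‖y‖ := by
    intro y
    rw [Finset.sum_mul, ← Finset.sum_add_distrib]
    refine Finset.sum_le_sum fun i _ => ?_
    have h1 := hA i y
    have h2 := hB i y
    have h3 := abs_add_le (Real.log ((f i).val y) - (f i).trop y) ((f i).trop y)
    rw [sub_add_cancel] at h3
    linarith
  have hBs : 0 ≤ ∑ i, B i := Finset.sum_nonneg fun i _ => hB0 i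
  -- With this r the additional exponential factor uses up at most half of the rate of decay δ.
  set r := δ / (2 * (∑ i, B i + 1)) with hr
  have hr0 : 0 < r := by positivity
  have hrB : r * ∑ i, B i ≤ δ / 2 := by
    rw [hr, div_mul_eq_mul_div, div_le_div_iff₀ (by positivity) two_pos]
    nlinarith
  refine ⟨r, hr0, ?_⟩
  refine ((integrable_exp_neg_mul_norm μ (half_pos hδ)).const_mul
    (Real.exp (C + r * ∑ i, A i))).mono' ?_ (Filter.Eventually.of_forall fun y => ?_)
  · refine Continuous.aestronglyMeasurable ((continuous_mellinIntegrand f m s).norm.mul ?_)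
    refine Real.continuous_exp.comp (continuous_const.mul ?_)
    exact continuous_finsetSum _ fun i _ => (f i).continuous_log_val.abs
  · rw [norm_mellinIntegrand, Real.norm_of_nonneg (by positivity), ← Real.exp_add, ← Real.exp_add]
    refine Real.exp_le_exp.2 ?_
    have h1 := (abs_le.1 (hC y)).2
    have h2 := hg y
    have h3 := mul_le_mul_of_nonneg_left (hlog y) hr0.le
    have h4 := mul_le_mul_of_nonneg_right hrB (norm_nonneg y)
    nlinarith

theorem integrable_mellinIntegrand {m : Y →L[ℝ] ℝ} {s : ι → ℂ} (hs : s ∈ mellinDomain f m) :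
    Integrable (mellinIntegrand f m s) μ := by
  obtain ⟨r, hr, h⟩ := exists_integrable_mellinIntegrand_mul_exp f μ hs
  refine h.mono' (continuous_mellinIntegrand f m s).aestronglyMeasurable
    (Filter.Eventually.of_forall fun y => ?_)
  refine le_mul_of_one_le_right (norm_nonneg _) (Real.one_le_exp ?_)
  exact mul_nonneg hr.le (Finset.sum_nonneg fun _ _ => abs_nonneg _)

/-- The Euler–Mellin integral, as a function of the exponents. -/
noncomputable def mellinIntegral (m : Y →L[ℝ] ℝ) (s : ι → ℂ) : ℂ :=
  ∫ y, mellinIntegrand f m s y ∂μ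

/-- Passing from s to z multiplies the integrand by exp(∑ (z_i - s_i) log f_i), so
`analyticAt_integral_mul_cexp` applies with the exponential moment found above. -/
theorem analyticAt_mellinIntegral {m : Y →L[ℝ] ℝ} {s : ι → ℂ} (hs : s ∈ mellinDomain f m) :
    AnalyticAt ℂ (mellinIntegral f μ m) s := by
  obtain ⟨r, hr, h⟩ := exists_integrable_mellinIntegrand_mul_exp f μ hs
  have h1 := analyticAt_integral_mul_cexp
    (continuous_mellinIntegrand f m s).aestronglyMeasurable
    (fun i => (f i).continuous_log_val.aestronglyMeasurable) hr h
  have h2 : AnalyticAt ℂ (fun z : ι → ℂ => z - s) s := by fun_prop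
  have h3 := AnalyticAt.comp_of_eq h1 h2 (sub_self s)
  convert! h3 using 1
  funext z
  simp only [mellinIntegral, Function.comp]
  refine integral_congr_ae (Filter.Eventually.of_forall fun y => ?_)
  simp only [mellinIntegrand, Pi.sub_apply, ← Complex.exp_add, sub_mul, Finset.sum_sub_distrib]
  congr 1
  ring

end EulerMellin

/-! ### Linear relations between Euler–Mellin integrals -/

section MellinRelations

open MeasureTheory

variable {ι κ Y : Type*} [Fintype ι] [DecidableEq ι] [NormedAddCommGroup Y] [NormedSpace ℝ Y]
  (f : ι → PosExpSum κ Y)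

theorem mellinGrowth_add_slope_sub_single (m : Y →L[ℝ] ℝ) (s : ι → ℂ) (i : ι) (k : κ) (y : Y) :
    mellinGrowth f (m + (f i).slope k) (s - Pi.single i 1) y
      = mellinGrowth f m s y + ((f i).slope k y - (f i).trop y) := by
  have h : ∑ j, ((Pi.single i 1 : ι → ℂ) j).re * (f j).trop y = (f i).trop y := by
    rw [Finset.sum_eq_single i]
    · simp
    · intro j _ hj
      simp [hj]
    · simp
  simp only [mellinGrowth, add_apply, Pi.sub_apply, Complex.sub_re, sub_mul,
    Finset.sum_sub_distrib, h]
  ring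

/-- Trading one power of f_i for one of its exponentials changes the growth by slope minus `trop`,
which is never positive. Hence all terms of the relations below converge where the original integral
does. -/
theorem sub_single_mem_mellinDomain {m : Y →L[ℝ] ℝ} {s : ι → ℂ} (hs : s ∈ mellinDomain f m)
    {i : ι} {k : κ} (hk : k ∈ (f i).supp) :
    s - Pi.single i 1 ∈ mellinDomain f (m + (f i).slope k) := by
  intro y hy
  rw [mellinGrowth_add_slope_sub_single]
  linarith [hs y hy, (f i).le_trop hk y]

theorem mellinIntegrand_add_slope_sub_single (m : Y →L[ℝ] ℝ) (s : ι → ℂ) (i : ι) (k : κ) (y : Y) :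
    mellinIntegrand f (m + (f i).slope k) (s - Pi.single i 1) y
      = mellinIntegrand f m s y * ((Real.exp ((f i).slope k y) / (f i).val y : ℝ) : ℂ) := by
  have h : ∑ j, (Pi.single i 1 : ι → ℂ) j * ((Real.log ((f j).val y) : ℝ) : ℂ)
      = ((Real.log ((f i).val y) : ℝ) : ℂ) := by
    rw [Finset.sum_eq_single i]
    · simp
    · intro j _ hj
      simp [hj]
    · simp
  have h2 : (Real.exp ((f i).slope k y) / (f i).val y : ℝ)
      = Real.exp ((f i).slope k y - Real.log ((f i).val y)) := by
    rw [Real.exp_sub, Real.exp_log ((f i).val_pos y)]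
  rw [h2, Complex.ofReal_exp, mellinIntegrand, mellinIntegrand, ← Complex.exp_add]
  congr 1
  simp only [add_apply, Pi.sub_apply, sub_mul, Finset.sum_sub_distrib, h]
  push_cast
  ring

/-- The logarithmic derivative of the integrand of an Euler–Mellin integral in the direction `v`. -/
noncomputable def mellinLogDeriv (m : Y →L[ℝ] ℝ) (s : ι → ℂ) (v y : Y) : ℂ :=
  m v + ∑ i, s i * (((f i).dirDeriv v y / (f i).val y : ℝ) : ℂ)

omit [DecidableEq ι] in
theorem hasLineDerivAt_mellinIntegrand (m : Y →L[ℝ] ℝ) (s : ι → ℂ) (v y : Y) :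
    HasLineDerivAt ℝ (mellinIntegrand f m s) (mellinIntegrand f m s y * mellinLogDeriv f m s v y)
      y v := by
  have h1 : HasDerivAt (fun t : ℝ => m (y + t • v)) (m v) 0 := by
    simp only [map_add, map_smul, smul_eq_mul]
    simpa using ((hasDerivAt_id (0 : ℝ)).mul_const (m v)).const_add (m y)
  have h2 : HasDerivAt (fun t : ℝ => ((m (y + t • v) : ℝ) : ℂ) +
      ∑ i, s i * ((Real.log ((f i).val (y + t • v)) : ℝ) : ℂ)) (mellinLogDeriv f m s v y) 0 :=
    h1.ofReal_comp.add (HasDerivAt.fun_sum fun i _ =>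
      (((f i).hasDerivAt_log_val v y).ofReal_comp.const_mul (s i)))
  have h3 := h2.cexp
  simpa [HasLineDerivAt, mellinIntegrand] using h3

theorem mellinIntegrand_mul_mellinLogDeriv (m : Y →L[ℝ] ℝ) (s : ι → ℂ) (v y : Y) :
    mellinIntegrand f m s y * mellinLogDeriv f m s v y = m v * mellinIntegrand f m s y +
      ∑ i, ∑ k ∈ (f i).supp, (s i * ((f i).coef k * (f i).slope k v : ℝ)) *
        mellinIntegrand f (m + (f i).slope k) (s - Pi.single i 1) y := by
  simp only [mellinIntegrand_add_slope_sub_single, mellinLogDeriv, mul_add, Finset.mul_sum,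
    PosExpSum.dirDeriv, Finset.sum_div, Complex.ofReal_sum]
  congr 1
  · ring
  · refine Finset.sum_congr rfl fun i _ => Finset.sum_congr rfl fun k _ => ?_
    push_cast
    ring

theorem mellinIntegrand_eq_sum (m : Y →L[ℝ] ℝ) (s : ι → ℂ) (i : ι) (y : Y) :
    mellinIntegrand f m s y = ∑ k ∈ (f i).supp, ((f i).coef k : ℂ) *
        mellinIntegrand f (m + (f i).slope k) (s - Pi.single i 1) y := by
  have h : ∑ k ∈ (f i).supp, ((f i).coef k : ℂ) *
      ((Real.exp ((f i).slope k y) / (f i).val y : ℝ) : ℂ) = 1 := by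
    have : ∑ k ∈ (f i).supp, (f i).coef k * (Real.exp ((f i).slope k y) / (f i).val y) = 1 := by
      simp only [← mul_div_assoc, ← Finset.sum_div]
      exact div_self ((f i).val_pos y).ne'
    rw [← Complex.ofReal_one, ← this]
    push_cast
    rfl
  simp only [mellinIntegrand_add_slope_sub_single]
  calc mellinIntegrand f m s y = mellinIntegrand f m s y * 1 := (mul_one _).symm
    _ = _ := by
      rw [← h, Finset.mul_sum]
      exact Finset.sum_congr rfl fun k _ => by ring

variable [FiniteDimensional ℝ Y] [MeasurableSpace Y] [BorelSpace Y]
  (μ : Measure Y) [μ.IsAddHaarMeasure]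

omit [DecidableEq ι] in
theorem integrable_mellinIntegrand_mul_mellinLogDeriv {m : Y →L[ℝ] ℝ} {s : ι → ℂ}
    (hs : s ∈ mellinDomain f m) (v : Y) :
    Integrable (fun y => mellinIntegrand f m s y * mellinLogDeriv f m s v y) μ := by
  classical
  simp only [mellinIntegrand_mul_mellinLogDeriv]
  refine ((integrable_mellinIntegrand f μ hs).const_mul _).add ?_
  exact integrable_finsetSum _ fun i _ => integrable_finsetSum _ fun k hk =>
    (integrable_mellinIntegrand f μ (sub_single_mem_mellinDomain f hs hk)).const_mul _

-- Integration by parts against the constant 1: integrability of the function and of its line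
-- derivative suffices, and no boundary term has to be estimated.
omit [DecidableEq ι] in
theorem integral_mellinIntegrand_mul_mellinLogDeriv {m : Y →L[ℝ] ℝ} {s : ι → ℂ}
    (hs : s ∈ mellinDomain f m) (v : Y) :
    ∫ y, mellinIntegrand f m s y * mellinLogDeriv f m s v y ∂μ = 0 := by
  have h := integral_bilinear_hasLineDerivAt_right_eq_neg_left_of_integrable (μ := μ) (v := v)
    (B := ContinuousLinearMap.mul ℝ ℂ) (f := fun _ => (1 : ℂ)) (f' := fun _ => 0)
    (g := mellinIntegrand f m s)
    (g' := fun y => mellinIntegrand f m s y * mellinLogDeriv f m s v y) (by simp)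
    (by simpa using integrable_mellinIntegrand_mul_mellinLogDeriv f μ hs v)
    (by simpa using integrable_mellinIntegrand f μ hs)
    (fun x _ => hasDerivAt_const _ _)
    (fun x _ => hasLineDerivAt_mellinIntegrand f m s v x)
  simpa using h

theorem mellinIntegral_eq_sum {m : Y →L[ℝ] ℝ} {s : ι → ℂ} (hs : s ∈ mellinDomain f m) (i : ι) :
    mellinIntegral f μ m s = ∑ k ∈ (f i).supp, ((f i).coef k : ℂ) *
        mellinIntegral f μ (m + (f i).slope k) (s - Pi.single i 1) := by
  simp only [mellinIntegral, ← integral_const_mul]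
  rw [← integral_finsetSum]
  · exact integral_congr_ae (Filter.Eventually.of_forall fun y => mellinIntegrand_eq_sum f m s i y)
  · exact fun k hk =>
      (integrable_mellinIntegrand f μ (sub_single_mem_mellinDomain f hs hk)).const_mul _

theorem mellinIntegral_dirDeriv_eq_zero {m : Y →L[ℝ] ℝ} {s : ι → ℂ}
    (hs : s ∈ mellinDomain f m) (v : Y) :
    m v * mellinIntegral f μ m s +
      ∑ i, ∑ k ∈ (f i).supp, (s i * ((f i).coef k * (f i).slope k v : ℝ)) *
        mellinIntegral f μ (m + (f i).slope k) (s - Pi.single i 1) = 0 := by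
  rw [← integral_mellinIntegrand_mul_mellinLogDeriv f μ hs v]
  simp only [mellinIntegrand_mul_mellinLogDeriv, mellinIntegral, ← integral_const_mul]
  have hint : ∀ i, ∀ k ∈ (f i).supp, Integrable (fun y =>
      (s i * ((f i).coef k * (f i).slope k v : ℝ)) *
        mellinIntegrand f (m + (f i).slope k) (s - Pi.single i 1) y) μ := fun i k hk =>
    (integrable_mellinIntegrand f μ (sub_single_mem_mellinDomain f hs hk)).const_mul _
  rw [integral_add ((integrable_mellinIntegrand f μ hs).const_mul _)
    (integrable_finsetSum _ fun i _ => integrable_finsetSum _ (hint i)), integral_finsetSum]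
  · congr 1
    exact Finset.sum_congr rfl fun i _ => (integral_finsetSum _ (hint i)).symm
  · exact fun i _ => integrable_finsetSum _ (hint i)

/-- The contiguity relation of Euler–Mellin integrals in the direction `v`. -/
theorem mellinIntegral_contiguity {m : Y →L[ℝ] ℝ} {s : ι → ℂ}
    (hs : s ∈ mellinDomain f m) (v : Y) :
    -(m v + ∑ i, s i * ((f i).trop v : ℝ)) * mellinIntegral f μ m s =
      ∑ i, ∑ k ∈ (f i).supp,
        (s i * ((f i).coef k * ((f i).slope k v - (f i).trop v) : ℝ)) *
          mellinIntegral f μ (m + (f i).slope k) (s - Pi.single i 1) := by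
  have h1 := mellinIntegral_dirDeriv_eq_zero f μ hs v
  -- Expanding each s_i `trop`_i(v) I by `mellinIntegral_eq_sum` and subtracting it from `h1`
  -- replaces each slope at v by its distance to the maximal slope. The exponentials maximal at v
  -- then have coefficient zero.
  have h2 : ∑ i, s i * ((f i).trop v : ℝ) * mellinIntegral f μ m s =
      ∑ i, ∑ k ∈ (f i).supp, (s i * ((f i).coef k * (f i).trop v : ℝ)) *
          mellinIntegral f μ (m + (f i).slope k) (s - Pi.single i 1) := by
    refine Finset.sum_congr rfl fun i _ => ?_
    rw [mellinIntegral_eq_sum f μ hs i, Finset.mul_sum]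
    refine Finset.sum_congr rfl fun k _ => ?_
    push_cast
    ring
  have h3 : ∑ i, ∑ k ∈ (f i).supp,
        (s i * ((f i).coef k * ((f i).slope k v - (f i).trop v) : ℝ)) *
          mellinIntegral f μ (m + (f i).slope k) (s - Pi.single i 1)
      = ∑ i, ∑ k ∈ (f i).supp, (s i * ((f i).coef k * (f i).slope k v : ℝ)) *
        mellinIntegral f μ (m + (f i).slope k) (s - Pi.single i 1) -
      ∑ i, ∑ k ∈ (f i).supp, (s i * ((f i).coef k * (f i).trop v : ℝ)) *
          mellinIntegral f μ (m + (f i).slope k) (s - Pi.single i 1) := by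
    rw [← Finset.sum_sub_distrib]
    refine Finset.sum_congr rfl fun i _ => ?_
    rw [← Finset.sum_sub_distrib]
    refine Finset.sum_congr rfl fun k _ => ?_
    push_cast
    ring
  rw [h3, ← h2, ← Finset.sum_mul]
  linear_combination -h1

end MellinRelations

/-! ### Finitely many directions cover the sphere -/

section Covering

variable {ι κ Y : Type*} [Fintype ι] [NormedAddCommGroup Y] [NormedSpace ℝ Y]
  (f : ι → PosExpSum κ Y)

/-- The points at which all slopes that are not maximal at `v` differ from the maximal slope by at
least `ε`. -/
def gapRegion (v : Y) (ε : ℝ) : Set Y :=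
  {y | ∀ i, ∀ k ∈ (f i).supp, (f i).slope k v < (f i).trop v →
    (f i).slope k y ≤ (f i).trop y - ε}

/-- Strict inequalities between the finitely many slopes at v persist near v with a margin.
Compactness of the sphere leaves finitely many v and a common margin ε. -/
theorem exists_finset_sphere_subset_gapRegion [FiniteDimensional ℝ Y] :
    ∃ (V : Finset Y) (ε : ℝ), 0 < ε ∧ (∀ v ∈ V, v ≠ 0) ∧
      ∀ y ∈ Metric.sphere (0 : Y) 1, ∃ v ∈ V, y ∈ gapRegion f v ε := by
  classical
  have : ProperSpace Y := FiniteDimensional.proper ℝ Y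
  refine (isCompact_sphere (0 : Y) 1).induction_on (p := fun S => ∃ (V : Finset Y) (ε : ℝ), 0 < ε ∧
    (∀ v ∈ V, v ≠ 0) ∧ ∀ y ∈ S, ∃ v ∈ V, y ∈ gapRegion f v ε) ?_ ?_ ?_ ?_
  · exact ⟨∅, 1, one_pos, by simp, by simp⟩
  · rintro S T hST ⟨V, ε, h1, h2, h3⟩
    exact ⟨V, ε, h1, h2, fun y hy => h3 y (hST hy)⟩
  · rintro S T ⟨V, ε, h1, h2, h3⟩ ⟨V', ε', h1', h2', h3'⟩
    refine ⟨V ∪ V', min ε ε', lt_min h1 h1', ?_, ?_⟩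
    · intro v hv
      exact (Finset.mem_union.1 hv).elim (h2 v) (h2' v)
    · rintro y (hy | hy)
      · obtain ⟨v, hv, h⟩ := h3 y hy
        exact ⟨v, Finset.mem_union_left _ hv, fun i k hk hlt =>
          (h i k hk hlt).trans (by gcongr; exact min_le_left _ _)⟩
      · obtain ⟨v, hv, h⟩ := h3' y hy
        exact ⟨v, Finset.mem_union_right _ hv, fun i k hk hlt =>
          (h i k hk hlt).trans (by gcongr; exact min_le_right _ _)⟩
  · intro v hv
    have h1 : ∀ᶠ ε : ℝ in 𝓝[>] 0, ∀ i, ∀ k ∈ (f i).supp, (f i).slope k v < (f i).trop v →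
        (f i).slope k v < (f i).trop v - ε := by
      rw [Filter.eventually_all]
      intro i
      rw [Filter.eventually_all_finset]
      intro k _
      by_cases h : (f i).slope k v < (f i).trop v
      · filter_upwards [Ioo_mem_nhdsGT (sub_pos.2 h)] with ε hε _
        linarith [hε.2]
      · exact Filter.Eventually.of_forall fun ε h' => absurd h' h
    obtain ⟨ε, hε, hε0⟩ := (h1.and self_mem_nhdsWithin).exists
    refine ⟨gapRegion f v ε, ?_, {v}, ε, hε0, ?_, fun y hy => ⟨v, by simp, hy⟩⟩
    · refine mem_nhdsWithin_of_mem_nhds ?_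
      have : ∀ᶠ y in 𝓝 v, ∀ i, ∀ k ∈ (f i).supp, (f i).slope k v < (f i).trop v →
          (f i).slope k y ≤ (f i).trop y - ε := by
        rw [Filter.eventually_all]
        intro i
        rw [Filter.eventually_all_finset]
        intro k hk
        by_cases h : (f i).slope k v < (f i).trop v
        · have := (((f i).slope k).continuous.tendsto v).eventually_lt
            (((f i).continuous_trop.sub continuous_const).tendsto v) (hε i k hk h)
          filter_upwards [this] with y hy _
          exact hy.le
        · exact Filter.Eventually.of_forall fun y h' => absurd h' h
      exact this
    · intro w hw
      rw [Finset.mem_singleton.1 hw]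
      rintro rfl
      simp at hv

end Covering

/-! ### Meromorphic continuation -/

/-- `M`, considered on `D₀`, has a continuation to `Ω` as a quotient of an analytic function on `Ω`
by an entire function without zeros in `D₀`. -/
def HasContinuation {Z : Type*} [NormedAddCommGroup Z] [NormedSpace ℂ Z] (D₀ Ω : Set Z)
    (M : Z → ℂ) : Prop :=
  ∃ h g : Z → ℂ, AnalyticOnNhd ℂ h Set.univ ∧ AnalyticOnNhd ℂ g Ω ∧
    ∀ z ∈ D₀, h z ≠ 0 ∧ g z = h z * M z

namespace HasContinuation

variable {Z : Type*} [NormedAddCommGroup Z] [NormedSpace ℂ Z] {D₀ Ω : Set Z}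

theorem of_analytic {M : Z → ℂ} (h : AnalyticOnNhd ℂ M Ω) : HasContinuation D₀ Ω M :=
  ⟨1, M, analyticOnNhd_const, h, fun z _ => by simp⟩

theorem add {M N : Z → ℂ} (hM : HasContinuation D₀ Ω M) (hN : HasContinuation D₀ Ω N) :
    HasContinuation D₀ Ω (fun z => M z + N z) := by
  obtain ⟨h, g, hh, hg, H⟩ := hM
  obtain ⟨h', g', hh', hg', H'⟩ := hN
  refine ⟨h * h', g * h' + g' * h, hh.mul hh',
    (hg.mul (hh'.mono (Set.subset_univ _))).add (hg'.mul (hh.mono (Set.subset_univ _))),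
    fun z hz => ⟨mul_ne_zero (H z hz).1 (H' z hz).1, ?_⟩⟩
  simp only [Pi.add_apply, Pi.mul_apply, (H z hz).2, (H' z hz).2]
  ring

theorem analytic_mul {a M : Z → ℂ} (ha : AnalyticOnNhd ℂ a Set.univ)
    (hM : HasContinuation D₀ Ω M) : HasContinuation D₀ Ω (fun z => a z * M z) := by
  obtain ⟨h, g, hh, hg, H⟩ := hM
  refine ⟨h, a * g, hh, (ha.mono (Set.subset_univ _)).mul hg, fun z hz => ⟨(H z hz).1, ?_⟩⟩
  simp only [Pi.mul_apply, (H z hz).2]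
  ring

theorem finset_sum {τ : Type*} (S : Finset τ) {M : τ → Z → ℂ}
    (hM : ∀ i ∈ S, HasContinuation D₀ Ω (M i)) : HasContinuation D₀ Ω (fun z => ∑ i ∈ S, M i z) := by
  classical
  induction S using Finset.induction_on with
  | empty => simpa using of_analytic (M := fun _ : Z => (0 : ℂ)) analyticOnNhd_const
  | insert i S hi ih =>
    simp only [Finset.sum_insert hi]
    exact (hM i (Finset.mem_insert_self _ _)).add
      (ih fun j hj => hM j (Finset.mem_insert_of_mem hj))

/-- This is the only source of poles: the zeros of `a` join those of the denominator. -/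
theorem of_mul_eq {a M N : Z → ℂ} (ha : AnalyticOnNhd ℂ a Set.univ) (ha0 : ∀ z ∈ D₀, a z ≠ 0)
    (hN : HasContinuation D₀ Ω N) (h : ∀ z ∈ D₀, a z * M z = N z) : HasContinuation D₀ Ω M := by
  obtain ⟨k, g, hk, hg, H⟩ := hN
  refine ⟨k * a, g, hk.mul ha, hg, fun z hz => ⟨mul_ne_zero (H z hz).1 (ha0 z hz), ?_⟩⟩
  rw [(H z hz).2, ← h z hz, Pi.mul_apply]
  ring

end HasContinuation

section MellinContinuation

open MeasureTheory

variable {ι κ Y Z : Type*} [Fintype ι] [NormedAddCommGroup Y] [NormedSpace ℝ Y]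
  (f : ι → PosExpSum κ Y) [FiniteDimensional ℝ Y] [MeasurableSpace Y] [BorelSpace Y]
  (μ : Measure Y) [μ.IsAddHaarMeasure] [NormedAddCommGroup Z] [NormedSpace ℂ Z]
  {σ : Z → ι → ℂ} {D₀ Ω : Set Z}

/-- The factor to divide by in the contiguity relation has real part equal to minus the growth in
the direction v, so it has no zeros on D₀. Only exponentials that are not maximal at v contribute on
the other side. -/
theorem hasContinuation_mellinIntegral_step [DecidableEq ι]
    (hσ : ∀ i, AnalyticOnNhd ℂ (fun z => σ z i) Set.univ)
    {v : Y} (hv : v ≠ 0) {m : Y →L[ℝ] ℝ} {a : ι → ℂ}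
    (hD : ∀ z ∈ D₀, σ z - a ∈ mellinDomain f m)
    (h : ∀ i, ∀ k ∈ (f i).supp, (f i).slope k v < (f i).trop v → HasContinuation D₀ Ω
      fun z => mellinIntegral f μ (m + (f i).slope k) (σ z - (a + Pi.single i 1))) :
    HasContinuation D₀ Ω fun z => mellinIntegral f μ m (σ z - a) := by
  have hσa : ∀ i, AnalyticOnNhd ℂ (fun z => (σ z - a) i) Set.univ := fun i =>
    (hσ i).sub analyticOnNhd_const
  refine HasContinuation.of_mul_eq
    (a := fun z => -(m v + ∑ i, (σ z - a) i * ((f i).trop v : ℝ)))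
    (N := fun z => ∑ i, ∑ k ∈ (f i).supp,
        ((σ z - a) i * ((f i).coef k * ((f i).slope k v - (f i).trop v) : ℝ)) *
          mellinIntegral f μ (m + (f i).slope k) (σ z - a - Pi.single i 1)) ?_ ?_ ?_
    (fun z hz => mellinIntegral_contiguity f μ (hD z hz) v)
  · exact (analyticOnNhd_const.add (Finset.analyticOnNhd_fun_sum _ fun i _ =>
      (hσa i).mul analyticOnNhd_const)).neg
  · intro z hz h0
    have h1 := hD z hz v hv
    have h2 := congrArg Complex.re h0
    simp only [Complex.neg_re, Complex.add_re, Complex.ofReal_re, Complex.re_sum,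
      Complex.re_mul_ofReal, Complex.zero_re] at h2
    simp only [mellinGrowth] at h1
    linarith
  · refine HasContinuation.finset_sum _ fun i _ => HasContinuation.finset_sum _ fun k hk => ?_
    obtain hlt | heq := ((f i).le_trop hk v).lt_or_eq
    · refine HasContinuation.analytic_mul ((hσa i).mul analyticOnNhd_const) ?_
      have := h i k hk hlt
      simpa only [sub_sub] using this
    · simp only [heq, sub_self, mul_zero, Complex.ofReal_zero, zero_mul]
      exact HasContinuation.of_analytic analyticOnNhd_const

/-- The step is applied once for each v in V. Growth never increases along the way, so the gain ε on
`gapRegion f v ε` from the step at v is retained. It is measured at the exponents `-a`, the part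
that does not depend on z. -/
theorem hasContinuation_mellinIntegral_round
    (hσ : ∀ i, AnalyticOnNhd ℂ (fun z => σ z i) Set.univ) {ε : ℝ}
    (V : Finset Y) (hV : ∀ v ∈ V, v ≠ 0) (m : Y →L[ℝ] ℝ) (a : ι → ℂ)
    (hD : ∀ z ∈ D₀, σ z - a ∈ mellinDomain f m)
    (h : ∀ (m' : Y →L[ℝ] ℝ) (a' : ι → ℂ), (∀ z ∈ D₀, σ z - a' ∈ mellinDomain f m') →
      (∀ y, mellinGrowth f m' (-a') y ≤ mellinGrowth f m (-a) y) →
      (∀ v ∈ V, ∀ y ∈ gapRegion f v ε,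
        mellinGrowth f m' (-a') y ≤ mellinGrowth f m (-a) y - ε) →
      HasContinuation D₀ Ω fun z => mellinIntegral f μ m' (σ z - a')) :
    HasContinuation D₀ Ω fun z => mellinIntegral f μ m (σ z - a) := by
  classical
  induction V using Finset.induction_on generalizing m a with
  | empty => exact h m a hD (fun _ => le_rfl) (by simp)
  | insert v V hv ih =>
    refine hasContinuation_mellinIntegral_step f μ hσ (hV v (Finset.mem_insert_self _ _)) hD
      fun i k hk hlt => ?_
    have hg : ∀ y, mellinGrowth f (m + (f i).slope k) (-(a + Pi.single i 1)) y
        = mellinGrowth f m (-a) y + ((f i).slope k y - (f i).trop y) := fun y => by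
      rw [neg_add, ← sub_eq_add_neg, mellinGrowth_add_slope_sub_single]
    refine ih (fun w hw => hV w (Finset.mem_insert_of_mem hw)) _ _ ?_ ?_
    · intro z hz
      rw [← sub_sub]
      exact sub_single_mem_mellinDomain f (hD z hz) hk
    · intro m' a' hD' h1 h2
      have h1' : ∀ y, mellinGrowth f m' (-a') y
          ≤ mellinGrowth f m (-a) y + ((f i).slope k y - (f i).trop y) := fun y =>
        (h1 y).trans_eq (hg y)
      refine h m' a' hD' (fun y => ?_) fun w hw y hy => ?_
      · linarith [h1' y, (f i).le_trop hk y]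
      · obtain rfl | hw := Finset.mem_insert.1 hw
        · linarith [h1' y, hy i k hk hlt]
        · have := h2 w hw y hy
          rw [hg] at this
          linarith [(f i).le_trop hk y]

/-- As the regions cover the sphere, each round lowers the growth by ε on all of it. -/
theorem hasContinuation_mellinIntegral_iterate
    (hσ : ∀ i, AnalyticOnNhd ℂ (fun z => σ z i) Set.univ) {ε : ℝ}
    (V : Finset Y) (hV : ∀ v ∈ V, v ≠ 0)
    (hcov : ∀ y ∈ Metric.sphere (0 : Y) 1, ∃ v ∈ V, y ∈ gapRegion f v ε)
    (n : ℕ) (m : Y →L[ℝ] ℝ) (a : ι → ℂ)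
    (hD : ∀ z ∈ D₀, σ z - a ∈ mellinDomain f m)
    (h : ∀ (m' : Y →L[ℝ] ℝ) (a' : ι → ℂ), (∀ z ∈ D₀, σ z - a' ∈ mellinDomain f m') →
      (∀ y ∈ Metric.sphere (0 : Y) 1,
        mellinGrowth f m' (-a') y ≤ mellinGrowth f m (-a) y - n * ε) →
      HasContinuation D₀ Ω fun z => mellinIntegral f μ m' (σ z - a')) :
    HasContinuation D₀ Ω fun z => mellinIntegral f μ m (σ z - a) := by
  induction n generalizing m a with
  | zero => exact h m a hD (by simp)
  | succ n ih =>
    refine hasContinuation_mellinIntegral_round (ε := ε) f μ hσ V hV m a hD fun m' a' hD' _ h2 => ?_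
    refine ih m' a' hD' fun m'' a'' hD'' h3 => h m'' a'' hD'' fun y hy => ?_
    obtain ⟨v, hv, hvy⟩ := hcov y hy
    have := h2 v hv y hvy
    have := h3 y hy
    push_cast
    linarith

/-- An Euler–Mellin integral has a meromorphic continuation to arbitrarily large balls in the
space of parameters. -/
theorem hasContinuation_mellinIntegral [ProperSpace Z]
    (hσ : ∀ i, AnalyticOnNhd ℂ (fun z => σ z i) Set.univ) {m : Y →L[ℝ] ℝ}
    (hD : ∀ z ∈ D₀, σ z ∈ mellinDomain f m) (R : ℝ) :
    HasContinuation D₀ (Metric.ball 0 R) fun z => mellinIntegral f μ m (σ z) := by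
  have : ProperSpace Y := FiniteDimensional.proper ℝ Y
  obtain ⟨V, ε, hε, hV, hcov⟩ := exists_finset_sphere_subset_gapRegion f
  have hσc : ∀ i, Continuous fun z => σ z i := fun i =>
    continuousOn_univ.1 (hσ i).continuousOn
  have hcont : Continuous fun p : Z × Y => mellinGrowth f m (σ p.1) p.2 := by
    refine (m.continuous.comp continuous_snd).add (continuous_finsetSum _ fun i _ => ?_)
    exact (Complex.continuous_re.comp ((hσc i).comp continuous_fst)).mul
      ((f i).continuous_trop.comp continuous_snd)
  obtain ⟨C, hC⟩ := (((isCompact_closedBall (0 : Z) R).prod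
    (isCompact_sphere (0 : Y) 1)).image hcont).bddAbove
  -- C bounds the original growth for z in the ball and y on the sphere. After n rounds with n ε >
  -- C, every remaining integral converges throughout the ball, hence is analytic there.
  obtain ⟨n, hn⟩ := exists_nat_gt (C / ε)
  rw [div_lt_iff₀ hε] at hn
  have key := hasContinuation_mellinIntegral_iterate (σ := σ) (D₀ := D₀)
    (Ω := Metric.ball 0 R) f μ hσ V hV hcov n m 0
    (by simpa using hD) ?_
  · simpa using key
  · intro m' a' _ h1
    refine HasContinuation.of_analytic fun z hz => ?_
    have hz' : σ z - a' ∈ mellinDomain f m' := by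
      intro y hy
      have hsph : ‖y‖⁻¹ • y ∈ Metric.sphere (0 : Y) 1 := by simp [norm_smul, hy]
      have h2 := h1 _ hsph
      have h3 : mellinGrowth f m (σ z) (‖y‖⁻¹ • y) ≤ C :=
        hC ⟨(z, ‖y‖⁻¹ • y), ⟨Metric.ball_subset_closedBall hz, hsph⟩, rfl⟩
      have h4 : mellinGrowth f m' (σ z - a') (‖y‖⁻¹ • y)
          = mellinGrowth f m' (-a') (‖y‖⁻¹ • y) +
            (mellinGrowth f m (σ z) (‖y‖⁻¹ • y) - mellinGrowth f m (-0) (‖y‖⁻¹ • y)) := by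
        simp only [mellinGrowth, Pi.sub_apply, Pi.neg_apply, Complex.sub_re, Complex.neg_re,
          sub_mul, Finset.sum_sub_distrib, neg_mul, Finset.sum_neg_distrib, neg_zero, Pi.zero_apply,
          Complex.zero_re, zero_mul, Finset.sum_const_zero]
        ring
      have h5 : mellinGrowth f m' (σ z - a') (‖y‖⁻¹ • y) < 0 := by linarith
      rw [mellinGrowth_smul _ _ _ (by positivity)] at h5
      exact (pos_iff_neg_of_mul_neg h5).1 (by positivity)
    have h6 : AnalyticAt ℂ (fun z => σ z - a') z :=
      AnalyticAt.sub (analyticAt_pi_iff.2 fun i => hσ i z (Set.mem_univ _)) analyticAt_const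
    exact AnalyticAt.comp (f := fun z => σ z - a') (analyticAt_mellinIntegral f μ hz') h6

end MellinContinuation

/-! ### Integrability forces decay -/

section Necessity

open MeasureTheory Filter

/-- Along the translates in a fixed direction, the lower limit of the norm of an integrable function
vanishes almost everywhere on every unit ball. -/
theorem ae_liminf_enorm_translate_eq_zero {Y : Type*} [NormedAddCommGroup Y] [NormedSpace ℝ Y]
    [MeasurableSpace Y] [BorelSpace Y] [FiniteDimensional ℝ Y] (μ : Measure Y) [μ.IsAddHaarMeasure]
    {H : Y → ℂ} (hH : Continuous H) (hint : Integrable H μ) {v : Y} (hv : v ≠ 0) (c : Y) :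
    ∀ᵐ y ∂μ, y ∈ Metric.ball c 1 → liminf (fun n : ℕ => ‖H (y + (n : ℝ) • v)‖ₑ) atTop = 0 := by
  set B := Metric.ball c 1 with hB
  have hBm : MeasurableSet B := measurableSet_ball
  let F : ℕ → Y → ENNReal := fun n x => B.indicator (fun _ => ‖H x‖ₑ) (x - (n : ℝ) • v)
  have hmeas : ∀ n, Measurable (F n) := by
    intro n
    have : F n = ((fun x => x - (n : ℝ) • v) ⁻¹' B).indicator (fun x => ‖H x‖ₑ) := by
      funext x
      simp only [F, Set.indicator]
      rfl
    rw [this]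
    exact hH.enorm.measurable.indicator (measurable_id.sub_const _ hBm)
  -- The ball translated by n v eventually misses any given point, so the mass of H on it tends to
  -- zero; Fatou's lemma then makes the lower limit vanish almost everywhere.
  have h1 : Tendsto (fun n => ∫⁻ x, F n x ∂μ) atTop (𝓝 (∫⁻ _, 0 ∂μ)) := by
    refine tendsto_lintegral_of_dominated_convergence (fun x => ‖H x‖ₑ) hmeas ?_ ?_ ?_
    · exact fun n => Eventually.of_forall fun x => Set.indicator_le_self' (by simp) _
    · exact hint.hasFiniteIntegral.ne
    · refine Eventually.of_forall fun x => tendsto_const_nhds.congr' ?_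
      have hv' := norm_pos_iff.2 hv
      obtain ⟨n₀, hn₀⟩ := exists_nat_gt ((1 + ‖x - c‖) / ‖v‖)
      filter_upwards [eventually_ge_atTop n₀] with n hn
      refine (Set.indicator_of_notMem ?_ _).symm
      rw [hB, Metric.mem_ball, dist_eq_norm, not_lt]
      have h2 : (1 + ‖x - c‖) < n * ‖v‖ := by
        rw [div_lt_iff₀ hv'] at hn₀
        have : (n₀ : ℝ) ≤ n := by exact_mod_cast hn
        nlinarith
      have h3 : ‖(n : ℝ) • v‖ = n * ‖v‖ := by simp [norm_smul]
      have h4 : (n : ℝ) • v = (x - c) - (x - (n : ℝ) • v - c) := by abel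
      have h5 := norm_sub_le (x - c) (x - (n : ℝ) • v - c)
      rw [← h4, h3] at h5
      linarith
  have h2 : ∀ n, ∫⁻ x, F n x ∂μ
      = ∫⁻ y, B.indicator (fun y => ‖H (y + (n : ℝ) • v)‖ₑ) y ∂μ := by
    intro n
    rw [← lintegral_add_right_eq_self (F n) ((n : ℝ) • v)]
    refine lintegral_congr fun y => ?_
    change B.indicator (fun _ => ‖H (y + (n : ℝ) • v)‖ₑ) (y + (n : ℝ) • v - (n : ℝ) • v) = _
    rw [add_sub_cancel_right]
    rfl
  simp only [h2, lintegral_zero] at h1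
  have hm : ∀ n : ℕ, Measurable (B.indicator fun y => ‖H (y + (n : ℝ) • v)‖ₑ) := fun n =>
    (hH.comp (continuous_id.add continuous_const)).enorm.measurable.indicator hBm
  have h3 : ∫⁻ y, liminf (fun n : ℕ => B.indicator (fun y => ‖H (y + (n : ℝ) • v)‖ₑ) y) atTop ∂μ
      ≤ liminf (fun n : ℕ => ∫⁻ y, B.indicator (fun y => ‖H (y + (n : ℝ) • v)‖ₑ) y ∂μ) atTop :=
    lintegral_liminf_le hm
  rw [h1.liminf_eq, nonpos_iff_eq_zero, lintegral_eq_zero_iff (Measurable.liminf hm)] at h3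
  filter_upwards [h3] with y hy hyB
  simpa [Set.indicator_of_mem hyB] using hy

variable {ι κ τ Y : Type*} [Fintype ι] [NormedAddCommGroup Y] [NormedSpace ℝ Y]
  (f : ι → PosExpSum κ Y)

theorem mellinIntegrand_eq_exp_mul (m : Y →L[ℝ] ℝ) (s : ι → ℂ) (y : Y) :
    mellinIntegrand f m s y = Real.exp (m y) * mellinIntegrand f 0 s y := by
  simp only [mellinIntegrand]
  rw [Complex.ofReal_exp, ← Complex.exp_add]
  simp

/-- If a combination of Euler–Mellin integrands is integrable, then it decays in every direction in
which its leading part does not vanish. -/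
theorem mellinGrowth_neg_of_integrable [FiniteDimensional ℝ Y] [MeasurableSpace Y] [BorelSpace Y]
    (μ : Measure Y) [μ.IsAddHaarMeasure] (S : Finset τ) (l : τ → Y →L[ℝ] ℝ) (c : τ → ℂ)
    (s : ι → ℂ) (hint : Integrable (fun y => ∑ k ∈ S, c k * mellinIntegrand f (l k) s y) μ)
    {v : Y} (hv : v ≠ 0) {d : ℝ} (hd : ∀ k ∈ S, l k v ≤ d)
    (hlead : ∃ y, ∑ k ∈ S with l k v = d, c k * Real.exp (l k y) ≠ 0) :
    d + ∑ i, (s i).re * (f i).trop v < 0 := by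
  by_contra hge
  rw [not_lt] at hge
  obtain ⟨y₁, hy₁⟩ := hlead
  set H : Y → ℂ := fun y => ∑ k ∈ S, c k * mellinIntegrand f (l k) s y with hHdef
  have hH : Continuous H := continuous_finsetSum _ fun k _ =>
    continuous_const.mul (continuous_mellinIntegrand f (l k) s)
  set N : Y → ℂ := fun y => ∑ k ∈ S with l k v = d, c k * Real.exp (l k y) with hNdef
  have hN : Continuous N := continuous_finsetSum _ fun k _ => continuous_const.mul
    (Complex.continuous_ofReal.comp (Real.continuous_exp.comp (l k).continuous))
  have hae := ae_liminf_enorm_translate_eq_zero μ hH hint hv y₁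
  have hU : IsOpen (Metric.ball y₁ 1 ∩ {y | N y ≠ 0}) :=
    Metric.isOpen_ball.inter (isOpen_ne_fun hN continuous_const)
  -- The lower limit is known only almost everywhere, so y is picked from a non-empty open set on
  -- which the leading part N does not vanish.
  have hpos := hU.measure_pos μ ⟨y₁, by simp, hy₁⟩
  obtain ⟨y, ⟨hyB, hyN⟩, hy⟩ := (frequently_ae_mem_iff.2 hpos.ne').and_eventually hae |>.exists
  have hlim := hy hyB
  obtain ⟨C, hC0, hC⟩ := exists_abs_log_norm_sub_mellinGrowth_le f 0 s
  choose A hA0 hA using fun i => (f i).exists_abs_trop_le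
  -- Up to the factor exp(n d) and the product of powers, this is H at y + n v. The terms with slope
  -- below d decay, which leaves N y in the limit.
  let Ψ : ℕ → ℂ := fun n => ∑ k ∈ S, c k * Real.exp (l k y) * Real.exp (n * (l k v - d))
  have hΨ : Tendsto Ψ atTop (𝓝 (N y)) := by
    have : N y = ∑ k ∈ S, c k * Real.exp (l k y) * (if l k v = d then 1 else 0) := by
      simp [hNdef, Finset.sum_filter]
    rw [this]
    refine tendsto_finsetSum _ fun k hk => Tendsto.const_mul _ ?_
    split_ifs with h
    · simp [h]
    · have hlt : l k v - d < 0 := sub_neg.2 (lt_of_le_of_ne (hd k hk) h)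
      have h1 : Tendsto (fun n : ℕ => Real.exp (n * (l k v - d))) atTop (𝓝 0) :=
        Real.tendsto_exp_atBot.comp (tendsto_natCast_atTop_atTop.atTop_mul_const_of_neg hlt)
      have h2 := (Complex.continuous_ofReal.tendsto 0).comp h1
      simpa [Function.comp_def] using h2
  set E : ℝ := Real.exp (-C - (∑ i, |(s i).re| * A i) * ‖y‖) with hE
  -- Since `trop` is subadditive and positively homogeneous, its value at y + n v differs from n
  -- times its value at v by a bound independent of n. If the growth along v were non-negative, E
  -- would be a uniform lower bound for the remaining factor.
  have hlow : ∀ n : ℕ, ‖Ψ n‖ * E ≤ ‖H (y + (n : ℝ) • v)‖ := by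
    intro n
    have h1 : H (y + (n : ℝ) • v)
        = Ψ n * (Real.exp (n * d) * mellinIntegrand f 0 s (y + (n : ℝ) • v)) := by
      simp only [hHdef, Ψ, Finset.sum_mul]
      refine Finset.sum_congr rfl fun k _ => ?_
      rw [mellinIntegrand_eq_exp_mul]
      have : Real.exp (l k (y + (n : ℝ) • v))
          = Real.exp (l k y) * Real.exp (n * (l k v - d)) * Real.exp (n * d) := by
        rw [← Real.exp_add, ← Real.exp_add, map_add, map_smul, smul_eq_mul]
        congr 1
        ring
      rw [this]
      push_cast
      ring
    rw [h1, norm_mul, norm_mul, Complex.norm_real, Real.norm_of_nonneg (Real.exp_pos _).le,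
      norm_mellinIntegrand, ← Real.exp_add]
    refine mul_le_mul_of_nonneg_left (Real.exp_le_exp.2 ?_) (norm_nonneg _)
    have h2 := (abs_le.1 (hC (y + (n : ℝ) • v))).1
    have h3 : -((∑ i, |(s i).re| * A i) * ‖y‖) + n * ∑ i, (s i).re * (f i).trop v
        ≤ mellinGrowth f 0 s (y + (n : ℝ) • v) := by
      simp only [mellinGrowth, zero_apply, zero_add]
      rw [Finset.sum_mul, ← Finset.sum_neg_distrib, Finset.mul_sum, ← Finset.sum_add_distrib]
      refine Finset.sum_le_sum fun i _ => ?_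
      have h4 : |(f i).trop (y + (n : ℝ) • v) - n * (f i).trop v| ≤ A i * ‖y‖ := by
        rw [← (f i).trop_smul (Nat.cast_nonneg n), abs_le]
        have h5 := (f i).trop_add_le y ((n : ℝ) • v)
        have h6 := (f i).trop_add_le (y + (n : ℝ) • v) (-y)
        rw [add_neg_cancel_comm] at h6
        have h7 := (abs_le.1 (hA i y)).2
        have h8 := (abs_le.1 (hA i (-y))).2
        rw [norm_neg] at h8
        constructor <;> linarith
      have h9 : |(s i).re * ((f i).trop (y + (n : ℝ) • v) - n * (f i).trop v)|
          ≤ |(s i).re| * (A i * ‖y‖) := by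
        rw [abs_mul]
        exact mul_le_mul_of_nonneg_left h4 (abs_nonneg _)
      have h10 := (abs_le.1 h9).1
      linarith
    have h11 : 0 ≤ (n : ℝ) * (d + ∑ i, (s i).re * (f i).trop v) :=
      mul_nonneg (Nat.cast_nonneg n) hge
    linarith
  have hev : ∀ᶠ n : ℕ in atTop, ENNReal.ofReal (‖N y‖ / 2 * E) ≤ ‖H (y + (n : ℝ) • v)‖ₑ := by
    have h1 : ∀ᶠ n in atTop, ‖N y‖ / 2 < ‖Ψ n‖ :=
      hΨ.norm.eventually (lt_mem_nhds (half_lt_self (norm_pos_iff.2 hyN)))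
    filter_upwards [h1] with n hn
    rw [← ofReal_norm]
    refine ENNReal.ofReal_le_ofReal (le_trans ?_ (hlow n))
    exact mul_le_mul_of_nonneg_right hn.le (Real.exp_pos _).le
  have hle := le_liminf_of_le (by isBoundedDefault) hev
  rw [hlim, nonpos_iff_eq_zero, ENNReal.ofReal_eq_zero] at hle
  have : 0 < ‖N y‖ / 2 * E := mul_pos (half_pos (norm_pos_iff.2 hyN)) (Real.exp_pos _)
  linarith

end Necessity

/-! ### Weights of monomials -/

namespace MvPolynomial

section Weights

variable {σ S A : Type*} [CommRing S] [AddCommGroup A] [PartialOrder A] [IsOrderedAddMonoid A]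

/-- All monomials of the polynomial `p` have weight at least `d`. -/
def WeightGE (v : σ → A) (d : A) (p : MvPolynomial σ S) : Prop :=
  ∀ m ∈ p.support, d ≤ Finsupp.weight v m

/-- The minimal weight of the monomials of the polynomial `p` is `d`. -/
def IsInitialWeight (v : σ → A) (d : A) (p : MvPolynomial σ S) : Prop :=
  p.WeightGE v d ∧ ∃ m ∈ p.support, Finsupp.weight v m = d

theorem exists_isInitialWeight (v : σ → ℤ) {p : MvPolynomial σ S} (hp : p ≠ 0) :
    ∃ d, IsInitialWeight v d p := by
  obtain ⟨m, hm, h⟩ := p.support.exists_min_image (fun m => Finsupp.weight v m)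
    (support_nonempty.2 hp)
  exact ⟨_, h, m, hm, rfl⟩

namespace WeightGE

variable {v : σ → A} {d d' : A} {p q : MvPolynomial σ S}

omit [IsOrderedAddMonoid A] in
theorem mono_support (hp : p.WeightGE v d) {S' : Type*} [CommRing S'] {q : MvPolynomial σ S'}
    (h : q.support ⊆ p.support) : q.WeightGE v d :=
  fun m hm => hp m (h hm)

omit [IsOrderedAddMonoid A] in
theorem add (hp : p.WeightGE v d) (hq : q.WeightGE v d) : (p + q).WeightGE v d := by
  classical
  intro m hm
  obtain h | h := Finset.mem_union.1 (support_add hm)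
  exacts [hp m h, hq m h]

omit [IsOrderedAddMonoid A] in
theorem neg (hp : p.WeightGE v d) : (-p).WeightGE v d :=
  hp.mono_support (by simp [support_neg])

omit [IsOrderedAddMonoid A] in
theorem sub (hp : p.WeightGE v d) (hq : q.WeightGE v d) : (p - q).WeightGE v d := by
  rw [sub_eq_add_neg]
  exact hp.add hq.neg

omit [IsOrderedAddMonoid A] in
theorem zero : (0 : MvPolynomial σ S).WeightGE v d := by
  simp [WeightGE]

theorem mul (hp : p.WeightGE v d) (hq : q.WeightGE v d') : (p * q).WeightGE v (d + d') := by
  classical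
  intro m hm
  obtain ⟨a, ha, b, hb, rfl⟩ := Finset.mem_add.1 (support_mul p q hm)
  rw [map_add]
  exact add_le_add (hp a ha) (hq b hb)

omit [IsOrderedAddMonoid A] in
theorem C_mul (hp : p.WeightGE v d) (c : S) : (C c * p).WeightGE v d :=
  hp.mono_support (by rw [C_mul']; exact support_smul)

omit [IsOrderedAddMonoid A] in
theorem sum {τ : Type*} {T : Finset τ} {p : τ → MvPolynomial σ S}
    (h : ∀ i ∈ T, (p i).WeightGE v d) : (∑ i ∈ T, p i).WeightGE v d := by
  classical
  induction T using Finset.induction_on with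
  | empty => simpa using zero
  | insert i T hi ih =>
    rw [Finset.sum_insert hi]
    exact (h i (Finset.mem_insert_self _ _)).add (ih fun j hj => h j (Finset.mem_insert_of_mem hj))

theorem prod {τ : Type*} {T : Finset τ} {p : τ → MvPolynomial σ S} {d : τ → A}
    (h : ∀ i ∈ T, (p i).WeightGE v (d i)) : (∏ i ∈ T, p i).WeightGE v (∑ i ∈ T, d i) := by
  classical
  induction T using Finset.induction_on with
  | empty =>
    intro m hm
    rw [Finset.prod_empty, mem_support_iff, coeff_one] at hm
    have : m = 0 := by
      by_contra h0
      exact hm (if_neg (Ne.symm h0))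
    simp [this]
  | insert i T hi ih =>
    rw [Finset.prod_insert hi, Finset.sum_insert hi]
    exact (h i (Finset.mem_insert_self _ _)).mul (ih fun j hj => h j (Finset.mem_insert_of_mem hj))

omit [IsOrderedAddMonoid A] in
theorem map (hp : p.WeightGE v d) {S' : Type*} [CommRing S'] (g : S →+* S') :
    (MvPolynomial.map g p).WeightGE v d :=
  hp.mono_support (support_map_subset g p)

end WeightGE

end Weights

section Euler

variable {σ S : Type*} [Fintype σ] [CommRing S]

/-- The Euler operator `∑ e, v e * X e * ∂_e`. -/
noncomputable def eulerOp (v : σ → ℤ) (p : MvPolynomial σ S) : MvPolynomial σ S :=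
  ∑ e, v e • (X e * pderiv e p)

omit [Fintype σ] in
theorem coeff_X_mul_pderiv (e : σ) (p : MvPolynomial σ S) (m : σ →₀ ℕ) :
    coeff m (X e * pderiv e p) = m e • coeff m p := by
  classical
  induction p using MvPolynomial.induction_on' with
  | monomial u a =>
    rw [X_mul_pderiv_monomial, coeff_smul, coeff_monomial]
    split_ifs with h
    · rw [h]
    · simp
  | add p q hp hq => rw [map_add, mul_add, coeff_add, coeff_add, hp, hq, smul_add]

theorem coeff_eulerOp (v : σ → ℤ) (p : MvPolynomial σ S) (m : σ →₀ ℕ) :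
    coeff m (eulerOp v p) = Finsupp.weight v m • coeff m p := by
  rw [eulerOp, coeff_sum, Finsupp.weight_eq_sum, Finset.sum_smul]
  refine Finset.sum_congr rfl fun e _ => ?_
  rw [coeff_smul, coeff_X_mul_pderiv]
  simp only [zsmul_eq_mul, nsmul_eq_mul]
  push_cast
  ring

theorem support_eulerOp_subset (v : σ → ℤ) (p : MvPolynomial σ S) :
    (eulerOp v p).support ⊆ p.support := by
  intro m hm
  rw [mem_support_iff, coeff_eulerOp] at hm
  rw [mem_support_iff]
  exact fun h => hm (by rw [h, smul_zero])

theorem IsHomogeneous.eulerOp {v : σ → ℤ} {p : MvPolynomial σ S} {n : ℕ} (h : p.IsHomogeneous n) :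
    (p.eulerOp v).IsHomogeneous n := by
  intro m hm
  exact h (mem_support_iff.1 (support_eulerOp_subset v p (mem_support_iff.2 hm)))

/-- The Euler operator multiplies a monomial by its weight, so the monomials of weight d cancel, and
the next integer weight is d + 1. -/
theorem WeightGE.eulerOp_sub {v : σ → ℤ} {d : ℤ} {p : MvPolynomial σ S} (h : p.WeightGE v d) :
    (eulerOp v p - d • p).WeightGE v (d + 1) := by
  intro m hm
  rw [mem_support_iff, coeff_sub, coeff_eulerOp, coeff_smul, ← sub_smul] at hm
  have h1 : m ∈ p.support := by
    rw [mem_support_iff]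
    exact fun h0 => hm (by rw [h0, smul_zero])
  have h2 : Finsupp.weight v m ≠ d := fun h0 => hm (by rw [h0, sub_self, zero_smul])
  have h3 := h m h1
  omega

end Euler

section Evaluation

variable {σ : Type*} [Fintype σ]

omit [Fintype σ] in
theorem eval_map_ofReal (p : MvPolynomial σ ℝ) (α : σ → ℝ) :
    eval (fun e => (α e : ℂ)) (map Complex.ofRealHom p) = ((eval α p : ℝ) : ℂ) := by
  rw [eval_map]
  exact (eval₂_comp_left Complex.ofRealHom (RingHom.id ℝ) α p).symm

theorem eval_pos {p : MvPolynomial σ ℝ} (hp : p ≠ 0) (h : ∀ m, 0 ≤ p.coeff m) {α : σ → ℝ}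
    (hα : ∀ e, 0 < α e) : 0 < eval α p := by
  rw [eval_eq']
  refine Finset.sum_pos (fun m hm => ?_) (support_nonempty.2 hp)
  exact mul_pos (lt_of_le_of_ne (h m) (mem_support_iff.1 hm).symm)
    (Finset.prod_pos fun e _ => pow_pos (hα e) _)

omit [Fintype σ] in
theorem exists_pos_eval_ne_zero {p : MvPolynomial σ ℂ} (hp : p ≠ 0) :
    ∃ α : σ → ℝ, (∀ e, 0 < α e) ∧ eval (fun e => (α e : ℂ)) p ≠ 0 := by
  by_contra! h
  refine hp (funext_set (fun _ => Complex.ofReal '' Set.Ioi 0)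
    (fun _ => (Set.Ioi_infinite 0).image Complex.ofReal_injective.injOn) fun x hx => ?_)
  choose α hα hαx using fun e => hx e (Set.mem_univ e)
  rw [map_zero, ← h α hα]
  congr 2
  exact _root_.funext fun e => (hαx e).symm

theorem IsHomogeneous.eval_smul {S : Type*} [CommRing S] {p : MvPolynomial σ S} {n : ℕ}
    (h : p.IsHomogeneous n) (c : S) (α : σ → S) :
    eval (fun e => c * α e) p = c ^ n * eval α p := by
  rw [eval_eq', eval_eq', Finset.mul_sum]
  refine Finset.sum_congr rfl fun m hm => ?_
  have h1 : ∑ e, m e = n := by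
    rw [← h (mem_support_iff.1 hm), Finsupp.weight_eq_sum]
    simp
  simp only [mul_pow, Finset.prod_mul_distrib, Finset.prod_pow_eq_pow_sum, h1]
  ring

theorem zpow_sum_eq_prod {𝕜 τ : Type*} [Field 𝕜] {t : 𝕜} (ht : t ≠ 0) (T : Finset τ) (n : τ → ℤ) :
    t ^ (∑ i ∈ T, n i) = ∏ i ∈ T, t ^ n i := by
  classical
  induction T using Finset.induction_on with
  | empty => simp
  | insert i T hi ih => rw [Finset.sum_insert hi, Finset.prod_insert hi, zpow_add₀ ht, ih]

theorem eval_zpow_mul {𝕜 : Type*} [Field 𝕜] (v : σ → ℤ) {t : 𝕜} (ht : t ≠ 0) (α : σ → 𝕜)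
    (p : MvPolynomial σ 𝕜) : eval (fun e => t ^ v e * α e) p
      = ∑ m ∈ p.support, t ^ (Finsupp.weight v m) * (coeff m p * ∏ e, α e ^ m e) := by
  rw [eval_eq']
  refine Finset.sum_congr rfl fun m _ => ?_
  have : ∏ e, (t ^ v e) ^ m e = t ^ (Finsupp.weight v m) := by
    rw [Finsupp.weight_eq_sum, zpow_sum_eq_prod ht]
    refine Finset.prod_congr rfl fun e _ => ?_
    rw [← zpow_natCast, ← zpow_mul]
    simp [mul_comm]
  simp only [mul_pow, Finset.prod_mul_distrib, this]
  ring

/-- After division by t^d each monomial carries a non-negative power of t, and only weight d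
survives as t tends to 0. -/
theorem WeightGE.tendsto_zpow_mul_eval {𝕜 : Type*} [RCLike 𝕜] {v : σ → ℤ} {d : ℤ}
    {p : MvPolynomial σ 𝕜} (h : p.WeightGE v d) (α : σ → 𝕜) :
    Filter.Tendsto (fun t : ℝ => (t : 𝕜) ^ (-d) * eval (fun e => (t : 𝕜) ^ v e * α e) p) (𝓝[>] 0)
      (𝓝 (eval α (weightedHomogeneousComponent v d p))) := by
  have h1 : eval α (weightedHomogeneousComponent v d p)
      = ∑ m ∈ p.support, (if Finsupp.weight v m = d then 1 else 0) *
        (coeff m p * ∏ e, α e ^ m e) := by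
    rw [weightedHomogeneousComponent_apply, map_sum, Finset.sum_filter]
    refine Finset.sum_congr rfl fun m _ => ?_
    split_ifs
    · rw [eval_monomial, one_mul, Finsupp.prod_fintype _ _ (by simp)]
    · simp
  have h2 : ∀ m ∈ p.support, Filter.Tendsto
      (fun t : ℝ => (t : 𝕜) ^ (Finsupp.weight v m - d) * (coeff m p * ∏ e, α e ^ m e)) (𝓝[>] 0)
      (𝓝 ((if Finsupp.weight v m = d then 1 else 0) * (coeff m p * ∏ e, α e ^ m e))) := by
    intro m hm
    refine Filter.Tendsto.mul_const _ ?_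
    split_ifs with hd
    · simp [hd]
    · obtain ⟨n, hn⟩ := Int.eq_ofNat_of_zero_le (sub_nonneg.2 (h m hm))
      have hn0 : n ≠ 0 := by
        rintro rfl
        simp only [Nat.cast_zero] at hn
        exact hd (by omega)
      have : Filter.Tendsto (fun t : ℝ => ((t ^ n : ℝ) : 𝕜)) (𝓝 0) (𝓝 ((0 ^ n : ℝ) : 𝕜)) :=
        ((RCLike.continuous_ofReal (K := 𝕜)).comp (continuous_pow n)).tendsto 0
      simp only [hn, zpow_natCast]
      simpa [zero_pow hn0] using this.mono_left nhdsWithin_le_nhds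
  rw [h1]
  refine (tendsto_finsetSum _ h2).congr' ?_
  filter_upwards [self_mem_nhdsWithin] with t ht
  have ht' : (t : 𝕜) ≠ 0 := by
    rw [Ne, RCLike.ofReal_eq_zero]
    exact (Set.mem_Ioi.1 ht).ne'
  rw [eval_zpow_mul v ht', Finset.mul_sum]
  refine Finset.sum_congr rfl fun m _ => ?_
  rw [← mul_assoc (_ ^ (-d)), ← zpow_add₀ ht', neg_add_eq_sub]

theorem hasDerivAt_eval {𝔸 : Type*} [NormedCommRing 𝔸] [NormedAlgebra ℝ 𝔸]
    (p : MvPolynomial σ 𝔸) {γ : ℝ → σ → 𝔸} {w : σ → 𝔸} {t : ℝ}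
    (hγ : ∀ e, HasDerivAt (fun t => γ t e) (w e) t) :
    HasDerivAt (fun t => eval (γ t) p) (∑ e, w e * eval (γ t) (pderiv e p)) t := by
  classical
  induction p using MvPolynomial.induction_on with
  | C a => simpa using hasDerivAt_const t a
  | add p q hp hq => simpa [mul_add, Finset.sum_add_distrib] using hp.fun_add hq
  | mul_X p i hp =>
    have := hp.mul (hγ i)
    simp only [map_mul, eval_X]
    convert! this using 1
    simp only [Derivation.leibniz, smul_eq_mul, pderiv_X, map_add, map_mul, eval_X, mul_add,
      Finset.sum_add_distrib, Finset.sum_mul]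
    rw [add_comm]
    congr 1
    · exact Finset.sum_congr rfl fun e _ => by ring
    · rw [Finset.sum_eq_single i]
      · simp [mul_comm]
      · intro e _ he
        simp [he.symm]
      · simp

end Evaluation

end MvPolynomial

/-! ### Degrees of vanishing -/

/-- The weights `1` on `J`, `-1` on `K` and `0` elsewhere. -/
def scalingWeight {E : Type*} [DecidableEq E] (J K : Finset E) (e : E) : ℤ :=
  if e ∈ J then 1 else if e ∈ K then -1 else 0

theorem rescale_eq_zpow {E : Type*} [DecidableEq E] (J K : Finset E) (t : ℝ) (α : E → ℝ) :
    rescale J K t α = fun e => t ^ scalingWeight J K e * α e := by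
  funext e
  simp only [rescale, scalingWeight]
  split_ifs <;> simp

theorem sum_scalingWeight_mul {E S : Type*} [Fintype E] [DecidableEq E] [CommRing S]
    {J K : Finset E} (hJK : Disjoint J K) (g : E → S) :
    ∑ e, (scalingWeight J K e : S) * g e = ∑ e ∈ J, g e - ∑ e ∈ K, g e := by
  have h : ∀ e, (scalingWeight J K e : S) * g e
      = (if e ∈ J then g e else 0) - (if e ∈ K then g e else 0) := by
    intro e
    simp only [scalingWeight]
    split_ifs with h1 h2 h2
    · exact absurd h2 (Finset.disjoint_left.1 hJK h1)
    · simp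
    · simp
    · simp
  simp [h, Finset.sum_sub_distrib, Finset.sum_ite_mem]

/-- If the limit is zero, |t^w| = t^(Re w) decides. Otherwise invariance of the limit under t ↦ e^x
t gives exp(x w) = 1 for all real x, and differentiation at x = 0 gives w = 0. -/
theorem eq_zero_or_re_pos_of_tendsto_cpow {w L : ℂ}
    (h : Filter.Tendsto (fun t : ℝ => (t : ℂ) ^ w) (𝓝[>] 0) (𝓝 L)) : w = 0 ∨ 0 < w.re := by
  by_cases hL : L = 0
  · right
    by_contra! hw
    have h1 := h.norm
    rw [hL, norm_zero] at h1
    obtain ⟨t, ⟨ht1, ht⟩⟩ := ((h1.eventually (gt_mem_nhds one_pos)).and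
      (Ioo_mem_nhdsGT (one_pos : (0 : ℝ) < 1))).exists
    rw [Complex.norm_cpow_eq_rpow_re_of_pos ht.1] at ht1
    exact absurd ht1 (not_lt.2 (Real.one_le_rpow_of_pos_of_le_one_of_nonpos ht.1 ht.2.le hw))
  · left
    have h1 : ∀ x : ℝ, Complex.exp (x * w) = 1 := by
      intro x
      have hc := Real.exp_pos x
      have h2 : Filter.Tendsto (fun t : ℝ => Real.exp x * t) (𝓝[>] 0) (𝓝[>] 0) := by
        refine tendsto_nhdsWithin_iff.2 ⟨?_, ?_⟩
        · have : Filter.Tendsto (fun t : ℝ => Real.exp x * t) (𝓝 0) (𝓝 (Real.exp x * 0)) :=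
            (continuous_const.mul continuous_id).tendsto 0
          rw [mul_zero] at this
          exact this.mono_left nhdsWithin_le_nhds
        · filter_upwards [self_mem_nhdsWithin] with t ht
          exact mul_pos hc ht
      have h3 : Filter.Tendsto (fun t : ℝ => ((Real.exp x * t : ℝ) : ℂ) ^ w) (𝓝[>] 0) (𝓝 L) :=
        h.comp h2
      have h4 : Filter.Tendsto (fun t : ℝ => ((Real.exp x * t : ℝ) : ℂ) ^ w) (𝓝[>] 0)
          (𝓝 (Complex.exp (x * w) * L)) := by
        refine (h.const_mul (Complex.exp (x * w))).congr' ?_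
        filter_upwards [self_mem_nhdsWithin] with t ht
        rw [Complex.ofReal_mul, Complex.mul_cpow_ofReal_nonneg hc.le (Set.mem_Ioi.1 ht).le]
        congr 1
        rw [Complex.cpow_def_of_ne_zero (by exact_mod_cast hc.ne'), ← Complex.ofReal_log hc.le,
          Real.log_exp]
      exact mul_right_cancel₀ hL ((tendsto_nhds_unique h4 h3).trans (one_mul L).symm)
    have h2 : HasDerivAt (fun x : ℝ => Complex.exp (x * w)) w 0 := by
      have := ((hasDerivAt_id (0 : ℝ)).ofReal_comp.mul_const w).cexp
      simpa using this
    have h3 : (fun x : ℝ => Complex.exp (x * w)) = fun _ => 1 := funext h1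
    rw [h3] at h2
    exact h2.unique (hasDerivAt_const _ _)

/-- Quotients of the two rescaled functions show that both t^(s - s') and t^(s' - s) have limits,
but the two real parts cannot both be positive. -/
theorem HasVanishingDegreeAt.unique {E : Type*} [DecidableEq E] {f : (E → ℝ) → ℂ}
    {J K : Finset E} {s s' : ℂ} (h : HasVanishingDegreeAt f J K s)
    (h' : HasVanishingDegreeAt f J K s') : s = s' := by
  have key : ∀ {s s' : ℂ}, HasVanishingDegreeAt f J K s → HasVanishingDegreeAt f J K s' →
      s - s' = 0 ∨ 0 < (s - s').re := by
    rintro s s' ⟨L, ⟨α, hα, hL⟩, h⟩ ⟨L', -, h'⟩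
    refine eq_zero_or_re_pos_of_tendsto_cpow (L := L' α / L α) ?_
    refine ((h' α hα).div (h α hα) hL).congr' ?_
    filter_upwards [self_mem_nhdsWithin, (h α hα).eventually (isOpen_ne.mem_nhds hL)] with t ht hne
    have ht' : (t : ℂ) ≠ 0 := by exact_mod_cast (Set.mem_Ioi.1 ht).ne'
    have hf : f (rescale J K t α) ≠ 0 := right_ne_zero_of_mul hne
    rw [Pi.div_apply, mul_div_mul_right _ _ hf, ← Complex.cpow_sub _ _ ht']
    congr 1
    ring
  obtain h1 | h1 := key h h'
  · exact sub_eq_zero.1 h1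
  · obtain h2 | h2 := key h' h
    · exact (sub_eq_zero.1 h2).symm
    · simp only [Complex.sub_re] at h1 h2
      linarith

namespace ParametricIntegrand

open MvPolynomial

variable {E R ι : Type*} [Fintype E] [Fintype ι]

/-- The numerator at fixed regulators. -/
noncomputable def numerAt (F : ParametricIntegrand E R ι) (z : R → ℂ) : MvPolynomial E ℂ :=
  map (eval z) F.numer

/-- The product of the powers of the polynomials of a parametric integrand. -/
noncomputable def powers (F : ParametricIntegrand E R ι) (z : R → ℂ) (α : E → ℝ) : ℂ :=
  ∏ i, ((eval α (F.poly i) : ℝ) : ℂ) ^ (eval z (F.expo i))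

theorem value_eq [DecidableEq E] [Fintype R] (F : ParametricIntegrand E R ι) (z : R → ℂ)
    (α : E → ℝ) : F.value z α
      = eval (fun e => (α e : ℂ)) (F.numerAt z) / eval z F.denom * F.powers z α := by
  rw [numerAt, eval_map, value, powers]

theorem poly_eval_pos (F : ParametricIntegrand E R ι) (i : ι) {α : E → ℝ} (hα : ∀ e, 0 < α e) :
    0 < eval α (F.poly i) :=
  eval_pos (F.poly_ne_zero i) (F.poly_coeff_nonneg i) hα

/-- Each factor is asymptotic to a power of t times its component of lowest weight. For the p_i this
component has non-negative coefficients, hence is positive on the orthant, and the complex power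
passes to the limit. For the numerator, z must avoid the zeros of one coefficient of lowest weight.
-/
theorem hasVanishingDegree [DecidableEq E] [Fintype R] (F : ParametricIntegrand E R ι)
    (J K : Finset E) {d : ℤ} {dp : ι → ℤ} (hd : IsInitialWeight (scalingWeight J K) d F.numer)
    (hdp : ∀ i, IsInitialWeight (scalingWeight J K) (dp i) (F.poly i)) :
    F.HasVanishingDegree J K ((d : MvPolynomial R ℂ) + ∑ i, (dp i : MvPolynomial R ℂ) * F.expo i) := by
  set v := scalingWeight J K with hv
  obtain ⟨hd, m, hm, hmd⟩ := hd
  refine ⟨F.denom * coeff m F.numer, mul_ne_zero F.denom_ne_zero (mem_support_iff.1 hm),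
    fun z hz => ?_⟩
  rw [map_mul] at hz
  have hq := left_ne_zero_of_mul hz
  refine ⟨hq, ?_⟩
  have hN : weightedHomogeneousComponent v d (F.numerAt z) ≠ 0 := by
    intro h0
    have := congrArg (coeff m) h0
    rw [coeff_weightedHomogeneousComponent, if_pos hmd, numerAt, coeff_map, coeff_zero] at this
    exact right_ne_zero_of_mul hz this
  have hp0 : ∀ i, weightedHomogeneousComponent v (dp i) (F.poly i) ≠ 0 := by
    intro i h0
    obtain ⟨-, k, hk, hkd⟩ := hdp i
    have := congrArg (coeff k) h0
    rw [coeff_weightedHomogeneousComponent, if_pos hkd, coeff_zero] at this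
    exact mem_support_iff.1 hk this
  have hpn : ∀ i k, 0 ≤ coeff k (weightedHomogeneousComponent v (dp i) (F.poly i)) := by
    intro i k
    rw [coeff_weightedHomogeneousComponent]
    split_ifs
    exacts [F.poly_coeff_nonneg i k, le_rfl]
  have hpos : ∀ (i : ι) {α : E → ℝ}, (∀ e, 0 < α e) →
      0 < eval α (weightedHomogeneousComponent v (dp i) (F.poly i)) := fun i α hα =>
    eval_pos (hp0 i) (hpn i) hα
  refine ⟨fun α => eval (fun e => (α e : ℂ)) (weightedHomogeneousComponent v d (F.numerAt z))
    / eval z F.denom * ∏ i, ((eval α (weightedHomogeneousComponent v (dp i) (F.poly i)) : ℝ) : ℂ) ^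
      (eval z (F.expo i)), ?_, ?_⟩
  · obtain ⟨α, hα, hne⟩ := exists_pos_eval_ne_zero hN
    refine ⟨α, hα, mul_ne_zero (div_ne_zero hne hq) (Finset.prod_ne_zero_iff.2 fun i _ => ?_)⟩
    rw [Complex.cpow_ne_zero_iff]
    left
    exact_mod_cast (hpos i hα).ne'
  · intro α hα
    have h1 := (hd.map (eval z)).tendsto_zpow_mul_eval (fun e => (α e : ℂ))
    have h2 : ∀ i, Filter.Tendsto (fun t : ℝ =>
        ((t ^ (-(dp i)) * eval (fun e => t ^ v e * α e) (F.poly i) : ℝ) : ℂ) ^ (eval z (F.expo i)))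
        (𝓝[>] 0) (𝓝 (((eval α (weightedHomogeneousComponent v (dp i) (F.poly i)) : ℝ) : ℂ) ^
          (eval z (F.expo i)))) := by
      intro i
      have h3 := (hdp i).1.tendsto_zpow_mul_eval α
      have h4 := (Complex.continuous_ofReal.tendsto _).comp h3
      have h5 : ContinuousAt (fun x : ℂ => x ^ (eval z (F.expo i)))
          ((eval α (weightedHomogeneousComponent v (dp i) (F.poly i)) : ℝ) : ℂ) :=
        continuousAt_id.cpow continuousAt_const
          (Complex.ofReal_mem_slitPlane.2 (hpos i hα))
      exact h5.tendsto.comp h4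
    refine ((h1.div_const _).mul (tendsto_finsetProd _ fun i _ => h2 i)).congr' ?_
    filter_upwards [self_mem_nhdsWithin] with t ht
    have ht0 : 0 < t := ht
    have htc : (t : ℂ) ≠ 0 := by exact_mod_cast ht0.ne'
    have hα' : ∀ e, 0 < t ^ v e * α e := fun e => mul_pos (zpow_pos ht0 _) (hα e)
    rw [rescale_eq_zpow, ← hv, value_eq, powers]
    have h6 : ∀ i, ((t ^ (-(dp i)) * eval (fun e => t ^ v e * α e) (F.poly i) : ℝ) : ℂ) ^
        (eval z (F.expo i)) = (t : ℂ) ^ (-((dp i : ℂ) * eval z (F.expo i))) *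
          ((eval (fun e => t ^ v e * α e) (F.poly i) : ℝ) : ℂ) ^ (eval z (F.expo i)) := by
      intro i
      rw [Complex.ofReal_mul, Complex.mul_cpow_ofReal_nonneg (zpow_nonneg ht0.le _)
        (F.poly_eval_pos i hα').le]
      congr 1
      rw [Complex.cpow_def_of_ne_zero (by exact_mod_cast (zpow_pos ht0 _).ne'),
        ← Complex.ofReal_log (zpow_nonneg ht0.le _), Real.log_zpow,
        Complex.cpow_def_of_ne_zero htc, ← Complex.ofReal_log ht0.le]
      congr 1
      push_cast
      ring
    simp only [h6, Finset.prod_mul_distrib]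
    have h7 : (t : ℂ) ^ (-(eval z ((d : MvPolynomial R ℂ) +
        ∑ i, (dp i : MvPolynomial R ℂ) * F.expo i)))
        = (t : ℂ) ^ (-d) * ∏ i, (t : ℂ) ^ (-((dp i : ℂ) * eval z (F.expo i))) := by
      rw [← Complex.cpow_intCast]
      simp only [Complex.cpow_def_of_ne_zero htc]
      rw [← Complex.exp_sum, ← Complex.exp_add, ← Finset.mul_sum, ← mul_add]
      congr 2
      simp only [map_add, map_sum, map_mul, map_intCast, Finset.sum_neg_distrib]
      push_cast
      ring
    rw [h7]
    have h8 : (fun e => ((t : ℂ) ^ v e * (α e : ℂ))) = fun e => ((t ^ v e * α e : ℝ) : ℂ) := by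
      funext e
      push_cast
      rfl
    have h9 : eval (fun e => ((t ^ v e * α e : ℝ) : ℂ)) (map (eval z) F.numer)
        = eval (fun e => ((t : ℂ) ^ v e * (α e : ℂ))) (map (eval z) F.numer) := by rw [h8]
    rw [numerAt, h9]
    simp only [Complex.coe_algebraMap]
    ring

theorem HasDivergenceDegree.unique [DecidableEq E] [Fintype R] {F : ParametricIntegrand E R ι}
    {J K : Finset E} {w w' : MvPolynomial R ℂ} (h : F.HasDivergenceDegree J K w)
    (h' : F.HasDivergenceDegree J K w') : w = w' := by
  obtain ⟨l, ⟨c, hc, hl⟩, rfl⟩ := h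
  obtain ⟨l', ⟨c', hc', hl'⟩, rfl⟩ := h'
  have : (l - l') * (c * c') = 0 := by
    refine MvPolynomial.funext fun z => ?_
    simp only [map_mul, map_sub, map_zero]
    by_cases h0 : eval z c = 0
    · simp [h0]
    by_cases h0' : eval z c' = 0
    · simp [h0']
    rw [(hl z h0).2.unique (hl' z h0').2, sub_self, zero_mul]
  rw [sub_eq_zero.1 ((mul_eq_zero.1 this).resolve_right (mul_ne_zero hc hc'))]

end ParametricIntegrand

/-! ### The Euler operator on parametric integrands -/

namespace MvPolynomial

variable {σ : Type*} [Fintype σ]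

theorem map_eulerOp {S S' : Type*} [CommRing S] [CommRing S'] (g : S →+* S') (v : σ → ℤ)
    (p : MvPolynomial σ S) : map g (eulerOp v p) = eulerOp v (map g p) := by
  simp [eulerOp, map_sum, pderiv_map]

theorem eval_eulerOp {S : Type*} [CommRing S] (v : σ → ℤ) (p : MvPolynomial σ S) (α : σ → S) :
    eval α (eulerOp v p) = ∑ e, (v e : S) * (α e * eval α (pderiv e p)) := by
  simp [eulerOp, map_sum]

end MvPolynomial

namespace ParametricIntegrand

open MvPolynomial

variable {E R ι : Type*} [Fintype E] [Fintype ι]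

/-- The polynomial `poly i` with coefficients viewed as constant functions of the regulators. -/
noncomputable def liftPoly (F : ParametricIntegrand E R ι) (i : ι) :
    MvPolynomial E (MvPolynomial R ℂ) :=
  map (C.comp Complex.ofRealHom) (F.poly i)

theorem map_eval_liftPoly (F : ParametricIntegrand E R ι) (i : ι) (z : R → ℂ) :
    map (eval z) (F.liftPoly i) = map Complex.ofRealHom (F.poly i) := by
  have h : (eval z).comp (C.comp Complex.ofRealHom) = Complex.ofRealHom :=
    RingHom.ext fun _ => by simp
  rw [liftPoly, map_map, h]

section Operator

variable [DecidableEq ι]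

/-- The numerator of `b * F - ∑ e, v e * α e * ∂_e F`, after multiplication with all
polynomials. -/
noncomputable def eulerNumer (F : ParametricIntegrand E R ι) (v : E → ℤ) (b : MvPolynomial R ℂ) :
    MvPolynomial E (MvPolynomial R ℂ) :=
  C b * (F.numer * ∏ i, F.liftPoly i) - (eulerOp v F.numer * ∏ i, F.liftPoly i +
    ∑ i, C (F.expo i) * (F.numer *
      (eulerOp v (F.liftPoly i) * ∏ j ∈ Finset.univ.erase i, F.liftPoly j)))

omit [DecidableEq ι] in
theorem liftPoly_isHomogeneous (F : ParametricIntegrand E R ι) (i : ι) :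
    (F.liftPoly i).IsHomogeneous (F.polyDeg i) :=
  (F.poly_homogeneous i).map _

theorem eulerNumer_isHomogeneous (F : ParametricIntegrand E R ι) (v : E → ℤ)
    (b : MvPolynomial R ℂ) :
    (F.eulerNumer v b).IsHomogeneous (F.numerDeg + ∑ i, F.polyDeg i) := by
  have hP : (∏ i, F.liftPoly i).IsHomogeneous (∑ i, F.polyDeg i) :=
    IsHomogeneous.prod _ _ _ fun i _ => F.liftPoly_isHomogeneous i
  refine IsHomogeneous.sub ((F.numer_homogeneous.mul hP).C_mul _)
    ((F.numer_homogeneous.eulerOp.mul hP).add (IsHomogeneous.sum _ _ _ fun i _ => ?_))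
  refine (F.numer_homogeneous.mul ?_).C_mul _
  rw [← Finset.add_sum_erase _ _ (Finset.mem_univ i)]
  exact (F.liftPoly_isHomogeneous i).eulerOp.mul
    (IsHomogeneous.prod _ _ _ fun j _ => F.liftPoly_isHomogeneous j)

/-- The parametric integrand `(b * F - ∑ e, v e * α e * ∂_e F) / ω`. -/
noncomputable def eulerIntegrand (F : ParametricIntegrand E R ι) (v : E → ℤ)
    (b ω : MvPolynomial R ℂ) (hω : ω ≠ 0) : ParametricIntegrand E R ι where
  poly := F.poly
  polyDeg := F.polyDeg
  expo i := F.expo i - 1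
  numer := F.eulerNumer v b
  numerDeg := F.numerDeg + ∑ i, F.polyDeg i
  denom := F.denom * ω
  poly_ne_zero := F.poly_ne_zero
  poly_coeff_nonneg := F.poly_coeff_nonneg
  poly_homogeneous := F.poly_homogeneous
  expo_affine i := (totalDegree_sub _ _).trans (max_le (F.expo_affine i) (by simp))
  numer_homogeneous := F.eulerNumer_isHomogeneous v b
  denom_ne_zero := mul_ne_zero F.denom_ne_zero hω
  degree_eq := by
    rw [← F.degree_eq]
    simp only [mul_sub, Finset.sum_sub_distrib, mul_one]
    push_cast
    ring

/-- The logarithmic derivative of `F` with respect to the Euler operator, multiplied with `F`. -/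
noncomputable def eulerValue (F : ParametricIntegrand E R ι) (v : E → ℤ) (z : R → ℂ)
    (α : E → ℝ) : ℂ :=
  (eval (fun e => (α e : ℂ)) (eulerOp v (F.numerAt z)) / eval z F.denom +
    eval (fun e => (α e : ℂ)) (F.numerAt z) / eval z F.denom *
      ∑ i, eval z (F.expo i) * ((eval α (eulerOp v (F.poly i)) / eval α (F.poly i) : ℝ) : ℂ)) *
    F.powers z α

/-- Lowering all exponents by one divides by the product P of the p_i, which compensates the
multiplication by P that made the numerator polynomial. -/
theorem eulerIntegrand_value [DecidableEq E] [Fintype R] (F : ParametricIntegrand E R ι)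
    (v : E → ℤ) (b ω : MvPolynomial R ℂ) (hω : ω ≠ 0) (z : R → ℂ) {α : E → ℝ}
    (hα : ∀ e, 0 < α e) :
    (F.eulerIntegrand v b ω hω).value z α
      = 1 / eval z ω * (eval z b * F.value z α - F.eulerValue v z α) := by
  have hp : ∀ i, ((eval α (F.poly i) : ℝ) : ℂ) ≠ 0 := fun i => by
    exact_mod_cast (F.poly_eval_pos i hα).ne'
  set P : ℂ := ∏ i, ((eval α (F.poly i) : ℝ) : ℂ) with hP
  have hP0 : P ≠ 0 := Finset.prod_ne_zero_iff.2 fun i _ => hp i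
  set x : E → ℂ := fun e => (α e : ℂ) with hx
  have h1 : (F.eulerIntegrand v b ω hω).powers z α = F.powers z α / P := by
    rw [powers, powers, hP, ← Finset.prod_div_distrib]
    refine Finset.prod_congr rfl fun i _ => ?_
    change ((eval α (F.poly i) : ℝ) : ℂ) ^ (eval z (F.expo i - 1)) = _
    rw [map_sub, map_one, Complex.cpow_sub _ _ (hp i), Complex.cpow_one]
  have h2 : ∀ i, eval x (map (eval z) (F.liftPoly i)) = ((eval α (F.poly i) : ℝ) : ℂ) := fun i => by
    rw [map_eval_liftPoly, eval_map_ofReal]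
  have h3 : ∀ i, eval x (map (eval z) (eulerOp v (F.liftPoly i)))
      = ((eval α (eulerOp v (F.poly i)) : ℝ) : ℂ) := fun i => by
    rw [map_eulerOp, map_eval_liftPoly, ← map_eulerOp, eval_map_ofReal]
  have h4 : eval x ((F.eulerIntegrand v b ω hω).numerAt z)
      = P * (eval z b * eval x (F.numerAt z) - (eval x (eulerOp v (F.numerAt z)) +
        eval x (F.numerAt z) * ∑ i, eval z (F.expo i) *
          ((eval α (eulerOp v (F.poly i)) / eval α (F.poly i) : ℝ) : ℂ))) := by
    have h5 : ∀ i, ∏ j ∈ Finset.univ.erase i, ((eval α (F.poly j) : ℝ) : ℂ)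
        = P / ((eval α (F.poly i) : ℝ) : ℂ) := fun i => by
      rw [eq_div_iff (hp i), hP, Finset.prod_erase_mul _ _ (Finset.mem_univ i)]
    change eval x (map (eval z) (F.eulerNumer v b)) = _
    simp only [eulerNumer, map_sub, map_add, map_mul, map_sum, map_prod, map_C, eval_C, h2, h3, h5,
      map_eulerOp (eval z) v F.numer, ← numerAt.eq_1 F z, ← hP, mul_sub, mul_add, Finset.mul_sum]
    congr 1
    · ring
    · congr 1
      · ring
      · refine Finset.sum_congr rfl fun i _ => ?_
        push_cast
        ring
  rw [value_eq, value_eq, h1, h4, eulerValue]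
  change _ / eval z (F.denom * ω) * _ = _
  rw [map_mul]
  field_simp
  ring

variable {A : Type*} [AddCommGroup A] [PartialOrder A] [IsOrderedAddMonoid A]

/-- The Euler operator creates no monomials, so only the factors p_i shift the weights. Weights lie
in a general ordered group because integers serve for degrees of divergence and reals for
convergence. -/
theorem eulerNumer_weightGE (F : ParametricIntegrand E R ι) (v : E → ℤ) (b : MvPolynomial R ℂ)
    {u : E → A} {d : A} {dp : ι → A} (hd : F.numer.WeightGE u d)
    (hdp : ∀ i, (F.poly i).WeightGE u (dp i)) :
    (F.eulerNumer v b).WeightGE u (d + ∑ i, dp i) := by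
  have hl : ∀ i, (F.liftPoly i).WeightGE u (dp i) := fun i => (hdp i).map _
  have hP : (∏ i, F.liftPoly i).WeightGE u (∑ i, dp i) := .prod fun i _ => hl i
  refine ((hd.mul hP).C_mul b).sub ((WeightGE.mul ?_ hP).add (WeightGE.sum fun i _ =>
    (hd.mul ?_).C_mul _))
  · exact hd.mono_support (support_eulerOp_subset _ _)
  · rw [← Finset.add_sum_erase _ _ (Finset.mem_univ i)]
    exact ((hl i).mono_support (support_eulerOp_subset _ _)).mul (.prod fun j _ => hl j)

/-- For this value of b the Leibniz rule distributes b - θ over the factors: each summand contains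
one factor with θ minus its own lowest weight applied to it, and `WeightGE.eulerOp_sub` gains one
there. -/
theorem eulerNumer_weightGE_add_one (F : ParametricIntegrand E R ι) (v : E → ℤ) {d : ℤ}
    {dp : ι → ℤ} (hd : F.numer.WeightGE v d) (hdp : ∀ i, (F.poly i).WeightGE v (dp i)) :
    (F.eulerNumer v (d + ∑ i, (dp i : MvPolynomial R ℂ) * F.expo i)).WeightGE v
      (d + ∑ i, dp i + 1) := by
  have hl : ∀ i, (F.liftPoly i).WeightGE v (dp i) := fun i => (hdp i).map _
  have hP : (∏ i, F.liftPoly i).WeightGE v (∑ i, dp i) := .prod fun i _ => hl i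
  have key : F.eulerNumer v (d + ∑ i, (dp i : MvPolynomial R ℂ) * F.expo i)
      = -((eulerOp v F.numer - d • F.numer) * ∏ i, F.liftPoly i +
        ∑ i, C (F.expo i) * (F.numer * ((eulerOp v (F.liftPoly i) - dp i • F.liftPoly i) *
          ∏ j ∈ Finset.univ.erase i, F.liftPoly j))) := by
    have h1 : ∀ i, C (F.expo i) * (F.numer * ((eulerOp v (F.liftPoly i) - dp i • F.liftPoly i) *
          ∏ j ∈ Finset.univ.erase i, F.liftPoly j))
        = C (F.expo i) * (F.numer * (eulerOp v (F.liftPoly i) *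
          ∏ j ∈ Finset.univ.erase i, F.liftPoly j)) -
          C ((dp i : MvPolynomial R ℂ) * F.expo i) * (F.numer * ∏ i, F.liftPoly i) := by
      intro i
      rw [← Finset.mul_prod_erase _ _ (Finset.mem_univ i), zsmul_eq_mul, map_mul, map_intCast]
      ring
    rw [Finset.sum_congr rfl fun i _ => h1 i]
    simp only [Finset.sum_sub_distrib, ← Finset.sum_mul, eulerNumer, map_add, map_intCast,
      map_sum, zsmul_eq_mul]
    ring
  rw [key]
  refine WeightGE.neg (WeightGE.add ?_ (WeightGE.sum fun i _ => WeightGE.C_mul ?_ _))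
  · rw [add_right_comm]
    exact hd.eulerOp_sub.mul hP
  · rw [add_assoc, ← Finset.add_sum_erase _ _ (Finset.mem_univ i), add_right_comm]
    exact hd.mul ((hl i).eulerOp_sub.mul (.prod fun j _ => hl j))

end Operator

theorem hasDerivAt_value_update [DecidableEq E] [Fintype R] (F : ParametricIntegrand E R ι)
    (z : R → ℂ) {α : E → ℝ} (hα : ∀ e, 0 < α e) (e : E) :
    HasDerivAt (fun t : ℝ => F.value z (Function.update α e t))
      ((eval (fun e => (α e : ℂ)) (pderiv e (F.numerAt z)) / eval z F.denom +
        eval (fun e => (α e : ℂ)) (F.numerAt z) / eval z F.denom *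
          ∑ i, eval z (F.expo i) * ((eval α (pderiv e (F.poly i)) / eval α (F.poly i) : ℝ) : ℂ)) *
        F.powers z α) (α e) := by
  classical
  have hup : Function.update α e (α e) = α := Function.update_eq_self e α
  have hcoord : ∀ e', HasDerivAt (fun t : ℝ => Function.update α e t e')
      ((Pi.single e 1 : E → ℝ) e') (α e) := fun e' => hasDerivAt_pi.1 (hasDerivAt_update α e (α e)) e'
  have hN : HasDerivAt (fun t : ℝ => eval (fun e' => ((Function.update α e t e' : ℝ) : ℂ))
      (F.numerAt z)) (eval (fun e => (α e : ℂ)) (pderiv e (F.numerAt z))) (α e) := by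
    have := hasDerivAt_eval (F.numerAt z) fun e' => (hcoord e').ofReal_comp
    rw [hup] at this
    convert! this using 1
    rw [Finset.sum_eq_single e]
    · simp
    · intro e' _ he'
      simp [he']
    · simp
  have hp : ∀ i, HasDerivAt (fun t : ℝ => eval (Function.update α e t) (F.poly i))
      (eval α (pderiv e (F.poly i))) (α e) := by
    intro i
    have := hasDerivAt_eval (F.poly i) hcoord
    rw [hup] at this
    convert! this using 1
    rw [Finset.sum_eq_single e]
    · simp
    · intro e' _ he'
      simp [he']
    · simp
  have hpos : ∀ i, 0 < eval α (F.poly i) := fun i => F.poly_eval_pos i hα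
  have hlog : HasDerivAt (fun t : ℝ => ∑ i, eval z (F.expo i) *
      ((Real.log (eval (Function.update α e t) (F.poly i)) : ℝ) : ℂ))
      (∑ i, eval z (F.expo i) * ((eval α (pderiv e (F.poly i)) / eval α (F.poly i) : ℝ) : ℂ))
      (α e) := by
    refine HasDerivAt.fun_sum fun i _ => HasDerivAt.const_mul _ (HasDerivAt.ofReal_comp ?_)
    have := (hp i).log (by rw [hup]; exact (hpos i).ne')
    rwa [hup] at this
  have hpow : ∀ β : E → ℝ, (∀ i, 0 < eval β (F.poly i)) → F.powers z β
      = Complex.exp (∑ i, eval z (F.expo i) * ((Real.log (eval β (F.poly i)) : ℝ) : ℂ)) := by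
    intro β hβ
    rw [powers, Complex.exp_sum]
    refine Finset.prod_congr rfl fun i _ => ?_
    rw [Complex.cpow_def_of_ne_zero (by exact_mod_cast (hβ i).ne'), ← Complex.ofReal_log (hβ i).le,
      mul_comm]
  have hexp := hlog.cexp
  have hP : HasDerivAt (fun t : ℝ => F.powers z (Function.update α e t))
      (F.powers z α * ∑ i, eval z (F.expo i) *
        ((eval α (pderiv e (F.poly i)) / eval α (F.poly i) : ℝ) : ℂ)) (α e) := by
    have hev : ∀ᶠ t in 𝓝 (α e), ∀ i, 0 < eval (Function.update α e t) (F.poly i) := by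
      rw [Filter.eventually_all]
      intro i
      exact (hp i).continuousAt.eventually (lt_mem_nhds (by simpa [hup] using hpos i))
    rw [hpow α hpos]
    rw [hup] at hexp
    refine hexp.congr_of_eventuallyEq ?_
    filter_upwards [hev] with t ht
    exact hpow _ ht
  simp only [value_eq]
  have := (hN.div_const (eval z F.denom)).mul hP
  rw [hup] at this
  convert! this using 1
  ring

/-- From ∂_e α_e = 1 + α_e ∂_e, the constants add up to |J| - |K| and the rest is the Euler
operator. -/
theorem anapartial_value [DecidableEq E] [Fintype R] (F : ParametricIntegrand E R ι)
    {J K : Finset E} (hJK : Disjoint J K) (w : ℂ) (z : R → ℂ) {α : E → ℝ} (hα : ∀ e, 0 < α e) :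
    anapartial J K w (F.value z) α = F.value z α - 1 / w *
      (((J.card : ℂ) - K.card) * F.value z α + F.eulerValue (scalingWeight J K) z α) := by
  have h1 : ∀ e, deriv (fun t : ℝ => (t : ℂ) * F.value z (Function.update α e t)) (α e)
      = F.value z α + α e *
      ((eval (fun e => (α e : ℂ)) (pderiv e (F.numerAt z)) / eval z F.denom +
        eval (fun e => (α e : ℂ)) (F.numerAt z) / eval z F.denom *
          ∑ i, eval z (F.expo i) * ((eval α (pderiv e (F.poly i)) / eval α (F.poly i) : ℝ) : ℂ)) *
        F.powers z α) := by
    intro e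
    have := (((hasDerivAt_id (α e)).ofReal_comp).fun_mul (F.hasDerivAt_value_update z hα e)).deriv
    simpa using this
  have h2 : F.eulerValue (scalingWeight J K) z α = ∑ e, (scalingWeight J K e : ℂ) * (α e *
      ((eval (fun e => (α e : ℂ)) (pderiv e (F.numerAt z)) / eval z F.denom +
        eval (fun e => (α e : ℂ)) (F.numerAt z) / eval z F.denom *
          ∑ i, eval z (F.expo i) * ((eval α (pderiv e (F.poly i)) / eval α (F.poly i) : ℝ) : ℂ)) *
        F.powers z α)) := by
    have h3 : ∑ i, eval z (F.expo i) *
        ((eval α (eulerOp (scalingWeight J K) (F.poly i)) / eval α (F.poly i) : ℝ) : ℂ)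
        = ∑ e, (scalingWeight J K e : ℂ) * (α e * ∑ i, eval z (F.expo i) *
          ((eval α (pderiv e (F.poly i)) / eval α (F.poly i) : ℝ) : ℂ)) := by
      simp only [eval_eulerOp, Finset.mul_sum, Finset.sum_div, Complex.ofReal_sum]
      rw [Finset.sum_comm]
      refine Finset.sum_congr rfl fun e _ => Finset.sum_congr rfl fun i _ => ?_
      push_cast
      ring
    rw [eulerValue, h3, eval_eulerOp, Finset.sum_div, Finset.mul_sum, ← Finset.sum_add_distrib,
      Finset.sum_mul]
    refine Finset.sum_congr rfl fun e _ => ?_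
    ring
  rw [h2, sum_scalingWeight_mul hJK, anapartial]
  simp only [h1, Finset.sum_add_distrib, Finset.sum_const, nsmul_eq_mul]
  ring

end ParametricIntegrand

/-! ### Logarithmic change of variables -/

section LogCoordinates

open MeasureTheory

variable {n : Type*} [Fintype n]

omit [Fintype n] in
theorem image_exp_univ :
    (fun (y : n → ℝ) e => Real.exp (y e)) '' Set.univ = {x | ∀ e, 0 < x e} := by
  ext x
  constructor
  · rintro ⟨y, -, rfl⟩ e
    exact Real.exp_pos _
  · intro hx
    exact ⟨fun e => Real.log (x e), Set.mem_univ _, funext fun e => Real.exp_log (hx e)⟩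

omit [Fintype n] in
theorem injOn_exp_univ :
    Set.InjOn (fun (y : n → ℝ) e => Real.exp (y e)) Set.univ := fun _ _ _ _ h =>
  funext fun e => Real.exp_injective (congrFun h e)

/-- The derivative of the coordinatewise exponential function. -/
noncomputable def expFDeriv (y : n → ℝ) : (n → ℝ) →L[ℝ] (n → ℝ) :=
  ContinuousLinearMap.pi fun e => (Real.exp (y e) • ContinuousLinearMap.id ℝ ℝ).comp
    (ContinuousLinearMap.proj e)

theorem hasFDerivWithinAt_exp (y : n → ℝ) :
    HasFDerivWithinAt (fun (y : n → ℝ) e => Real.exp (y e)) (expFDeriv y) Set.univ y := by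
  refine (hasFDerivAt_pi.2 fun e => ?_).hasFDerivWithinAt
  have := ((ContinuousLinearMap.proj (R := ℝ) (φ := fun _ : n => ℝ) e).hasFDerivAt (x := y)).exp
  convert! this using 1

theorem abs_det_expFDeriv (y : n → ℝ) : |(expFDeriv y).det| = Real.exp (∑ e, y e) := by
  rw [expFDeriv, ContinuousLinearMap.det_pi, Real.exp_sum, Finset.abs_prod]
  refine Finset.prod_congr rfl fun e _ => ?_
  simp [ContinuousLinearMap.det]

variable {F : Type*} [NormedAddCommGroup F] [NormedSpace ℝ F]

theorem integrableOn_pos_iff (g : (n → ℝ) → F) :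
    IntegrableOn g {x | ∀ e, 0 < x e} ↔
      Integrable fun y : n → ℝ => Real.exp (∑ e, y e) • g (fun e => Real.exp (y e)) := by
  rw [← image_exp_univ, integrableOn_image_iff_integrableOn_abs_det_fderiv_smul volume
    MeasurableSet.univ (fun y _ => hasFDerivWithinAt_exp y) injOn_exp_univ]
  simp only [abs_det_expFDeriv, integrableOn_univ]

theorem integral_pos_eq (g : (n → ℝ) → F) :
    ∫ x in {x | ∀ e, 0 < x e}, g x =
      ∫ y : n → ℝ, Real.exp (∑ e, y e) • g (fun e => Real.exp (y e)) := by
  rw [← image_exp_univ, integral_image_eq_integral_abs_det_fderiv_smul volume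
    MeasurableSet.univ (fun y _ => hasFDerivWithinAt_exp y) injOn_exp_univ]
  simp only [abs_det_expFDeriv, Measure.restrict_univ]

end LogCoordinates

/-! ### Polynomials in the regulators -/

namespace MvPolynomial

variable {σ : Type*} [Fintype σ]

/-- Polynomials of degree at most one are affine functions. -/
theorem eval_affine_combination {S : Type*} [CommRing S] {p : MvPolynomial σ S}
    (hp : p.totalDegree ≤ 1) {a b : S} (hab : a + b = 1) (x y : σ → S) :
    eval (fun r => a * x r + b * y r) p = a * eval x p + b * eval y p := by
  classical
  simp only [eval_eq', Finset.mul_sum]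
  rw [← Finset.sum_add_distrib]
  refine Finset.sum_congr rfl fun m hm => ?_
  have h1 : m.sum (fun _ e => e) ≤ 1 := (le_totalDegree hm).trans hp
  suffices h : ∏ r, (a * x r + b * y r) ^ m r = a * ∏ r, x r ^ m r + b * ∏ r, y r ^ m r by
    rw [h]; ring
  obtain h0 | h1 := Nat.le_one_iff_eq_zero_or_eq_one.1 h1
  · have hm0 : ∀ r, m r = 0 := by
      rw [Finsupp.sum_fintype _ _ (fun _ => rfl), Finset.sum_eq_zero_iff] at h0
      exact fun r => h0 r (Finset.mem_univ r)
    simp [hm0, hab]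
  · obtain ⟨r, rfl⟩ := (Finsupp.sum_eq_one_iff m).1 h1
    have h2 : ∀ x : σ → S, ∏ r', x r' ^ (Finsupp.single r 1) r' = x r := by
      intro x
      rw [Finset.prod_eq_single r]
      · simp
      · intro r' _ hr'
        simp [hr'.symm]
      · simp
    rw [h2 x, h2 y, h2 fun r => a * x r + b * y r]

theorem analyticOnNhd_eval (p : MvPolynomial σ ℂ) :
    AnalyticOnNhd ℂ (fun z : σ → ℂ => eval z p) Set.univ := by
  have := AnalyticOnNhd.aeval_mvPolynomial (𝕜 := ℂ) (A := ℂ) (s := Set.univ)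
    (f := fun z : σ → ℂ => z) (fun i => (ContinuousLinearMap.proj (R := ℂ)
      (φ := fun _ : σ => ℂ) i).analyticOnNhd _) p
  have h : ∀ z : σ → ℂ, aeval z p = eval z p := fun z => by
    rw [aeval_def, Algebra.algebraMap_self]
    rfl
  simpa only [h] using this

theorem dense_eval_ne_zero {p : MvPolynomial σ ℂ} (hp : p ≠ 0) :
    Dense {z : σ → ℂ | eval z p ≠ 0} := by
  rw [dense_iff_inter_open]
  rintro U hU ⟨z₀, hz₀⟩
  by_contra hne
  have h0 : ∀ z ∈ U, eval z p = 0 := fun z hz => by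
    by_contra h
    exact hne ⟨z, hz, h⟩
  have h1 := (analyticOnNhd_eval p).eqOn_of_preconnected_of_eventuallyEq
    (analyticOnNhd_const (v := (0 : ℂ))) isPreconnected_univ (Set.mem_univ z₀)
    (Filter.eventually_of_mem (hU.mem_nhds hz₀) h0)
  exact hp (MvPolynomial.funext fun z => by simpa using h1 (Set.mem_univ z))

end MvPolynomial

/-! ### Projective integrals as sums of Euler–Mellin integrals -/

namespace ParametricIntegrand

open MvPolynomial MeasureTheory

variable {E R ι : Type*} [Fintype E] [DecidableEq E] [Fintype ι]

/-- The extension of a vector by zero at the edge `e₀`. -/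
noncomputable def extendZero (e₀ : E) (y : {e : E // e ≠ e₀} → ℝ) : E → ℝ :=
  fun e => if h : e = e₀ then 0 else y ⟨e, h⟩

omit [Fintype E] in
theorem onHyperplane_exp (e₀ : E) (y : {e : E // e ≠ e₀} → ℝ) :
    onHyperplane e₀ (fun e => Real.exp (y e)) = fun e => Real.exp (extendZero e₀ y e) := by
  funext e
  simp only [onHyperplane, extendZero]
  split_ifs <;> simp

theorem sum_extendZero {S : Type*} [AddCommMonoid S] (e₀ : E) (g : E → S) (h : g e₀ = 0) :
    ∑ e, g e = ∑ e : {e : E // e ≠ e₀}, g e := by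
  rw [← Finset.sum_erase Finset.univ h, Finset.sum_subtype (p := fun e => e ≠ e₀) _ (by simp)]

/-- The exponent of the monomial `a` on the hyperplane as a linear form in the logarithms of the
coordinates. -/
noncomputable def slopeAt (e₀ : E) (a : E →₀ ℕ) : ({e : E // e ≠ e₀} → ℝ) →L[ℝ] ℝ :=
  ∑ e : {e : E // e ≠ e₀}, (a e : ℝ) • ContinuousLinearMap.proj e

theorem slopeAt_apply (e₀ : E) (a : E →₀ ℕ) (y : {e : E // e ≠ e₀} → ℝ) :
    slopeAt e₀ a y = ∑ e : {e : E // e ≠ e₀}, (a e : ℝ) * y e := by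
  simp [slopeAt]

theorem slopeAt_eq_weight (e₀ : E) (a : E →₀ ℕ) (y : {e : E // e ≠ e₀} → ℝ) :
    slopeAt e₀ a y = Finsupp.weight (extendZero e₀ y) a := by
  rw [slopeAt_apply, Finsupp.weight_eq_sum, sum_extendZero e₀ _ (by simp [extendZero])]
  refine Finset.sum_congr rfl fun e _ => ?_
  simp [extendZero, e.2]

theorem prod_exp_extendZero (e₀ : E) (a : E →₀ ℕ) (y : {e : E // e ≠ e₀} → ℝ) :
    ∏ e, Real.exp (extendZero e₀ y e) ^ a e = Real.exp (slopeAt e₀ a y) := by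
  rw [slopeAt_eq_weight, Finsupp.weight_eq_sum, Real.exp_sum]
  refine Finset.prod_congr rfl fun e _ => ?_
  rw [nsmul_eq_mul, Real.exp_nat_mul]

/-- The polynomial `poly i` on the hyperplane as a sum of exponentials in the logarithms of the
coordinates. -/
noncomputable def polySum (F : ParametricIntegrand E R ι) (e₀ : E) (i : ι) :
    PosExpSum (E →₀ ℕ) ({e : E // e ≠ e₀} → ℝ) where
  supp := (F.poly i).support
  slope := slopeAt e₀
  coef a := (F.poly i).coeff a
  nonempty := support_nonempty.2 (F.poly_ne_zero i)
  coef_pos a ha := lt_of_le_of_ne (F.poly_coeff_nonneg i a) (mem_support_iff.1 ha).symm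

theorem polySum_val (F : ParametricIntegrand E R ι) (e₀ : E) (i : ι)
    (y : {e : E // e ≠ e₀} → ℝ) : (F.polySum e₀ i).val y
      = eval (fun e => Real.exp (extendZero e₀ y e)) (F.poly i) := by
  rw [eval_eq', PosExpSum.val]
  exact Finset.sum_congr rfl fun a _ => by rw [prod_exp_extendZero]; rfl

/-- The exponent of the monomial `a` times the volume form. -/
noncomputable def volSlope (e₀ : E) (a : E →₀ ℕ) : ({e : E // e ≠ e₀} → ℝ) →L[ℝ] ℝ :=
  slopeAt e₀ a + ∑ e : {e : E // e ≠ e₀}, ContinuousLinearMap.proj e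

theorem volSlope_apply (e₀ : E) (a : E →₀ ℕ) (y : {e : E // e ≠ e₀} → ℝ) :
    volSlope e₀ a y = slopeAt e₀ a y + ∑ e, y e := by
  simp [volSlope]

/-- The exponents at given regulators. -/
noncomputable def exponents (F : ParametricIntegrand E R ι) (z : R → ℂ) (i : ι) : ℂ :=
  eval z (F.expo i)

theorem powers_exp (F : ParametricIntegrand E R ι) (e₀ : E) (z : R → ℂ)
    (y : {e : E // e ≠ e₀} → ℝ) : F.powers z (fun e => Real.exp (extendZero e₀ y e))
      = mellinIntegrand (F.polySum e₀) 0 (F.exponents z) y := by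
  simp only [powers, mellinIntegrand, ← polySum_val, zero_apply, Complex.ofReal_zero, zero_add,
    Complex.exp_sum]
  refine Finset.prod_congr rfl fun i _ => ?_
  have h := (F.polySum e₀ i).val_pos y
  rw [Complex.cpow_def_of_ne_zero (by exact_mod_cast h.ne'), ← Complex.ofReal_log h.le, mul_comm]
  rfl

theorem mellinIntegrand_volSlope (F : ParametricIntegrand E R ι) (e₀ : E) (z : R → ℂ)
    (a : E →₀ ℕ) (y : {e : E // e ≠ e₀} → ℝ) :
    mellinIntegrand (F.polySum e₀) (volSlope e₀ a) (F.exponents z) y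
      = Real.exp (∑ e, y e) * (∏ e, ((Real.exp (extendZero e₀ y e) : ℝ) : ℂ) ^ a e) *
        F.powers z (fun e => Real.exp (extendZero e₀ y e)) := by
  rw [mellinIntegrand_eq_exp_mul, powers_exp, volSlope_apply, Real.exp_add, ← prod_exp_extendZero]
  push_cast
  ring

omit [DecidableEq E] in
theorem eval_numerAt (F : ParametricIntegrand E R ι) (z : R → ℂ) (x : E → ℂ) :
    eval x (F.numerAt z) = ∑ a ∈ F.numer.support, eval z (coeff a F.numer) * ∏ e, x e ^ a e := by
  rw [numerAt, eval_map, eval₂_eq']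

omit [DecidableEq E] in
theorem eval_eulerOp_numerAt (F : ParametricIntegrand E R ι) (v : E → ℤ) (z : R → ℂ) (x : E → ℂ) :
    eval x (eulerOp v (F.numerAt z)) = ∑ a ∈ F.numer.support,
      (Finsupp.weight v a : ℂ) * (eval z (coeff a F.numer) * ∏ e, x e ^ a e) := by
  rw [numerAt, ← map_eulerOp, eval_map, eval₂_eq']
  rw [Finset.sum_subset (support_eulerOp_subset v F.numer)]
  · refine Finset.sum_congr rfl fun a _ => ?_
    rw [coeff_eulerOp, zsmul_eq_mul, map_mul, map_intCast, mul_assoc]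
  · intro a _ ha
    rw [notMem_support_iff.1 ha, map_zero, zero_mul]

variable [Fintype R]

theorem exp_smul_value (F : ParametricIntegrand E R ι) (e₀ : E) (z : R → ℂ)
    (y : {e : E // e ≠ e₀} → ℝ) :
    Real.exp (∑ e, y e) • F.value z (onHyperplane e₀ fun e => Real.exp (y e))
      = 1 / eval z F.denom * ∑ a ∈ F.numer.support, eval z (coeff a F.numer) *
        mellinIntegrand (F.polySum e₀) (volSlope e₀ a) (F.exponents z) y := by
  rw [onHyperplane_exp, value_eq, eval_numerAt, Complex.real_smul]
  simp only [mellinIntegrand_volSlope, Finset.mul_sum, Finset.sum_mul, Finset.sum_div]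
  exact Finset.sum_congr rfl fun a _ => by ring

/-- The regulators for which the contributions of all monomials of the numerator are integrable. -/
def regDomain (F : ParametricIntegrand E R ι) (e₀ : E) : Set (R → ℂ) :=
  {z | ∀ a ∈ F.numer.support, F.exponents z ∈ mellinDomain (F.polySum e₀) (volSlope e₀ a)}

/-- The projective integral multiplied with the denominator. -/
noncomputable def mellinSum (F : ParametricIntegrand E R ι) (e₀ : E) (z : R → ℂ) : ℂ :=
  ∑ a ∈ F.numer.support, eval z (coeff a F.numer) *
    mellinIntegral (F.polySum e₀) volume (volSlope e₀ a) (F.exponents z)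

omit [DecidableEq E] in
theorem analyticOnNhd_exponents (F : ParametricIntegrand E R ι) (i : ι) :
    AnalyticOnNhd ℂ (fun z => F.exponents z i) Set.univ :=
  analyticOnNhd_eval (F.expo i)

omit [DecidableEq E] in
theorem analyticAt_exponents (F : ParametricIntegrand E R ι) (z : R → ℂ) :
    AnalyticAt ℂ F.exponents z :=
  analyticAt_pi_iff.2 fun i => F.analyticOnNhd_exponents i z (Set.mem_univ z)

theorem isOpen_regDomain (F : ParametricIntegrand E R ι) (e₀ : E) : IsOpen (F.regDomain e₀) := by
  have : F.regDomain e₀ = ⋂ a ∈ F.numer.support,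
      F.exponents ⁻¹' mellinDomain (F.polySum e₀) (volSlope e₀ a) := by
    ext z
    simp [regDomain]
  rw [this]
  refine isOpen_biInter_finset fun a _ => (isOpen_mellinDomain _ _).preimage ?_
  exact continuous_iff_continuousAt.2 fun z => (F.analyticAt_exponents z).continuousAt

/-- The exponents are affine in z and the growth is affine in their real parts, so the defining
inequalities are preserved by convex combinations. -/
theorem convex_regDomain (F : ParametricIntegrand E R ι) (e₀ : E) :
    Convex ℝ (F.regDomain e₀) := by
  intro z hz z' hz' s t hs ht hst a ha y hy
  have hexp : F.exponents (s • z + t • z') = fun i => (s : ℂ) * F.exponents z i +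
      (t : ℂ) * F.exponents z' i := by
    have h0 : s • z + t • z' = fun r => (s : ℂ) * z r + (t : ℂ) * z' r := by
      funext r
      simp
    funext i
    rw [h0]
    have hst' : (s : ℂ) + t = 1 := by exact_mod_cast hst
    exact eval_affine_combination (F.expo_affine i) hst' z z'
  have h : mellinGrowth (F.polySum e₀) (volSlope e₀ a) (F.exponents (s • z + t • z')) y
      = s * mellinGrowth (F.polySum e₀) (volSlope e₀ a) (F.exponents z) y +
        t * mellinGrowth (F.polySum e₀) (volSlope e₀ a) (F.exponents z') y := by
    simp only [mellinGrowth, hexp, Complex.add_re, Complex.re_ofReal_mul, mul_add, Finset.mul_sum,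
      add_mul, Finset.sum_add_distrib]
    have h1 : volSlope e₀ a y = s * volSlope e₀ a y + t * volSlope e₀ a y := by
      rw [← add_mul, hst, one_mul]
    nth_rewrite 1 [h1]
    simp only [mul_assoc]
    ring
  rw [h]
  have h1 := hz a ha y hy
  have h2 := hz' a ha y hy
  obtain rfl | hs := hs.eq_or_lt
  · have : t = 1 := by linarith
    subst this
    linarith
  · nlinarith [mul_neg_of_pos_of_neg hs h1, mul_nonpos_of_nonneg_of_nonpos ht h2.le]

theorem analyticOnNhd_mellinSum (F : ParametricIntegrand E R ι) (e₀ : E) :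
    AnalyticOnNhd ℂ (F.mellinSum e₀) (F.regDomain e₀) := by
  intro z hz
  refine Finset.analyticAt_fun_sum _ fun a ha =>
    (analyticOnNhd_eval _ z (Set.mem_univ z)).mul ?_
  exact (analyticAt_mellinIntegral _ _ (hz a ha)).comp (F.analyticAt_exponents z)

theorem hasContinuation_mellinSum (F : ParametricIntegrand E R ι) (e₀ : E) (r : ℝ) :
    HasContinuation (F.regDomain e₀) (Metric.ball 0 r) (F.mellinSum e₀) :=
  HasContinuation.finset_sum _ fun a ha => HasContinuation.analytic_mul (analyticOnNhd_eval _)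
    (hasContinuation_mellinIntegral (F.polySum e₀) volume F.analyticOnNhd_exponents
      (fun z (hz : z ∈ F.regDomain e₀) => hz a ha) r)

theorem mem_convergenceSet (F : ParametricIntegrand E R ι) (e₀ : E) {z : R → ℂ}
    (hz : z ∈ F.regDomain e₀) (hq : eval z F.denom ≠ 0) : z ∈ F.convergenceSet e₀ := by
  refine ⟨hq, ?_⟩
  rw [integrableOn_pos_iff]
  simp only [exp_smul_value]
  exact (integrable_finsetSum _ fun a ha =>
    (integrable_mellinIntegrand _ _ (hz a ha)).const_mul _).const_mul _

theorem projIntegral_eq (F : ParametricIntegrand E R ι) (e₀ : E) {z : R → ℂ}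
    (hz : z ∈ F.regDomain e₀) : F.projIntegral e₀ z = F.mellinSum e₀ z / eval z F.denom := by
  rw [projIntegral, integral_pos_eq]
  simp only [exp_smul_value]
  rw [integral_const_mul, integral_finsetSum _ fun a ha =>
    (integrable_mellinIntegrand _ _ (hz a ha)).const_mul _, mellinSum, one_div_mul_eq_div]
  simp only [integral_const_mul]
  rfl

end ParametricIntegrand

theorem MvPolynomial.eval_eulerOp_eq_sum {σ S : Type*} [Fintype σ] [CommRing S] (v : σ → ℤ)
    (p : MvPolynomial σ S) (x : σ → S) : eval x (eulerOp v p)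
      = ∑ a ∈ p.support, (Finsupp.weight v a : S) * (coeff a p * ∏ e, x e ^ a e) := by
  rw [eval_eq', Finset.sum_subset (support_eulerOp_subset v p)]
  · refine Finset.sum_congr rfl fun a _ => ?_
    rw [coeff_eulerOp, zsmul_eq_mul, mul_assoc]
  · intro a _ ha
    rw [notMem_support_iff.1 ha, zero_mul]

/-! ### Integration by parts on the hyperplane and domains of convergence -/

namespace ParametricIntegrand

open MvPolynomial MeasureTheory

variable {E R ι : Type*} [Fintype E] [DecidableEq E] [Fintype ι]

/-- Subtracting the constant v e₀ removes the component at e₀, so the direction is tangent to the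
hyperplane. The cost is v e₀ times the degree of the monomial. -/
theorem slopeAt_intCast (e₀ : E) (a : E →₀ ℕ) (v : E → ℤ) (c : ℤ) (hc : v e₀ = c) :
    slopeAt e₀ a (fun e => (v e : ℝ) - c) = Finsupp.weight v a - c * Finsupp.weight (1 : E → ℕ) a := by
  rw [slopeAt_apply, ← sum_extendZero e₀ (fun e => (a e : ℝ) * ((v e : ℝ) - c)) (by simp [hc]),
    Finsupp.weight_eq_sum, Finsupp.weight_eq_sum]
  simp only [mul_sub, Finset.sum_sub_distrib]
  push_cast
  simp [Finset.mul_sum, mul_comm]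

theorem polySum_dirDeriv (F : ParametricIntegrand E R ι) (e₀ : E) (i : ι) (v : E → ℤ)
    (y : {e : E // e ≠ e₀} → ℝ) :
    (F.polySum e₀ i).dirDeriv (fun e => (v e : ℝ) - v e₀) y
      = eval (fun e => Real.exp (extendZero e₀ y e)) (eulerOp v (F.poly i)) -
        v e₀ * F.polyDeg i * (F.polySum e₀ i).val y := by
  have hsupp : (F.polySum e₀ i).supp = (F.poly i).support := rfl
  rw [eval_eulerOp_eq_sum, PosExpSum.dirDeriv, PosExpSum.val, Finset.mul_sum, hsupp,
    ← Finset.sum_sub_distrib]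
  refine Finset.sum_congr rfl fun a ha => ?_
  change coeff a (F.poly i) * Real.exp (slopeAt e₀ a y) * slopeAt e₀ a _ =
    _ - _ * (coeff a (F.poly i) * Real.exp (slopeAt e₀ a y))
  rw [slopeAt_intCast e₀ a v _ rfl, F.poly_homogeneous i (mem_support_iff.1 ha),
    prod_exp_extendZero]
  ring

omit [DecidableEq E] in
theorem degree_eq_eval (F : ParametricIntegrand E R ι) (z : R → ℂ) :
    (F.numerDeg : ℂ) + ∑ i, (F.polyDeg i : ℂ) * F.exponents z i = -(Fintype.card E : ℂ) := by
  have := congrArg (eval z) F.degree_eq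
  simpa [exponents] using this

/-- Projectivity enters here: the shift by v e₀ contributes a multiple of the total degree of F plus
|E|, which is zero. The sum of the v e comes from the volume form. -/
theorem mellinLogDeriv_volSlope (F : ParametricIntegrand E R ι) (e₀ : E) (v : E → ℤ) (z : R → ℂ)
    {a : E →₀ ℕ} (ha : a ∈ F.numer.support) (y : {e : E // e ≠ e₀} → ℝ) :
    mellinLogDeriv (F.polySum e₀) (volSlope e₀ a) (F.exponents z) (fun e => (v e : ℝ) - v e₀) y
      = Finsupp.weight v a + ∑ e, (v e : ℂ) + ∑ i, F.exponents z i *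
        ((eval (fun e => Real.exp (extendZero e₀ y e)) (eulerOp v (F.poly i)) /
          eval (fun e => Real.exp (extendZero e₀ y e)) (F.poly i) : ℝ) : ℂ) := by
  have h1 : volSlope e₀ a (fun e => (v e : ℝ) - v e₀)
      = Finsupp.weight v a - v e₀ * F.numerDeg + (∑ e, (v e : ℝ) - v e₀ * Fintype.card E) := by
    rw [volSlope_apply, slopeAt_intCast e₀ a v _ rfl, F.numer_homogeneous (mem_support_iff.1 ha),
      ← sum_extendZero e₀ (fun e => (v e : ℝ) - v e₀) (by simp)]
    simp [mul_comm]
  have h2 : ∀ i, (F.polySum e₀ i).dirDeriv (fun e => (v e : ℝ) - v e₀) y / (F.polySum e₀ i).val y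
      = eval (fun e => Real.exp (extendZero e₀ y e)) (eulerOp v (F.poly i)) /
          eval (fun e => Real.exp (extendZero e₀ y e)) (F.poly i) - v e₀ * F.polyDeg i := by
    intro i
    rw [polySum_dirDeriv, ← polySum_val, sub_div, mul_div_cancel_right₀ _
      ((F.polySum e₀ i).val_pos y).ne']
  have h3 := F.degree_eq_eval z
  have h4 : ∑ i, F.exponents z i * (((v e₀ : ℝ) * F.polyDeg i : ℝ) : ℂ)
      = v e₀ * ∑ i, (F.polyDeg i : ℂ) * F.exponents z i := by
    rw [Finset.mul_sum]
    refine Finset.sum_congr rfl fun i _ => ?_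
    push_cast
    ring
  simp only [mellinLogDeriv, h1, h2, Complex.ofReal_sub, mul_sub (F.exponents z _),
    Finset.sum_sub_distrib, h4]
  push_cast
  linear_combination (-(v e₀ : ℂ)) * h3

theorem exp_mul_eulerValue (F : ParametricIntegrand E R ι) (e₀ : E) (v : E → ℤ) (z : R → ℂ)
    (y : {e : E // e ≠ e₀} → ℝ) :
    (Real.exp (∑ e, y e) : ℂ) * F.eulerValue v z (fun e => Real.exp (extendZero e₀ y e))
      = 1 / eval z F.denom * ∑ a ∈ F.numer.support, eval z (coeff a F.numer) *
        (mellinIntegrand (F.polySum e₀) (volSlope e₀ a) (F.exponents z) y *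
          (mellinLogDeriv (F.polySum e₀) (volSlope e₀ a) (F.exponents z)
            (fun e => (v e : ℝ) - v e₀) y - ∑ e, (v e : ℂ))) := by
  have h : ∀ a ∈ F.numer.support, eval z (coeff a F.numer) *
        (mellinIntegrand (F.polySum e₀) (volSlope e₀ a) (F.exponents z) y *
          (mellinLogDeriv (F.polySum e₀) (volSlope e₀ a) (F.exponents z)
            (fun e => (v e : ℝ) - v e₀) y - ∑ e, (v e : ℂ)))
      = (Real.exp (∑ e, y e) : ℂ) * ((Finsupp.weight v a : ℂ) * (eval z (coeff a F.numer) *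
          ∏ e, ((Real.exp (extendZero e₀ y e) : ℝ) : ℂ) ^ a e) + (eval z (coeff a F.numer) *
          ∏ e, ((Real.exp (extendZero e₀ y e) : ℝ) : ℂ) ^ a e) * ∑ i, F.exponents z i *
        ((eval (fun e => Real.exp (extendZero e₀ y e)) (eulerOp v (F.poly i)) /
          eval (fun e => Real.exp (extendZero e₀ y e)) (F.poly i) : ℝ) : ℂ)) *
          F.powers z (fun e => Real.exp (extendZero e₀ y e)) := by
    intro a ha
    rw [F.mellinLogDeriv_volSlope e₀ v z ha, mellinIntegrand_volSlope]
    ring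
  rw [Finset.sum_congr rfl h, ← Finset.sum_mul, ← Finset.mul_sum, Finset.sum_add_distrib,
    ← Finset.sum_mul, ← eval_eulerOp_numerAt, ← eval_numerAt, eulerValue]
  simp only [exponents]
  ring

variable [Fintype R] [DecidableEq ι]

omit [Fintype R] [DecidableEq E] in
theorem eulerIntegrand_exponents (F : ParametricIntegrand E R ι) (v : E → ℤ)
    (b ω : MvPolynomial R ℂ) (hω : ω ≠ 0) (z : R → ℂ) (i : ι) :
    (F.eulerIntegrand v b ω hω).exponents z i = F.exponents z i - 1 := by
  change eval z (F.expo i - 1) = _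
  simp [exponents]

-- A maximal slope in the direction y is a minimal weight for -y. The new numerator raises the
-- maximal slope by at most the sum of the `trop`_i(y), and lowering all exponents by one subtracts
-- exactly this sum.
omit [Fintype R] in
theorem regDomain_subset_eulerIntegrand (F : ParametricIntegrand E R ι) (hF : F.numer ≠ 0)
    (v : E → ℤ) (b ω : MvPolynomial R ℂ) (hω : ω ≠ 0) (e₀ : E) :
    F.regDomain e₀ ⊆ (F.eulerIntegrand v b ω hω).regDomain e₀ := by
  intro z hz a ha y hy
  obtain ⟨a₀, ha₀, hmax⟩ := F.numer.support.exists_max_image (fun a => slopeAt e₀ a y)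
    (support_nonempty.2 hF)
  have hneg : ∀ a : E →₀ ℕ, Finsupp.weight (fun e => -extendZero e₀ y e) a = -slopeAt e₀ a y := by
    intro a
    rw [slopeAt_eq_weight, Finsupp.weight_eq_sum, Finsupp.weight_eq_sum]
    simp
  have h1 : F.numer.WeightGE (fun e => -extendZero e₀ y e) (-slopeAt e₀ a₀ y) := by
    intro a ha
    rw [hneg]
    exact neg_le_neg (hmax a ha)
  have h2 : ∀ i, (F.poly i).WeightGE (fun e => -extendZero e₀ y e)
      (-(F.polySum e₀ i).trop y) := by
    intro i a ha
    rw [hneg]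
    exact neg_le_neg ((F.polySum e₀ i).le_trop ha y)
  have h3 := F.eulerNumer_weightGE v b h1 h2 a ha
  rw [hneg, Finset.sum_neg_distrib] at h3
  have h4 := hz a₀ ha₀ y hy
  simp only [mellinGrowth, eulerIntegrand_exponents, volSlope_apply, Complex.sub_re, Complex.one_re,
    sub_mul, one_mul, Finset.sum_sub_distrib] at h4 ⊢
  change _ + (∑ i, (F.exponents z i).re * (F.polySum e₀ i).trop y -
    ∑ i, (F.polySum e₀ i).trop y) < 0
  linarith

/-- The choice of b cancels the constant ∑ v_e, so the integrands differ by a combination of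
directional derivatives, each of integral zero. -/
theorem projIntegral_eulerIntegrand (F : ParametricIntegrand E R ι) (v : E → ℤ)
    {b ω : MvPolynomial R ℂ} (hω : ω ≠ 0) (hb : b = ω - ∑ e, (v e : MvPolynomial R ℂ)) (e₀ : E)
    {z : R → ℂ} (hz : z ∈ F.regDomain e₀) (hωz : eval z ω ≠ 0) :
    (F.eulerIntegrand v b ω hω).projIntegral e₀ z = F.projIntegral e₀ z := by
  have hval : ∀ y : {e : E // e ≠ e₀} → ℝ, Real.exp (∑ e, y e) •
      (F.eulerIntegrand v b ω hω).value z (onHyperplane e₀ fun e => Real.exp (y e))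
      = Real.exp (∑ e, y e) • F.value z (onHyperplane e₀ fun e => Real.exp (y e)) -
        1 / eval z ω * (1 / eval z F.denom) * ∑ a ∈ F.numer.support, eval z (coeff a F.numer) *
        (mellinIntegrand (F.polySum e₀) (volSlope e₀ a) (F.exponents z) y *
          mellinLogDeriv (F.polySum e₀) (volSlope e₀ a) (F.exponents z)
            (fun e => (v e : ℝ) - v e₀) y) := by
    intro y
    have h1 := F.exp_smul_value e₀ z y
    have h2 := F.exp_mul_eulerValue e₀ v z y
    rw [onHyperplane_exp, Complex.real_smul] at h1
    rw [onHyperplane_exp, F.eulerIntegrand_value v b ω hω z (fun e => Real.exp_pos _),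
      Complex.real_smul, Complex.real_smul]
    have h3 : eval z b = eval z ω - ∑ e, (v e : ℂ) := by
      rw [hb]
      simp
    have h4 : ∑ a ∈ F.numer.support, eval z (coeff a F.numer) *
        (mellinIntegrand (F.polySum e₀) (volSlope e₀ a) (F.exponents z) y *
          (mellinLogDeriv (F.polySum e₀) (volSlope e₀ a) (F.exponents z)
            (fun e => (v e : ℝ) - v e₀) y - ∑ e, (v e : ℂ)))
        = ∑ a ∈ F.numer.support, eval z (coeff a F.numer) *
        (mellinIntegrand (F.polySum e₀) (volSlope e₀ a) (F.exponents z) y *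
          mellinLogDeriv (F.polySum e₀) (volSlope e₀ a) (F.exponents z)
            (fun e => (v e : ℝ) - v e₀) y) - (∑ e, (v e : ℂ)) *
          ∑ a ∈ F.numer.support, eval z (coeff a F.numer) *
        mellinIntegrand (F.polySum e₀) (volSlope e₀ a) (F.exponents z) y := by
      rw [Finset.mul_sum, ← Finset.sum_sub_distrib]
      exact Finset.sum_congr rfl fun a _ => by ring
    rw [h4] at h2
    rw [h3]
    have hc : eval z ω * (1 / eval z ω) = 1 := mul_one_div_cancel hωz
    linear_combination (-(1 / eval z ω)) * h2 - (1 / eval z ω) * (∑ e, (v e : ℂ)) * h1 +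
      (Real.exp (∑ e, y e) : ℂ) * F.value z (fun e => Real.exp (extendZero e₀ y e)) * hc
  have hint : ∀ a ∈ F.numer.support, Integrable fun y => eval z (coeff a F.numer) *
        (mellinIntegrand (F.polySum e₀) (volSlope e₀ a) (F.exponents z) y *
          mellinLogDeriv (F.polySum e₀) (volSlope e₀ a) (F.exponents z)
            (fun e => (v e : ℝ) - v e₀) y) := fun a ha =>
    (integrable_mellinIntegrand_mul_mellinLogDeriv _ _ (hz a ha) _).const_mul _
  rw [projIntegral, projIntegral, integral_pos_eq, integral_pos_eq]
  simp only [hval]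
  rw [integral_sub, integral_const_mul, integral_finsetSum _ hint, Finset.sum_eq_zero, mul_zero,
    sub_zero]
  · intro a ha
    rw [integral_const_mul, integral_mellinIntegrand_mul_mellinLogDeriv _ _ (hz a ha), mul_zero]
  · simp only [exp_smul_value]
    exact (integrable_finsetSum _ fun a ha =>
      (integrable_mellinIntegrand _ _ (hz a ha)).const_mul _).const_mul _
  · exact (integrable_finsetSum _ hint).const_mul _

omit [DecidableEq ι]

-- The chosen monomials form a non-zero homogeneous polynomial. It is non-zero somewhere on the
-- positive orthant, and homogeneity moves that point to the hyperplane.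
omit [Fintype R] in
theorem exists_sum_exp_volSlope_ne_zero (F : ParametricIntegrand E R ι) (e₀ : E) {z : R → ℂ}
    (hz : ∀ a ∈ F.numer.support, eval z (coeff a F.numer) ≠ 0) {T : Finset (E →₀ ℕ)}
    (hT : T ⊆ F.numer.support) (hne : T.Nonempty) :
    ∃ y, ∑ a ∈ T, eval z (coeff a F.numer) * (Real.exp (volSlope e₀ a y) : ℂ) ≠ 0 := by
  set Q : MvPolynomial E ℂ := ∑ a ∈ T, monomial a (eval z (coeff a F.numer)) with hQ
  have hQ0 : Q ≠ 0 := by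
    obtain ⟨a, ha⟩ := hne
    intro h0
    have := congrArg (coeff a) h0
    simp only [hQ, coeff_sum, coeff_monomial, Finset.sum_ite_eq', if_pos ha, coeff_zero] at this
    exact hz a (hT ha) this
  have hQh : Q.IsHomogeneous F.numerDeg := by
    refine IsHomogeneous.sum _ _ _ fun a ha => isHomogeneous_monomial _ ?_
    have := F.numer_homogeneous (mem_support_iff.1 (hT ha))
    rw [Finsupp.degree_eq_weight_one]
    exact this
  obtain ⟨α, hα, hne⟩ := exists_pos_eval_ne_zero hQ0
  refine ⟨fun e => Real.log ((α e₀)⁻¹ * α e), ?_⟩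
  have hexp : (fun e => Real.exp (extendZero e₀ (fun e => Real.log ((α e₀)⁻¹ * α e)) e))
      = fun e => (α e₀)⁻¹ * α e := by
    funext e
    simp only [extendZero]
    split_ifs with h
    · rw [h, Real.exp_zero, inv_mul_cancel₀ (hα e₀).ne']
    · exact Real.exp_log (mul_pos (inv_pos.2 (hα e₀)) (hα e))
  have heval := hQh.eval_smul (((α e₀)⁻¹ : ℝ) : ℂ) (fun e => (α e : ℂ))
  have hterm : ∑ a ∈ T, eval z (coeff a F.numer) *
      (Real.exp (volSlope e₀ a fun e => Real.log ((α e₀)⁻¹ * α e)) : ℂ)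
      = eval (fun e => (((α e₀)⁻¹ : ℝ) : ℂ) * (α e : ℂ)) Q *
        (Real.exp (∑ e : {e : E // e ≠ e₀}, Real.log ((α e₀)⁻¹ * α e)) : ℂ) := by
    rw [hQ, map_sum, Finset.sum_mul]
    refine Finset.sum_congr rfl fun a _ => ?_
    have h1 := prod_exp_extendZero e₀ a fun e => Real.log ((α e₀)⁻¹ * α e)
    simp only [fun e => congrFun hexp e] at h1
    rw [volSlope_apply, Real.exp_add, ← h1, eval_monomial, Finsupp.prod_fintype _ _ (by simp)]
    push_cast
    ring
  rw [hterm, heval]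
  refine mul_ne_zero (mul_ne_zero (pow_ne_zero _ ?_) hne) ?_
  · exact_mod_cast (inv_pos.2 (hα e₀)).ne'
  · exact_mod_cast (Real.exp_pos _).ne'

/-- If no coefficient vanishes at z, the leading part in any direction is non-zero, so integrability
of the sum forces decay of the monomials of maximal slope and hence of all others. -/
theorem mem_regDomain_of_generic (F : ParametricIntegrand E R ι) (e₀ : E) {z : R → ℂ}
    (hz : z ∈ F.convergenceSet e₀) (hc : ∀ a ∈ F.numer.support, eval z (coeff a F.numer) ≠ 0) :
    z ∈ F.regDomain e₀ := by
  intro a ha y hy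
  obtain ⟨hq, hint⟩ := hz
  rw [integrableOn_pos_iff] at hint
  simp only [exp_smul_value] at hint
  have hint' : Integrable fun y => ∑ a ∈ F.numer.support, eval z (coeff a F.numer) *
      mellinIntegrand (F.polySum e₀) (volSlope e₀ a) (F.exponents z) y := by
    have := hint.const_mul (eval z F.denom)
    simpa only [← mul_assoc, mul_one_div_cancel hq, one_mul] using this
  obtain ⟨a₀, ha₀, hmax⟩ := F.numer.support.exists_max_image (fun a => volSlope e₀ a y) ⟨a, ha⟩
  have h := mellinGrowth_neg_of_integrable (F.polySum e₀) volume F.numer.support (volSlope e₀)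
    (fun a => eval z (coeff a F.numer)) (F.exponents z) hint' hy hmax
    (F.exists_sum_exp_volSlope_ne_zero e₀ hc (Finset.filter_subset _ _)
      ⟨a₀, Finset.mem_filter.2 ⟨ha₀, rfl⟩⟩)
  have := hmax a ha
  simp only [mellinGrowth]
  linarith

/-- At special z a leading coefficient may vanish. An interior point is nevertheless the midpoint of
two generic points of the interior, exchanged by the reflection `ρ`, and `regDomain` is convex. -/
theorem interior_convergenceSet_subset (F : ParametricIntegrand E R ι) (e₀ : E) :
    interior (F.convergenceSet e₀) ⊆ F.regDomain e₀ := by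
  intro z hz
  set c : MvPolynomial R ℂ := ∏ a ∈ F.numer.support, coeff a F.numer with hc
  have hc0 : c ≠ 0 := Finset.prod_ne_zero_iff.2 fun a ha => mem_support_iff.1 ha
  have hcz : ∀ z, eval z c ≠ 0 → ∀ a ∈ F.numer.support, eval z (coeff a F.numer) ≠ 0 := by
    intro z h a ha
    rw [hc, map_prod] at h
    exact Finset.prod_ne_zero_iff.1 h a ha
  let ρ : (R → ℂ) ≃ₜ (R → ℂ) := Homeomorph.subLeft (z + z)
  have hopen : IsOpen {z : R → ℂ | eval z c ≠ 0} :=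
    isOpen_ne_fun (continuousOn_univ.1 (analyticOnNhd_eval c).continuousOn) continuous_const
  have hd := dense_eval_ne_zero hc0
  have hd2 : Dense (ρ ⁻¹' {z : R → ℂ | eval z c ≠ 0}) := hd.preimage ρ.isOpenMap
  have hd3 := hd.inter_of_isOpen_left hd2 hopen
  have hU : IsOpen (interior (F.convergenceSet e₀) ∩ ρ ⁻¹' interior (F.convergenceSet e₀)) :=
    isOpen_interior.inter (isOpen_interior.preimage ρ.continuous)
  obtain ⟨z', ⟨h1, h2⟩, h3, h4⟩ := hd3.inter_open_nonempty _ hU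
    ⟨z, hz, by simpa [ρ] using hz⟩
  have h5 := F.mem_regDomain_of_generic e₀ (interior_subset h1) (hcz _ h3)
  have h6 := F.mem_regDomain_of_generic e₀ (interior_subset h2) (hcz _ h4)
  have h7 := F.convex_regDomain e₀ h5 h6 (a := 1 / 2) (b := 1 / 2) (by norm_num) (by norm_num)
    (by norm_num)
  convert h7 using 1
  funext r
  simp only [ρ, Homeomorph.subLeft_apply, Pi.add_apply, Pi.smul_apply, Pi.sub_apply,
    Complex.real_smul]
  push_cast
  ring

end ParametricIntegrand

/-! ### Gluing the local continuations -/

/-- Local continuations of `M / q` on `D₀` and `MG / (q * ω)` on a larger convex domain `DG`, with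
`MG = ω * M` on `D₀`, glue to a meromorphic function. -/
theorem exists_isMeromorphic {R : Type*} [Fintype R] {D₀ DG : Set (R → ℂ)}
    {M MG : (R → ℂ) → ℂ} {q ω : MvPolynomial R ℂ} (hq : q ≠ 0) (hω : ω ≠ 0)
    (hD₀ : IsOpen D₀) (hne : D₀.Nonempty) (hDG : Convex ℝ DG) (hsub : D₀ ⊆ DG)
    (hMG : AnalyticOnNhd ℂ MG DG) (hcont : ∀ r, HasContinuation D₀ (Metric.ball 0 r) M)
    (hrel : ∀ z ∈ D₀, MvPolynomial.eval z (q * ω) ≠ 0 →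
      MG z = MvPolynomial.eval z ω * M z) :
    ∃ I : (R → ℂ) → ℂ, IsMeromorphic I ∧
      (∀ z ∈ D₀, MvPolynomial.eval z q ≠ 0 → I z = M z / MvPolynomial.eval z q) ∧
      (∀ z ∈ DG, MvPolynomial.eval z (q * ω) ≠ 0 →
        I z = MG z / MvPolynomial.eval z (q * ω)) := by
  classical
  choose h g hh hg hD using hcont
  obtain ⟨z₁, hz₁⟩ := hne
  have hqω : q * ω ≠ 0 := mul_ne_zero hq hω
  have hdense := MvPolynomial.dense_eval_ne_zero hqω
  have ha : ∀ (p : MvPolynomial R ℂ) (S : Set (R → ℂ)),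
      AnalyticOnNhd ℂ (fun z => MvPolynomial.eval z p) S := fun p S =>
    (MvPolynomial.analyticOnNhd_eval p).mono (Set.subset_univ _)
  obtain ⟨n₀, hn₀⟩ := exists_nat_gt ‖z₁‖
  let r : ℕ → ℝ := fun n => n + n₀
  have hball : ∀ n, z₁ ∈ Metric.ball (0 : R → ℂ) (r n) := fun n => by
    rw [mem_ball_zero_iff]
    have : (0 : ℝ) ≤ n := Nat.cast_nonneg n
    simp only [r]
    linarith
  -- The quotients are compared after cross-multiplication because the denominators may vanish. All
  -- balls contain z₁, so the identity theorem applies on their convex intersection.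
  have hcompat : ∀ m n, ∀ z ∈ Metric.ball (0 : R → ℂ) (r m) ∩ Metric.ball 0 (r n),
      g (r m) z * h (r n) z = g (r n) z * h (r m) z := by
    intro m n
    refine AnalyticOnNhd.eqOn_of_preconnected_of_eventuallyEq (𝕜 := ℂ) (z₀ := z₁) ?_ ?_
      ((convex_ball _ _).inter (convex_ball _ _)).isPreconnected ⟨hball m, hball n⟩ ?_
    · exact ((hg (r m)).mono Set.inter_subset_left).mul ((hh (r n)).mono (Set.subset_univ _))
    · exact ((hg (r n)).mono Set.inter_subset_right).mul ((hh (r m)).mono (Set.subset_univ _))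
    · filter_upwards [hD₀.mem_nhds hz₁] with z hz
      rw [(hD (r m) z hz).2, (hD (r n) z hz).2]
      ring
  -- The relation known on D₀ spreads over the connected set DG ∩ ball, including points where the
  -- integral of F need not converge.
  have hG : ∀ n, ∀ z ∈ DG ∩ Metric.ball (0 : R → ℂ) (r n),
      h (r n) z * MG z = MvPolynomial.eval z ω * g (r n) z := by
    intro n
    obtain ⟨z₂, ⟨hz₂, hz₂b⟩, hz₂q⟩ := hdense.inter_open_nonempty _
      (hD₀.inter (Metric.isOpen_ball (x := (0 : R → ℂ)) (ε := r n))) ⟨z₁, hz₁, hball n⟩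
    refine AnalyticOnNhd.eqOn_of_preconnected_of_eventuallyEq (𝕜 := ℂ) (z₀ := z₂) ?_ ?_
      (hDG.inter (convex_ball _ _)).isPreconnected ⟨hsub hz₂, hz₂b⟩ ?_
    · exact ((hh (r n)).mono (Set.subset_univ _)).mul (hMG.mono Set.inter_subset_left)
    · exact (ha ω _).mul ((hg (r n)).mono Set.inter_subset_right)
    · have hev : ∀ᶠ z in 𝓝 z₂, MvPolynomial.eval z (q * ω) ≠ 0 :=
        (ha (q * ω) Set.univ z₂ (Set.mem_univ _)).continuousAt.eventually_ne hz₂q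
      filter_upwards [hD₀.mem_nhds hz₂, hev] with z hz hzq
      rw [hrel z hz hzq, (hD (r n) z hz).2]
      ring
  let P : (R → ℂ) → ℕ → Prop := fun z n => z ∈ Metric.ball (0 : R → ℂ) (r n) ∧ h (r n) z ≠ 0
  -- Exact values are prescribed on D₀ and on DG away from the zeros of the polynomial denominators,
  -- even at points of DG where h vanishes. They therefore take precedence over the local quotients;
  -- `hI` shows that all cases agree where h, q and ω are non-zero.
  let I : (R → ℂ) → ℂ := fun z =>
    if z ∈ D₀ ∧ MvPolynomial.eval z q ≠ 0 then M z / MvPolynomial.eval z q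
    else if z ∈ DG ∧ MvPolynomial.eval z (q * ω) ≠ 0 then MG z / MvPolynomial.eval z (q * ω)
    else if hn : ∃ n, P z n then
      g (r hn.choose) z / (h (r hn.choose) z * MvPolynomial.eval z q)
    else 0
  have hI : ∀ n z, P z n → MvPolynomial.eval z (q * ω) ≠ 0 →
      I z = g (r n) z / (h (r n) z * MvPolynomial.eval z q) := by
    rintro n z ⟨hzn, hhz⟩ hz
    have hz' := hz
    rw [map_mul] at hz'
    have hq' := left_ne_zero_of_mul hz'
    have hω' := right_ne_zero_of_mul hz'
    simp only [I]
    split_ifs with h1 h2 h3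
    · rw [(hD (r n) z h1.1).2, mul_div_mul_left _ _ hhz]
    · rw [map_mul, div_eq_div_iff (mul_ne_zero hq' hω') (mul_ne_zero hhz hq')]
      linear_combination (MvPolynomial.eval z q) * hG n z ⟨h2.1, hzn⟩
    · obtain ⟨h4, h5⟩ := h3.choose_spec
      rw [div_eq_div_iff (mul_ne_zero h5 hq') (mul_ne_zero hhz hq')]
      linear_combination (MvPolynomial.eval z q) * hcompat _ _ z ⟨h4, hzn⟩
    · exact absurd ⟨n, hzn, hhz⟩ h3
  refine ⟨I, ?_, ?_, ?_⟩
  · intro z₀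
    obtain ⟨n, hn⟩ := exists_nat_gt ‖z₀‖
    have hz₀ : z₀ ∈ Metric.ball (0 : R → ℂ) (r n) := by
      rw [mem_ball_zero_iff]
      have : (0 : ℝ) ≤ n₀ := Nat.cast_nonneg n₀
      simp only [r]
      linarith
    have hden : AnalyticOnNhd ℂ (fun z => h (r n) z * MvPolynomial.eval z (q * ω)) Set.univ :=
      (hh (r n)).mul (ha _ _)
    refine ⟨fun z => g (r n) z * MvPolynomial.eval z ω,
      fun z => h (r n) z * MvPolynomial.eval z (q * ω), (hg (r n) z₀ hz₀).mul (ha _ _ z₀ hz₀),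
      hden z₀ (Set.mem_univ _), ?_, ?_⟩
    · intro hzero
      have h0 := hden.eqOn_of_preconnected_of_eventuallyEq
        (analyticOnNhd_const (v := (0 : ℂ))) isPreconnected_univ (Set.mem_univ z₀) hzero
      obtain ⟨z₂, hz₂, hz₂q⟩ := hdense.inter_open_nonempty _ hD₀ ⟨z₁, hz₁⟩
      exact mul_ne_zero (hD (r n) z₂ hz₂).1 hz₂q (h0 (Set.mem_univ z₂))
    · filter_upwards [Metric.isOpen_ball.mem_nhds hz₀] with z hz hne
      have h1 := left_ne_zero_of_mul hne
      have h2 := right_ne_zero_of_mul hne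
      rw [hI n z ⟨hz, h1⟩ h2, map_mul]
      rw [map_mul] at h2
      rw [← mul_assoc, mul_div_mul_right _ _ (right_ne_zero_of_mul h2)]
  · intro z hz hzq
    simp only [I, if_pos (And.intro hz hzq)]
  · intro z hz hzq
    by_cases h1 : z ∈ D₀ ∧ MvPolynomial.eval z q ≠ 0
    · simp only [I, if_pos h1]
      rw [hrel z h1.1 hzq]
      rw [map_mul] at hzq ⊢
      rw [mul_comm (MvPolynomial.eval z q), mul_div_mul_left _ _ (right_ne_zero_of_mul hzq)]
    · simp only [I, if_neg h1, if_pos (And.intro hz hzq)]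

/-! ### Common regularisation and degrees of the new integrand -/

namespace ParametricIntegrand

open MvPolynomial

variable {E R ι : Type*} [Fintype E] [DecidableEq E] [Fintype ι] [DecidableEq ι] [Fintype R]

theorem exists_isAnalyticRegularization_eulerIntegrand (F : ParametricIntegrand E R ι)
    (hF : F.numer ≠ 0) (v : E → ℤ) {b ω : MvPolynomial R ℂ} (hω : ω ≠ 0)
    (hb : b = ω - ∑ e, (v e : MvPolynomial R ℂ)) (e₀ : E)
    (hne : (interior (F.convergenceSet e₀)).Nonempty) :
    ∃ I, F.IsAnalyticRegularization e₀ I ∧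
      (F.eulerIntegrand v b ω hω).IsAnalyticRegularization e₀ I := by
  set G := F.eulerIntegrand v b ω hω with hG
  have hsub : F.regDomain e₀ ⊆ G.regDomain e₀ := F.regDomain_subset_eulerIntegrand hF v b ω hω e₀
  have hdom : (F.regDomain e₀).Nonempty := hne.mono (F.interior_convergenceSet_subset e₀)
  have hGd : G.denom = F.denom * ω := rfl
  obtain ⟨I, hI, hIF, hIG⟩ := exists_isMeromorphic F.denom_ne_zero hω (F.isOpen_regDomain e₀) hdom
    (G.convex_regDomain e₀) hsub (G.analyticOnNhd_mellinSum e₀) (F.hasContinuation_mellinSum e₀) (by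
      intro z hz hqz
      have h1 := F.projIntegral_eulerIntegrand v hω hb e₀ hz
        (right_ne_zero_of_mul (by rwa [map_mul] at hqz))
      rw [← hG, F.projIntegral_eq e₀ hz, G.projIntegral_eq e₀ (hsub hz), hGd] at h1
      rw [map_mul] at h1 hqz
      rw [div_eq_div_iff hqz (left_ne_zero_of_mul hqz)] at h1
      refine mul_right_cancel₀ (left_ne_zero_of_mul hqz) ?_
      rw [h1]
      ring)
  refine ⟨I, ⟨hne, hI, fun z hz => ?_⟩, ⟨?_, hI, fun z hz => ?_⟩⟩
  · have h1 := F.interior_convergenceSet_subset e₀ hz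
    rw [hIF z h1 (interior_subset hz).1, F.projIntegral_eq e₀ h1]
  -- The new integral converges on the domain of F off the zeros of the new denominator, and this
  -- set is open and non-empty.
  · obtain ⟨z, hz, hzq⟩ := (dense_eval_ne_zero G.denom_ne_zero).inter_open_nonempty _
      (F.isOpen_regDomain e₀) hdom
    have hopen : IsOpen (F.regDomain e₀ ∩ {z : R → ℂ | eval z G.denom ≠ 0}) :=
      (F.isOpen_regDomain e₀).inter (isOpen_ne_fun
        (continuousOn_univ.1 (analyticOnNhd_eval G.denom).continuousOn) continuous_const)
    exact ⟨z, interior_maximal (fun z' hz' => G.mem_convergenceSet e₀ (hsub hz'.1) hz'.2) hopen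
      ⟨hz, hzq⟩⟩
  · have h1 := G.interior_convergenceSet_subset e₀ hz
    rw [hIG z h1 (interior_subset hz).1, G.projIntegral_eq e₀ h1, hGd]

omit [DecidableEq ι] in
theorem hasDivergenceDegree_iff (F : ParametricIntegrand E R ι) (J K : Finset E) {d : ℤ}
    {dp : ι → ℤ} (hd : IsInitialWeight (scalingWeight J K) d F.numer)
    (hdp : ∀ i, IsInitialWeight (scalingWeight J K) (dp i) (F.poly i)) (w : MvPolynomial R ℂ) :
    F.HasDivergenceDegree J K w ↔ w = (J.card : MvPolynomial R ℂ) - (K.card : MvPolynomial R ℂ) +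
      ((d : MvPolynomial R ℂ) + ∑ i, (dp i : MvPolynomial R ℂ) * F.expo i) := by
  have h : F.HasDivergenceDegree J K ((J.card : MvPolynomial R ℂ) - (K.card : MvPolynomial R ℂ) +
      ((d : MvPolynomial R ℂ) + ∑ i, (dp i : MvPolynomial R ℂ) * F.expo i)) :=
    ⟨_, F.hasVanishingDegree J K hd hdp, rfl⟩
  exact ⟨fun hw => hw.unique h, fun hw => hw ▸ h⟩

/-- The degree of divergence of `eulerIntegrand` exceeds that of `F` by the difference of the
minimal weights of the numerators. -/
theorem eulerIntegrand_hasDivergenceDegree (F : ParametricIntegrand E R ι) (v : E → ℤ)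
    {b ω : MvPolynomial R ℂ} (hω : ω ≠ 0) (J K : Finset E) {d d' : ℤ} {dp : ι → ℤ}
    (hd : IsInitialWeight (scalingWeight J K) d F.numer)
    (hdp : ∀ i, IsInitialWeight (scalingWeight J K) (dp i) (F.poly i)) {n : ℕ}
    (hd' : (F.eulerNumer v b).WeightGE (scalingWeight J K) d') (hn : d' = d + ∑ i, dp i + n)
    (hG : F.eulerNumer v b ≠ 0) {w : MvPolynomial R ℂ} (hw : F.HasDivergenceDegree J K w) :
    ∃ k : ℕ, n ≤ k ∧
      (F.eulerIntegrand v b ω hω).HasDivergenceDegree J K (w + (k : MvPolynomial R ℂ)) := by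
  obtain ⟨dG, hdG⟩ := exists_isInitialWeight (scalingWeight J K) hG
  have hle : d' ≤ dG := by
    obtain ⟨-, m, hm, rfl⟩ := hdG
    exact hd' m hm
  -- Cancellation in the numerator may raise its lowest weight beyond the guaranteed d'; k is this
  -- excess. The sum of the dp i contained in d' is offset by the lowered exponents.
  obtain ⟨k, hk⟩ := Int.eq_ofNat_of_zero_le (sub_nonneg.2 hle)
  refine ⟨n + k, Nat.le_add_right _ _, ?_⟩
  rw [hasDivergenceDegree_iff (F.eulerIntegrand v b ω hω) J K hdG hdp,
    (F.hasDivergenceDegree_iff J K hd hdp w).1 hw]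
  have hdG' : dG = d + ∑ i, dp i + n + k := by omega
  change _ = _ + (_ + ∑ i, (dp i : MvPolynomial R ℂ) * (F.expo i - 1))
  rw [hdG']
  simp only [mul_sub, Finset.sum_sub_distrib, mul_one]
  push_cast
  ring

end ParametricIntegrand

theorem lemma5p2 {E R ι : Type*} [Fintype E] [DecidableEq E] [Fintype R] [Fintype ι]
    (F : ParametricIntegrand E R ι) (hF : F.numer ≠ 0)
    (J K : Finset E) (hJK : Disjoint J K) (hne : (J ∪ K).Nonempty) (hss : J ∪ K ≠ Finset.univ) :
    -- the degrees of divergence of `F` are well defined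
    (∀ J' K' : Finset E, Disjoint J' K' →
      ∃! w : MvPolynomial R ℂ, F.HasDivergenceDegree J' K' w) ∧
    ∀ ω : MvPolynomial R ℂ, F.HasDivergenceDegree J K ω → ω ≠ 0 →
      -- the operator turns `F` into a new parametric integrand `G`
      ∃ G : ParametricIntegrand E R ι,
        G.poly = F.poly ∧ G.denom = F.denom * ω ∧
        (∀ z : R → ℂ, MvPolynomial.eval z (F.denom * ω) ≠ 0 →
          ∀ α : E → ℝ, (∀ e, 0 < α e) →
            G.value z α = anapartial J K (MvPolynomial.eval z ω) (F.value z) α) ∧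
        -- the analytically regularized integrals agree
        (∀ e₀ : E, (interior (F.convergenceSet e₀)).Nonempty →
          ∃ I : (R → ℂ) → ℂ,
            F.IsAnalyticRegularization e₀ I ∧ G.IsAnalyticRegularization e₀ I) ∧
        -- no degree of divergence decreases (all of them are infinite if `G` vanishes)
        (∀ J' K' : Finset E, Disjoint J' K' → ∀ w : MvPolynomial R ℂ,
          F.HasDivergenceDegree J' K' w →
            G.numer = 0 ∨ ∃ k : ℕ, G.HasDivergenceDegree J' K' (w + (k : MvPolynomial R ℂ))) ∧
        -- the degree of divergence for `J`, `K` increases at least by one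
        (G.numer = 0 ∨
          ∃ k : ℕ, 1 ≤ k ∧ G.HasDivergenceDegree J K (ω + (k : MvPolynomial R ℂ))) := by
  classical
  have hex : ∀ J' K' : Finset E, ∃ (d : ℤ) (dp : ι → ℤ),
      MvPolynomial.IsInitialWeight (scalingWeight J' K') d F.numer ∧
      ∀ i, MvPolynomial.IsInitialWeight (scalingWeight J' K') (dp i) (F.poly i) := by
    intro J' K'
    obtain ⟨d, hd⟩ := MvPolynomial.exists_isInitialWeight (scalingWeight J' K') hF
    choose dp hdp using fun i =>
      MvPolynomial.exists_isInitialWeight (scalingWeight J' K') (F.poly_ne_zero i)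
    exact ⟨d, dp, hd, hdp⟩
  refine ⟨fun J' K' _ => ?_, fun ω hω hω0 => ?_⟩
  · obtain ⟨d, dp, hd, hdp⟩ := hex J' K'
    exact ⟨_, (F.hasDivergenceDegree_iff J' K' hd hdp _).2 rfl,
      fun w hw => (F.hasDivergenceDegree_iff J' K' hd hdp w).1 hw⟩
  · have hv : (∑ e, (scalingWeight J K e : MvPolynomial R ℂ)) = J.card - K.card := by
      simpa using sum_scalingWeight_mul hJK (fun _ => (1 : MvPolynomial R ℂ))
    set b : MvPolynomial R ℂ := ω - ∑ e, (scalingWeight J K e : MvPolynomial R ℂ) with hb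
    refine ⟨F.eulerIntegrand (scalingWeight J K) b ω hω0, rfl, rfl, ?_, ?_, ?_, ?_⟩
    · intro z hz α hα
      rw [map_mul] at hz
      have hωz := right_ne_zero_of_mul hz
      rw [F.eulerIntegrand_value _ b ω hω0 z hα, F.anapartial_value hJK _ z hα, hb, hv]
      simp only [map_sub, map_natCast]
      field_simp
      ring
    · exact fun e₀ he₀ => F.exists_isAnalyticRegularization_eulerIntegrand hF _ hω0 hb e₀ he₀
    · intro J' K' _ w hw
      by_cases hG : F.eulerNumer (scalingWeight J K) b = 0
      · exact Or.inl hG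
      · obtain ⟨d, dp, hd, hdp⟩ := hex J' K'
        obtain ⟨k, -, hk⟩ := F.eulerIntegrand_hasDivergenceDegree _ hω0 J' K' hd hdp (n := 0)
          (F.eulerNumer_weightGE _ b hd.1 fun i => (hdp i).1) (by simp) hG hw
        exact Or.inr ⟨k, hk⟩
    · by_cases hG : F.eulerNumer (scalingWeight J K) b = 0
      · exact Or.inl hG
      · obtain ⟨d, dp, hd, hdp⟩ := hex J K
        -- Here b is the degree of vanishing of F for (J, K), the one value for which the leading
        -- part is annihilated.
        have hb' : b = d + ∑ i, (dp i : MvPolynomial R ℂ) * F.expo i := by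
          rw [hb, hv, (F.hasDivergenceDegree_iff J K hd hdp ω).1 hω]
          ring
        obtain ⟨k, hk1, hk⟩ := F.eulerIntegrand_hasDivergenceDegree _ hω0 J K hd hdp (n := 1)
          (by rw [hb']; exact F.eulerNumer_weightGE_add_one _ hd.1 fun i => (hdp i).1)
          (by simp) hG hω
        exact Or.inr ⟨k, hk1, hk⟩
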